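/- **Notions.** A *second order non-commutative probability space* $(\mathcal A,\varphi,\rho)$ is a unital complex algebra $\mathcal A$ with a tracial linear functional $\varphi$, $\varphi(1)=1$, and a bilinear functional $\rho$, tracial in each argument, with $\rho(a,1)=0=\rho(1,b)$. A tuple $(a_1,\dots,a_n)$, $n\ge 1$, is *centered* if $\varphi(a_k)=0$ for all $k$, and *cyclically alternating* with respect to unital subalgebras $\mathcal A_1,\dots,\mathcal A_r$ if $a_k\in\mathcal A_{i(k)}$ with $i(k)\ne i(k+1)$ for all $k$ modulo $n$ (no condition if $n=1$). The subalgebras are *free with respect to $(\varphi,\rho)$* (free of second order) if they are free with respect to $\varphi$, and for all centered cyclically alternating $(a_1,\dots,a_n)$, $(b_1,\dots,b_m)$: $\rho(a_1\cdots a_n,b_1\cdots b_m)=0$ if $n\neq m$; $\rho(a,b)=0$ for $a\in\mathcal A_i,\ b\in\mathcal A_j$, $i\ne j$; and for $n=m\ge2$, $\rho(a_1\cdots a_n,b_1\cdots b_n)=\sum_{k=0}^{n-1}\prod_{j=1}^n\varphi(a_j b_{n+1-j+k})$ (indices modulo $n$). A sequence in $N$ of families $(A_i)_{i\in I}$ of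 $N\times N$ random matrices has the *second order limit distribution* given by $(a_i)_{i\in I}\subset\mathcal A$ in $(\mathcal A,\varphi,\rho)$ if for all polynomials $p_1,p_2,\dots$ in non-commuting indeterminates the classical cumulants $k_r$ exist and, as $N\to\infty$, $k_1\{\mathrm{tr}\,p_1(A)\}\to\varphi(p_1(a))$, $k_2\{\mathrm{Tr}\,p_1(A),\mathrm{Tr}\,p_2(A)\}\to\rho(p_1(a),p_2(a))$, and $k_r\{\mathrm{Tr}\,p_1(A),\dots,\mathrm{Tr}\,p_r(A)\}\to0$ for $r\ge3$ ($\mathrm{Tr}$ is the trace and $\mathrm{tr}=\frac1N\mathrm{Tr}$). Several families are *asymptotically free of second order* if jointly they have a second order limit distribution in some $(\mathcal A,\varphi,\rho)$ for which the unital algebras generated by the limits of the individual families are free with respect to $(\varphi,\rho)$. For a complex vector space $V$ with a positive semidefinite inner product $\langle\cdot,\cdot\rangle$ (linear in the first argument), let $\mathcal F(V)=\mathbb C\Omega\oplus\bigoplus_{n\ge1}V^{\otimes n}$ be the algebraic full Fock space with $l(f)$, $l^*(f)$ the creation and annihilation operators, $l^*(f)\Omega=0$, $l^*(f)(f_1\otimes\cdots\otimes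 f_n)=\langle f_1,f\rangle f_2\otimes\cdots\otimes f_n$. Let $\mathcal F_{cyc}(V)$ be the algebraic cyclic Fock space, spanned by circular tensors $[f_1\otimes\cdots\otimes f_n]=[f_2\otimes\cdots\otimes f_n\otimes f_1]$, with $\langle[f_1\otimes\cdots\otimes f_n],[g_1\otimes\cdots\otimes g_m]\rangle_{cyc}=\delta_{nm}\sum_{k=0}^{n-1}\prod_{i}\langle f_i,g_{i+k}\rangle$ (indices of $g$ modulo $n$). **Theorem.** (1) *Gaussian case.* Let $\mathcal H_{\mathbb R}$ be a real Hilbert space (completeness plays no role) with complexification $\mathcal H$ and conjugation $f\mapsto\bar f$. For $f\in\mathcal H$ put $\omega(f)=l(f)+l^*(\bar f)$ on $\mathcal F(\mathcal H)$, and let $\mathcal A$ be the unital $*$-algebra generated by all $\omega(f)$. Define $\mathbf c:\mathcal F(\mathcal H)\to\mathcal F_{cyc}(\mathcal H)$ linearly by $\mathbf c\,\Omega=0$, $\mathbf c f=[f]$, $\mathbf c(f_1\otimes\cdots\otimes f_n)=[f_1\otimes\cdots\otimes f_n]+\langle f_1,\bar f_n\rangle\,\mathbf c(f_2\otimes\cdots\otimes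 f_{n-1})$ for $n\ge2$, and put $\varphi(a)=\langle a\Omega,\Omega\rangle$, $\rho(a,b)=\langle\mathbf c\,a\Omega,\mathbf c\,b^*\Omega\rangle_{cyc}$. Then $(\mathcal A,\varphi,\rho)$ is a second order non-commutative probability space. If $\mathcal K_1,\dots,\mathcal K_n$ are pairwise orthogonal subspaces of $\mathcal H_{\mathbb R}$, or pairwise orthogonal complex subspaces of $\mathcal H$ invariant under conjugation, and $\mathcal A_i$ is the unital algebra generated by $\{\omega(f):f\in\mathcal K_i\}$, then $\mathcal A_1,\dots,\mathcal A_n$ are free with respect to $(\varphi,\rho)$. Let, for each $N$, $\{X_N(f)\}_{f\in\mathcal H_{\mathbb R}}$ be a family of Hermitian Gaussian random $N\times N$ matrices, that is, the entries $x_{ij}(f)$ form a centered (jointly) Gaussian family with $E\{x_{ij}(f)x_{kl}(g)\}=0$ for $i<j$, $k<l$ and $E\{x_{ij}(f)\overline{x_{kl}(g)}\}=\delta_{ik}\delta_{jl}\frac1N\langle f,g\rangle$ for $i\le j$, $k\le l$. Then $\{X_N(f)\}_f$ has the second order limit distribution given by $\{\omega(f)\}_{f}$ in $(\mathcal A,\varphi,\rho)$;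 and for pairwise orthogonal subspaces $\mathcal K_1,\dots,\mathcal K_n\subset\mathcal H_{\mathbb R}$ the families $\{X_N(f)\}_{f\in\mathcal K_1},\dots,\{X_N(f)\}_{f\in\mathcal K_n}$ are asymptotically free of second order. (2) *Compound Wishart case.* Let $\mathcal D$ be a unital $*$-algebra with a tracial state $\psi$, with $\langle d,e\rangle=\psi(e^*d)$, and let $d_1,\dots,d_p\in\mathcal D$. On $\mathcal F(\mathcal D)$ let $\Lambda(d)\Omega=0$, $\Lambda(d)(e_1\otimes\cdots\otimes e_n)=(de_1)\otimes e_2\otimes\cdots\otimes e_n$ and $p(d)=l(d)+l^*(d^*)+\Lambda(d)+\psi(d)1$, and let $\mathcal A$ be the unital $*$-algebra generated by all $p(d)$, with $p(d)^*=p(d^*)$. Define $\mathbf c:\mathcal F(\mathcal D)\to\mathcal F_{cyc}(\mathcal D)$ linearly by $\mathbf c\,\Omega=0$, $\mathbf c\,e=[e]$, $\mathbf c(e_1\otimes\cdots\otimes e_n)=[e_1\otimes\cdots\otimes e_n]+[e_ne_1\otimes e_2\otimes\cdots\otimes e_{n-1}]+\psi(e_1e_n)\,\mathbf c(e_2\otimes\cdots\otimes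 e_{n-1})$ for $n\ge2$, and $\varphi(a)=\langle a\Omega,\Omega\rangle$, $\rho(a,b)=\langle\mathbf c\,a\Omega,\mathbf c\,b^*\Omega\rangle_{cyc}$. Then $(\mathcal A,\varphi,\rho)$ is a second order non-commutative probability space, and if $d_id_j=0$ for all $i\ne j$, then the unital algebras $\mathcal A_i$ generated by $p(d_i)$ are free with respect to $(\varphi,\rho)$. Let $X_N$ be complex Gaussian random $N\times N$ matrices (independent centered complex Gaussian entries of variance $1/N$), and let $D^{(N)}_1,\dots,D^{(N)}_p$ be deterministic $N\times N$ matrices converging in distribution to $(d_1,\dots,d_p)$, that is, $\mathrm{tr}[D^{(N)}_{i_1}\cdots D^{(N)}_{i_k}]\to\psi(d_{i_1}\cdots d_{i_k})$ for all words. Then $\{X_N^*D^{(N)}_iX_N\}_{i}$ has the second order limit distribution given by $\{p(d_i)\}_i$ in $(\mathcal A,\varphi,\rho)$; and if $d_id_j=0$ for all $i\neq j$, then the sequences $X_N^*D^{(N)}_1X_N,\dots,X_N^*D^{(N)}_pX_N$ are asymptotically free of second order. -/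

import Mathlib

open MeasureTheory ProbabilityTheory Filter Topology
open scoped TensorProduct DirectSum NNReal

noncomputable section

namespace SecondOrder

/-! ### Second order non-commutative probability spaces and second order freeness -/

section Freeness

universe u

variable {A : Type u} [Ring A] [Algebra ℂ A]

/-- `(A, φ, ρ)` is a second order non-commutative probability space: `φ` is a unital tracial linear
functional and `ρ` is a bilinear functional, tracial in each argument, which vanishes as soon
as one of its arguments is `1`. -/
structure IsSecondOrderSpace (φ : A →ₗ[ℂ] ℂ) (ρ : A →ₗ[ℂ] A →ₗ[ℂ] ℂ) : Prop where
  map_one : φ 1 = 1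
  trace : ∀ a b, φ (a * b) = φ (b * a)
  trace_left : ∀ a b c, ρ (a * b) c = ρ (b * a) c
  trace_right : ∀ a b c, ρ a (b * c) = ρ a (c * b)
  one_right : ∀ a, ρ a 1 = 0
  one_left : ∀ b, ρ 1 b = 0

/-- The product `a₁ ⋯ aₙ` of a tuple, in this order. -/
def tupleProd {n : ℕ} (a : Fin n → A) : A := (List.ofFn a).prod

/-- All entries of the tuple have `φ`-mean zero. -/
def IsCentered (φ : A →ₗ[ℂ] ℂ) {n : ℕ} (a : Fin n → A) : Prop := ∀ k, φ (a k) = 0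

/-- The entries of the tuple come from subalgebras such that, for `n ≥ 2`, cyclic neighbours come
from subalgebras with different indices (`finRotate n` is `k ↦ k + 1` modulo `n`). -/
def IsCyclicallyAlternating {ι : Type*} (B : ι → Subalgebra ℂ A) {n : ℕ} (a : Fin n → A) : Prop :=
  ∃ i : Fin n → ι, (∀ k, a k ∈ B (i k)) ∧ (2 ≤ n → ∀ k, i k ≠ i (finRotate n k))

/-- Freeness (of first order) of a family of unital subalgebras with respect to `φ`. -/
def IsFree {ι : Type*} (φ : A →ₗ[ℂ] ℂ) (B : ι → Subalgebra ℂ A) : Prop :=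
  ∀ (n : ℕ) (a : Fin n → A) (i : Fin n → ι), 1 ≤ n → (∀ k, a k ∈ B (i k)) →
    (∀ k l : Fin n, (k : ℕ) + 1 = l → i k ≠ i l) → IsCentered φ a → φ (tupleProd a) = 0

/-- Freeness of second order of a family of unital subalgebras with respect to `(φ, ρ)`. In the
last condition indices of `a` increase while those of `b` decrease, everything modulo `n`:
with indices starting at `1`, the factors are `φ(a_j b_{n+1-j+k})`. -/
structure IsSecondOrderFree {ι : Type*} (φ : A →ₗ[ℂ] ℂ) (ρ : A →ₗ[ℂ] A →ₗ[ℂ] ℂ)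
    (B : ι → Subalgebra ℂ A) : Prop where
  free : IsFree φ B
  of_ne : ∀ (n m : ℕ) (a : Fin n → A) (b : Fin m → A), 1 ≤ n → 1 ≤ m →
    IsCyclicallyAlternating B a → IsCyclicallyAlternating B b → IsCentered φ a → IsCentered φ b →
    n ≠ m → ρ (tupleProd a) (tupleProd b) = 0
  single : ∀ (i j : ι), i ≠ j → ∀ a ∈ B i, ∀ b ∈ B j, ρ a b = 0
  of_eq : ∀ (n : ℕ) (a b : Fin n → A), 2 ≤ n →
    IsCyclicallyAlternating B a → IsCyclicallyAlternating B b → IsCentered φ a → IsCentered φ b →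
    ρ (tupleProd a) (tupleProd b) = ∑ k : Fin n, ∏ j : Fin n, φ (a j * b (Fin.rev j + k))

end Freeness

/-! ### Random matrices: cumulants, second order limits, asymptotic freeness of second order -/

section RandomMatrices

/-- The classical cumulant `k_r(Y₁, …, Y_r)` of complex random variables: the sum over all
partitions of the index set of the Möbius weight times the product over blocks of moments. -/
def cumulant {Ω : Type*} [MeasurableSpace Ω] (P : Measure Ω) {r : ℕ} (Y : Fin r → Ω → ℂ) : ℂ :=
  ∑ π : Finpartition (Finset.univ : Finset (Fin r)),
    (-1 : ℂ) ^ (π.parts.card - 1) * (Nat.factorial (π.parts.card - 1) : ℂ) *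
      ∏ b ∈ π.parts, ∫ ω, ∏ i ∈ b, Y i ω ∂P

/-- The (unnormalized) trace of the polynomial `p` in non-commuting indeterminates, evaluated at
a family of matrices. -/
def polyTr {I : Type*} {N : ℕ} (p : FreeAlgebra ℂ I) (A : I → Matrix (Fin N) (Fin N) ℂ) : ℂ :=
  Matrix.trace (FreeAlgebra.lift ℂ A p)

/-- The sequence (in `N`) of families of `N × N` random matrices `A N i` has the second order limit
distribution given by the family `a` in the second order space `(𝒜, φ, ρ)`. The
field `integrable` records that all cumulants involved are well defined. -/
structure HasSecondOrderLimit {I : Type*} {Ω : ℕ → Type*} [∀ N, MeasurableSpace (Ω N)]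
    (P : ∀ N, Measure (Ω N)) (A : ∀ N, I → Ω N → Matrix (Fin N) (Fin N) ℂ)
    {𝒜 : Type*} [Ring 𝒜] [Algebra ℂ 𝒜] (φ : 𝒜 →ₗ[ℂ] ℂ) (ρ : 𝒜 →ₗ[ℂ] 𝒜 →ₗ[ℂ] ℂ)
    (a : I → 𝒜) : Prop where
  space : IsSecondOrderSpace φ ρ
  integrable : ∀ (N r : ℕ) (p : Fin r → FreeAlgebra ℂ I),
    Integrable (fun ω => ∏ j, polyTr (p j) (fun i => A N i ω)) (P N)
  tendsto_one : ∀ p : FreeAlgebra ℂ I,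
    Tendsto (fun N : ℕ => cumulant (P N)
        (fun (_ : Fin 1) ω => (N : ℂ)⁻¹ * polyTr p (fun i => A N i ω))) atTop
      (𝓝 (φ (FreeAlgebra.lift ℂ a p)))
  tendsto_two : ∀ p : Fin 2 → FreeAlgebra ℂ I,
    Tendsto (fun N : ℕ => cumulant (P N) (fun j ω => polyTr (p j) (fun i => A N i ω))) atTop
      (𝓝 (ρ (FreeAlgebra.lift ℂ a (p 0)) (FreeAlgebra.lift ℂ a (p 1))))
  tendsto_zero : ∀ r : ℕ, 3 ≤ r → ∀ p : Fin r → FreeAlgebra ℂ I,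
    Tendsto (fun N : ℕ => cumulant (P N) (fun j ω => polyTr (p j) (fun i => A N i ω))) atTop (𝓝 0)

/-- Families `(A N k j)_{j ∈ J k}`, one for each `k`, of sequences of random matrices are
asymptotically free of second order: jointly they have a second order limit distribution,
given by `(𝒜, φ, ρ)` and elements `a k j`, and the unital algebras generated by the families
`(a k j)_j` are free with respect to `(φ, ρ)`. -/
def AsymptoticallyFreeSecondOrder.{v, w, x, y} {K : Type w} {J : K → Type x} {Ω : ℕ → Type y}
    [∀ N, MeasurableSpace (Ω N)] (P : ∀ N, Measure (Ω N))
    (A : ∀ N, (k : K) → J k → Ω N → Matrix (Fin N) (Fin N) ℂ) : Prop :=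
  ∃ (𝒜 : Type v) (_ : Ring 𝒜) (_ : Algebra ℂ 𝒜) (φ : 𝒜 →ₗ[ℂ] ℂ) (ρ : 𝒜 →ₗ[ℂ] 𝒜 →ₗ[ℂ] ℂ)
    (a : (k : K) → J k → 𝒜),
    HasSecondOrderLimit P (fun N (s : Σ k, J k) => A N s.1 s.2) φ ρ (fun s => a s.1 s.2) ∧
    IsSecondOrderFree φ ρ (fun k => Algebra.adjoin ℂ (Set.range (a k)))

/-- A family `X(f)`, `f ∈ H_ℝ`, of Hermitian Gaussian random `N × N` matrices: the real and imaginary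
parts of all the entries form a centred Gaussian family, with the stated covariances. -/
structure IsHermitianGaussianFamily {E : Type*} [NormedAddCommGroup E] [InnerProductSpace ℝ E]
    {Ω : Type*} [MeasurableSpace Ω] (P : Measure Ω) {N : ℕ}
    (X : E → Ω → Matrix (Fin N) (Fin N) ℂ) : Prop where
  hermitian : ∀ f, ∀ᵐ ω ∂P, (X f ω).IsHermitian
  gaussian : IsGaussianProcess (fun (t : E × Fin N × Fin N × Bool) ω =>
    if t.2.2.2 then (X t.1 ω t.2.1 t.2.2.1).re else (X t.1 ω t.2.1 t.2.2.1).im) P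
  centered : ∀ f i j, ∫ ω, X f ω i j ∂P = 0
  cov : ∀ f g i j k l, i < j → k < l → ∫ ω, X f ω i j * X g ω k l ∂P = 0
  cov_conj : ∀ f g i j k l, i ≤ j → k ≤ l →
    ∫ ω, X f ω i j * (starRingEnd ℂ) (X g ω k l) ∂P =
      if i = k ∧ j = l then (N : ℂ)⁻¹ * ((inner ℝ f g : ℝ) : ℂ) else 0

/-- A complex Gaussian random `N × N` matrix: the entries are independent centred complex Gaussians
with variance `1 / N`, that is, the real and the imaginary parts of all entries are independent
centred real Gaussians with variance `1 / (2 N)`. -/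
structure IsComplexGaussianMatrix {Ω : Type*} [MeasurableSpace Ω] (P : Measure Ω) {N : ℕ}
    (X : Ω → Matrix (Fin N) (Fin N) ℂ) : Prop where
  indep : iIndepFun (fun (t : Fin N × Fin N × Bool) ω =>
    if t.2.2 then (X ω t.1 t.2.1).re else (X ω t.1 t.2.1).im) P
  law : ∀ i j, HasLaw (fun ω => (X ω i j).re) (gaussianReal 0 (2 * (N : ℝ≥0))⁻¹) P ∧
    HasLaw (fun ω => (X ω i j).im) (gaussianReal 0 (2 * (N : ℝ≥0))⁻¹) P

end RandomMatrices

/-! ### Algebraic full (linear) Fock space -/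

section Fock

universe u

/-- The orthogonal sum of a sequence of sesquilinear forms, linear in the first and
antilinear in the second argument. -/
def sumForm {M : ℕ → Type u} [∀ n, AddCommGroup (M n)] [∀ n, Module ℂ (M n)]
    (s : ∀ n, M n →ₗ[ℂ] M n →ₗ⋆[ℂ] ℂ) : (⨁ n, M n) →ₗ[ℂ] (⨁ n, M n) →ₗ⋆[ℂ] ℂ :=
  DirectSum.toModule ℂ ℕ _ fun n =>
    { toFun := fun x => (s n x).comp (DirectSum.component ℂ ℕ M n)
      map_add' := fun x y => by ext z; simp
      map_smul' := fun c x => by ext z; simp }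

theorem sumForm_of {M : ℕ → Type u} [∀ n, AddCommGroup (M n)] [∀ n, Module ℂ (M n)]
    (s : ∀ n, M n →ₗ[ℂ] M n →ₗ⋆[ℂ] ℂ) (n : ℕ) (x : M n) (y : ⨁ n, M n) :
    sumForm s (DirectSum.lof ℂ ℕ M n x) y = s n x (y n) := by
  simp [sumForm, DirectSum.component]
  rfl

variable {V : Type u} [AddCommGroup V] [Module ℂ V]

/-- For a tuple `f`, the linear functional `g₁ ⊗ ⋯ ⊗ gₙ ↦ ∏ᵢ conj ⟨fᵢ, gᵢ⟩`. -/
def tensorFunctional (h : V →ₗ[ℂ] V →ₗ⋆[ℂ] ℂ) (n : ℕ) (f : Fin n → V) : ⨂[ℂ]^n V →ₗ[ℂ] ℂ :=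
  PiTensorProduct.lift ((MultilinearMap.mkPiAlgebra ℂ (Fin n) ℂ).compLinearMap
    fun i => (starLinearEquiv ℂ (A := ℂ)).toLinearMap.comp (h (f i)))

theorem tensorFunctional_tprod (h : V →ₗ[ℂ] V →ₗ⋆[ℂ] ℂ) (n : ℕ) (f g : Fin n → V) :
    tensorFunctional h n f (PiTensorProduct.tprod ℂ g) =
      ∏ i, (starRingEnd ℂ) (h (f i) (g i)) := by
  simp [tensorFunctional]

theorem prod_update (h : V →ₗ[ℂ] V →ₗ⋆[ℂ] ℂ) {n : ℕ} (m g : Fin n → V) (i : Fin n) (z : V) :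
    ∏ j, h (Function.update m i z j) (g j) =
      h z (g i) * ∏ j ∈ Finset.univ.erase i, h (m j) (g j) := by
  rw [← Finset.mul_prod_erase Finset.univ _ (Finset.mem_univ i), Function.update_self]
  congr 1
  refine Finset.prod_congr rfl fun j hj => ?_
  rw [Function.update_of_ne (Finset.ne_of_mem_erase hj)]

/-- The inner product on `V^{⊗n}`: `⟨f₁ ⊗ ⋯ ⊗ fₙ, g₁ ⊗ ⋯ ⊗ gₙ⟩ = ∏ᵢ ⟨fᵢ, gᵢ⟩`. -/
def tensorForm (h : V →ₗ[ℂ] V →ₗ⋆[ℂ] ℂ) (n : ℕ) : ⨂[ℂ]^n V →ₗ[ℂ] ⨂[ℂ]^n V →ₗ⋆[ℂ] ℂ :=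
  PiTensorProduct.lift (MultilinearMap.mk'
    (fun f => (starLinearEquiv ℂ (A := ℂ)).toLinearMap.comp (tensorFunctional h n f))
    (fun m i x y => by
      ext z
      induction z using PiTensorProduct.induction_on with
      | smul_tprod c g =>
        simp [tensorFunctional_tprod, prod_update, add_mul, mul_add]
      | add a b ha hb => rw [map_add, map_add, ha, hb])
    (fun m i c x => by
      ext z
      induction z using PiTensorProduct.induction_on with
      | smul_tprod d g =>
        simp [tensorFunctional_tprod, prod_update, mul_assoc, mul_left_comm]
      | add a b ha hb => rw [map_add, map_add, ha, hb]))

theorem tensorForm_tprod (h : V →ₗ[ℂ] V →ₗ⋆[ℂ] ℂ) (n : ℕ) (f g : Fin n → V) :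
    tensorForm h n (PiTensorProduct.tprod ℂ f) (PiTensorProduct.tprod ℂ g) =
      ∏ i, h (f i) (g i) := by
  simp [tensorForm, tensorFunctional_tprod]

variable (V) in
/-- The algebraic full Fock space `ℂΩ ⊕ V ⊕ V^{⊗2} ⊕ ⋯`. -/
abbrev Fock : Type u := ⨁ n : ℕ, ⨂[ℂ]^n V

/-- The elementary tensor `f₁ ⊗ ⋯ ⊗ fₙ` in the Fock space. -/
def word {n : ℕ} (f : Fin n → V) : Fock V :=
  DirectSum.lof ℂ ℕ (fun n => ⨂[ℂ]^n V) n (PiTensorProduct.tprod ℂ f)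

variable (V) in
/-- The vacuum vector `Ω`. -/
def vacuum : Fock V := word (n := 0) Fin.elim0

/-- The inner product of the full Fock space. -/
def fockForm (h : V →ₗ[ℂ] V →ₗ⋆[ℂ] ℂ) : Fock V →ₗ[ℂ] Fock V →ₗ⋆[ℂ] ℂ :=
  sumForm (tensorForm h)

/-- The creation operator `l(f)`: `f₁ ⊗ ⋯ ⊗ fₙ ↦ f ⊗ f₁ ⊗ ⋯ ⊗ fₙ`. -/
def creation (f : V) : Module.End ℂ (Fock V) :=
  DirectSum.toModule ℂ ℕ _ fun n =>
    (DirectSum.lof ℂ ℕ (fun n => ⨂[ℂ]^n V) (n + 1)).comp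
      (PiTensorProduct.lift
        ((PiTensorProduct.tprod ℂ (s := fun _ : Fin (n + 1) => V)).curryLeft f))

/-- The annihilation operator `l*(f)`: `Ω ↦ 0`, `f₁ ⊗ ⋯ ⊗ fₙ ↦ ⟨f₁, f⟩ f₂ ⊗ ⋯ ⊗ fₙ`. -/
def annihilation (h : V →ₗ[ℂ] V →ₗ⋆[ℂ] ℂ) (f : V) : Module.End ℂ (Fock V) :=
  DirectSum.toModule ℂ ℕ _ fun n =>
    match n with
    | 0 => 0
    | n + 1 => (DirectSum.lof ℂ ℕ (fun n => ⨂[ℂ]^n V) n).comp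
        (PiTensorProduct.lift (LinearMap.uncurryLeft (M := fun _ : Fin (n + 1) => V)
          { toFun := fun v => h v f • PiTensorProduct.tprod ℂ
            map_add' := fun v w => by rw [map_add, LinearMap.add_apply, add_smul]
            map_smul' := fun c v => by simp [mul_smul] }))

/-- The preservation operator of an operator `T` on `V`:
`Ω ↦ 0`, `f₁ ⊗ f₂ ⊗ ⋯ ⊗ fₙ ↦ (T f₁) ⊗ f₂ ⊗ ⋯ ⊗ fₙ`. -/
def preservation (T : Module.End ℂ V) : Module.End ℂ (Fock V) :=
  DirectSum.toModule ℂ ℕ _ fun n =>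
    match n with
    | 0 => 0
    | n + 1 => (DirectSum.lof ℂ ℕ (fun n => ⨂[ℂ]^n V) (n + 1)).comp
        (PiTensorProduct.map fun i : Fin (n + 1) => if i = 0 then T else LinearMap.id)

theorem creation_word (f : V) {n : ℕ} (g : Fin n → V) :
    creation f (word g) = word (Fin.cons f g : Fin (n + 1) → V) := by
  simp [creation, word]

theorem annihilation_vacuum (h : V →ₗ[ℂ] V →ₗ⋆[ℂ] ℂ) (f : V) (g : Fin 0 → V) :
    annihilation h f (word g) = 0 := by
  simp [annihilation, word]

theorem annihilation_word (h : V →ₗ[ℂ] V →ₗ⋆[ℂ] ℂ) (f : V) {n : ℕ} (g : Fin (n + 1) → V) :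
    annihilation h f (word g) = h (g 0) f • word (Fin.tail g) := by
  simp [annihilation, word]

theorem preservation_vacuum (T : Module.End ℂ V) (g : Fin 0 → V) :
    preservation T (word g) = 0 := by
  simp [preservation, word]

theorem preservation_word (T : Module.End ℂ V) {n : ℕ} (g : Fin (n + 1) → V) :
    preservation T (word g) = word (Fin.cons (T (g 0)) (Fin.tail g) : Fin (n + 1) → V) := by
  have : (fun i : Fin (n + 1) => (if i = 0 then T else LinearMap.id) (g i)) =
      (Fin.cons (T (g 0)) (Fin.tail g) : Fin (n + 1) → V) := by
    funext i
    refine Fin.cases ?_ (fun j => ?_) i <;> simp [Fin.tail]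
  simp [preservation, word, ← this]

theorem fockForm_word_ne (h : V →ₗ[ℂ] V →ₗ⋆[ℂ] ℂ) {n m : ℕ} (hnm : n ≠ m)
    (f : Fin n → V) (g : Fin m → V) : fockForm h (word f) (word g) = 0 := by
  rw [fockForm, word, sumForm_of, word, DirectSum.lof_eq_of, DirectSum.of_eq_of_ne _ _ _ hnm,
    map_zero]

theorem fockForm_word (h : V →ₗ[ℂ] V →ₗ⋆[ℂ] ℂ) {n : ℕ} (f g : Fin n → V) :
    fockForm h (word f) (word g) = ∏ i, h (f i) (g i) := by
  rw [fockForm, word, sumForm_of, word, DirectSum.lof_eq_of, DirectSum.of_eq_same,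
    tensorForm_tprod]

theorem fock_induction {p : Fock V → Prop} (hw : ∀ (n : ℕ) (f : Fin n → V), p (word f))
    (hs : ∀ (c : ℂ) x, p x → p (c • x)) (ha : ∀ x y, p x → p y → p (x + y)) (x : Fock V) : p x := by
  induction x using DirectSum.induction_on with
  | zero => simpa using hs 0 _ (hw 0 Fin.elim0)
  | of n x =>
    induction x using PiTensorProduct.induction_on with
    | smul_tprod c f =>
      rw [← DirectSum.lof_eq_of ℂ, map_smul]
      exact hs c _ (hw n f)
    | add a b hha hhb => rw [map_add]; exact ha _ _ hha hhb
  | add x y hx hy => exact ha _ _ hx hy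

/-- Two operators are formal adjoints of each other if this is so on elementary tensors. -/
theorem adjoint_of_words (s : Fock V →ₗ[ℂ] Fock V →ₗ⋆[ℂ] ℂ) (a b : Module.End ℂ (Fock V))
    (hab : ∀ (n m : ℕ) (f : Fin n → V) (g : Fin m → V),
      s (a (word f)) (word g) = s (word f) (b (word g))) (x y : Fock V) :
    s (a x) y = s x (b y) := by
  induction x using fock_induction with
  | hs c x hx => simp only [map_smul, LinearMap.smul_apply, hx]
  | ha x x' hx hx' => simp only [map_add, LinearMap.add_apply, hx, hx']
  | hw n f =>
    induction y using fock_induction with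
    | hs c x hx => simp only [map_smul, map_smulₛₗ, hx]
    | ha x x' hx hx' => simp only [map_add, hx, hx']
    | hw m g => exact hab n m f g

theorem creation_adjoint (h : V →ₗ[ℂ] V →ₗ⋆[ℂ] ℂ)
    (hh : ∀ v w, h v w = (starRingEnd ℂ) (h w v)) (f : V) (x y : Fock V) :
    fockForm h (creation f x) y = fockForm h x (annihilation h f y) := by
  refine adjoint_of_words _ _ _ (fun n m u v => ?_) x y
  rw [creation_word]
  cases m with
  | zero => rw [annihilation_vacuum, map_zero, fockForm_word_ne _ (by omega)]
  | succ m =>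
    rw [annihilation_word, map_smulₛₗ]
    by_cases hnm : n = m
    · subst hnm
      rw [fockForm_word, fockForm_word, Fin.prod_univ_succ, hh]
      simp [Fin.tail]
    · rw [fockForm_word_ne _ (by omega), fockForm_word_ne _ hnm, smul_zero]

theorem annihilation_adjoint (h : V →ₗ[ℂ] V →ₗ⋆[ℂ] ℂ) (f : V) (x y : Fock V) :
    fockForm h (annihilation h f x) y = fockForm h x (creation f y) := by
  refine adjoint_of_words _ _ _ (fun n m u v => ?_) x y
  rw [creation_word]
  cases n with
  | zero => rw [annihilation_vacuum, map_zero, LinearMap.zero_apply, fockForm_word_ne _ (by omega)]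
  | succ n =>
    rw [annihilation_word, map_smul, LinearMap.smul_apply]
    by_cases hnm : n = m
    · subst hnm
      rw [fockForm_word, fockForm_word, Fin.prod_univ_succ]
      simp [Fin.tail]
    · rw [fockForm_word_ne _ hnm, fockForm_word_ne _ (by omega), smul_zero]

theorem preservation_adjoint (h : V →ₗ[ℂ] V →ₗ⋆[ℂ] ℂ) (T S : Module.End ℂ V)
    (hTS : ∀ v w, h (T v) w = h v (S w)) (x y : Fock V) :
    fockForm h (preservation T x) y = fockForm h x (preservation S y) := by
  refine adjoint_of_words _ _ _ (fun n m u v => ?_) x y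
  rcases n with _ | n
  · rw [preservation_vacuum, map_zero, LinearMap.zero_apply]
    rcases m with _ | m
    · rw [preservation_vacuum, map_zero]
    · rw [preservation_word, fockForm_word_ne _ (by omega)]
  · rw [preservation_word]
    rcases m with _ | m
    · rw [preservation_vacuum, map_zero, fockForm_word_ne _ (by omega)]
    · rw [preservation_word]
      by_cases hnm : n = m
      · subst hnm
        rw [fockForm_word, fockForm_word, Fin.prod_univ_succ, Fin.prod_univ_succ]
        simp [Fin.tail, hTS]
      · rw [fockForm_word_ne _ (by omega), fockForm_word_ne _ (by omega)]

end Fock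

/-! ### Operators with a formal adjoint -/

section Adjointable

universe u

/-- Operators on a complex vector space with sesquilinear form `s` (linear in the first argument)
together with a formal adjoint: `⟨a x, y⟩ = ⟨x, a* y⟩` for all `x` and `y`. -/
@[ext]
structure AdjOp {F : Type u} [AddCommGroup F] [Module ℂ F] (s : F →ₗ[ℂ] F →ₗ⋆[ℂ] ℂ) :
    Type u where
  op : Module.End ℂ F
  adj : Module.End ℂ F
  rel : ∀ x y, s (op x) y = s x (adj y)

namespace AdjOp

variable {F : Type u} [AddCommGroup F] [Module ℂ F] {s : F →ₗ[ℂ] F →ₗ⋆[ℂ] ℂ}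

instance : Zero (AdjOp s) := ⟨⟨0, 0, by simp⟩⟩
instance : One (AdjOp s) := ⟨⟨1, 1, by simp⟩⟩
instance : Add (AdjOp s) := ⟨fun a b => ⟨a.op + b.op, a.adj + b.adj, by simp [a.rel, b.rel]⟩⟩
instance : Neg (AdjOp s) := ⟨fun a => ⟨-a.op, -a.adj, by simp [a.rel]⟩⟩
instance : Mul (AdjOp s) := ⟨fun a b => ⟨a.op * b.op, b.adj * a.adj, by simp [a.rel, b.rel]⟩⟩
instance : SMul ℂ (AdjOp s) :=
  ⟨fun c a => ⟨c • a.op, (starRingEnd ℂ c) • a.adj, by simp [a.rel, map_smulₛₗ]⟩⟩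

@[simp] theorem zero_op : (0 : AdjOp s).op = 0 := rfl
@[simp] theorem zero_adj : (0 : AdjOp s).adj = 0 := rfl
@[simp] theorem one_op : (1 : AdjOp s).op = 1 := rfl
@[simp] theorem one_adj : (1 : AdjOp s).adj = 1 := rfl
@[simp] theorem add_op (a b : AdjOp s) : (a + b).op = a.op + b.op := rfl
@[simp] theorem add_adj (a b : AdjOp s) : (a + b).adj = a.adj + b.adj := rfl
@[simp] theorem neg_op (a : AdjOp s) : (-a).op = -a.op := rfl
@[simp] theorem neg_adj (a : AdjOp s) : (-a).adj = -a.adj := rfl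
@[simp] theorem mul_op (a b : AdjOp s) : (a * b).op = a.op * b.op := rfl
@[simp] theorem mul_adj (a b : AdjOp s) : (a * b).adj = b.adj * a.adj := rfl
@[simp] theorem smul_op (c : ℂ) (a : AdjOp s) : (c • a).op = c • a.op := rfl
@[simp] theorem smul_adj (c : ℂ) (a : AdjOp s) : (c • a).adj = (starRingEnd ℂ c) • a.adj := rfl

instance : Ring (AdjOp s) where
  add_assoc a b c := by ext1 <;> simp [add_assoc]
  zero_add a := by ext1 <;> simp
  add_zero a := by ext1 <;> simp
  add_comm a b := by ext1 <;> simp [add_comm]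
  neg_add_cancel a := by ext1 <;> simp
  mul_assoc a b c := by ext1 <;> simp [mul_assoc]
  one_mul a := by ext1 <;> simp
  mul_one a := by ext1 <;> simp
  zero_mul a := by ext1 <;> simp
  mul_zero a := by ext1 <;> simp
  left_distrib a b c := by ext1 <;> simp [mul_add, add_mul]
  right_distrib a b c := by ext1 <;> simp [mul_add, add_mul]
  nsmul := nsmulRec
  zsmul := zsmulRec

instance : Module ℂ (AdjOp s) where
  one_smul a := by ext1 <;> simp
  mul_smul c d a := by ext1 <;> simp [mul_smul]
  smul_zero c := by ext1 <;> simp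
  smul_add c a b := by ext1 <;> simp
  add_smul c d a := by ext1 <;> simp [add_smul]
  zero_smul a := by ext1 <;> simp

instance : Algebra ℂ (AdjOp s) :=
  Algebra.ofModule (fun c a b => by ext1 <;> simp) (fun c a b => by ext1 <;> simp)

end AdjOp

end Adjointable

/-! ### Algebraic cyclic Fock space -/

section Cyclic

universe u

variable {V : Type u} [AddCommGroup V] [Module ℂ V]

variable (V) in
/-- The relations `f₁ ⊗ f₂ ⊗ ⋯ ⊗ fₙ ∼ f₂ ⊗ ⋯ ⊗ fₙ ⊗ f₁`. -/
def rotationRel (n : ℕ) : Submodule ℂ (⨂[ℂ]^n V) :=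
  Submodule.span ℂ (Set.range fun f : Fin n → V =>
    PiTensorProduct.tprod ℂ f - PiTensorProduct.tprod ℂ (f ∘ finRotate n))

variable (V) in
/-- The space of circular tensors `[f₁ ⊗ ⋯ ⊗ fₙ]`. -/
abbrev CircTensor (n : ℕ) : Type u := (⨂[ℂ]^n V) ⧸ rotationRel V n

variable (V) in
/-- The algebraic cyclic Fock space. -/
abbrev CycFock : Type u := ⨁ n : ℕ, CircTensor V n

/-- The map `f₁ ⊗ ⋯ ⊗ fₙ ↦ [f₁ ⊗ ⋯ ⊗ fₙ]`. -/
def circ (n : ℕ) : ⨂[ℂ]^n V →ₗ[ℂ] CycFock V :=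
  (DirectSum.lof ℂ ℕ (fun n => CircTensor V n) n).comp (rotationRel V n).mkQ

/-- The sesquilinear form
`(f₁ ⊗ ⋯ ⊗ fₙ, g₁ ⊗ ⋯ ⊗ gₙ) ↦ ∑_{k=0}^{n-1} ⟨f₁, g_{1+k}⟩ ⋯ ⟨fₙ, g_{n+k}⟩` (indices of `g` modulo `n`),
before passing to circular tensors. -/
def preCircForm (h : V →ₗ[ℂ] V →ₗ⋆[ℂ] ℂ) (n : ℕ) : ⨂[ℂ]^n V →ₗ[ℂ] ⨂[ℂ]^n V →ₗ⋆[ℂ] ℂ :=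
  ∑ k ∈ Finset.range n, (tensorForm h n).compl₂
    (PiTensorProduct.reindex ℂ (fun _ => V) ((finRotate n ^ k)⁻¹)).toLinearMap

theorem preCircForm_tprod (h : V →ₗ[ℂ] V →ₗ⋆[ℂ] ℂ) (n : ℕ) (f g : Fin n → V) :
    preCircForm h n (PiTensorProduct.tprod ℂ f) (PiTensorProduct.tprod ℂ g) =
      ∑ k ∈ Finset.range n, ∏ i, h (f i) (g ((finRotate n ^ k) i)) := by
  simp only [preCircForm, LinearMap.sum_apply, LinearMap.compl₂_apply, LinearEquiv.coe_coe]
  refine Finset.sum_congr rfl fun k _ => ?_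
  erw [PiTensorProduct.reindex_tprod]
  rw [tensorForm_tprod]
  rfl

theorem finRotate_pow_self (n : ℕ) : finRotate n ^ n = 1 := by
  rcases n with _ | _ | n
  · exact Subsingleton.elim _ _
  · ext i
    exact congrArg Fin.val (Subsingleton.elim (α := Fin 1) _ _)
  · have h := (isCycle_finRotate (n := n)).orderOf
    rw [support_finRotate, Finset.card_univ, Fintype.card_fin] at h
    exact orderOf_dvd_iff_pow_eq_one.mp (dvd_of_eq h)

theorem sum_finRotate_succ (n : ℕ) (t : Equiv.Perm (Fin n) → ℂ) :
    ∑ k ∈ Finset.range n, t (finRotate n ^ (k + 1)) = ∑ k ∈ Finset.range n, t (finRotate n ^ k) := by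
  have h1 := Finset.sum_range_succ (fun k => t (finRotate n ^ k)) n
  have h2 := Finset.sum_range_succ' (fun k => t (finRotate n ^ k)) n
  rw [h1] at h2
  simp only [finRotate_pow_self, pow_zero] at h2
  exact (add_right_cancel h2).symm

theorem preCircForm_rotate_right (h : V →ₗ[ℂ] V →ₗ⋆[ℂ] ℂ) (n : ℕ) (f g : Fin n → V) :
    preCircForm h n (PiTensorProduct.tprod ℂ f) (PiTensorProduct.tprod ℂ (g ∘ finRotate n)) =
      preCircForm h n (PiTensorProduct.tprod ℂ f) (PiTensorProduct.tprod ℂ g) := by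
  rw [preCircForm_tprod, preCircForm_tprod,
    ← sum_finRotate_succ n fun σ => ∏ i, h (f i) (g (σ i))]
  refine Finset.sum_congr rfl fun k _ => ?_
  simp [pow_succ']

theorem preCircForm_rotate_left (h : V →ₗ[ℂ] V →ₗ⋆[ℂ] ℂ) (n : ℕ) (f g : Fin n → V) :
    preCircForm h n (PiTensorProduct.tprod ℂ (f ∘ finRotate n)) (PiTensorProduct.tprod ℂ g) =
      preCircForm h n (PiTensorProduct.tprod ℂ f) (PiTensorProduct.tprod ℂ g) := by
  rw [preCircForm_tprod, preCircForm_tprod,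
    ← sum_finRotate_succ n fun σ => ∏ i, h ((f ∘ finRotate n) i) (g (σ i))]
  refine Finset.sum_congr rfl fun k _ => ?_
  rw [← Equiv.prod_comp (finRotate n) fun i => h (f i) (g ((finRotate n ^ k) i))]
  simp [pow_succ]

theorem rotationRel_le_right (h : V →ₗ[ℂ] V →ₗ⋆[ℂ] ℂ) (n : ℕ) (x : ⨂[ℂ]^n V) :
    rotationRel V n ≤ (preCircForm h n x).ker := by
  refine Submodule.span_le.mpr (Set.range_subset_iff.mpr fun g => ?_)
  rw [SetLike.mem_coe, LinearMap.mem_ker]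
  induction x using PiTensorProduct.induction_on with
  | smul_tprod c f =>
    rw [map_smul, LinearMap.smul_apply, map_sub, preCircForm_rotate_right, sub_self, smul_zero]
  | add a b ha hb => rw [map_add, LinearMap.add_apply, ha, hb, add_zero]

theorem rotationRel_le_left (h : V →ₗ[ℂ] V →ₗ⋆[ℂ] ℂ) (n : ℕ) :
    rotationRel V n ≤ (preCircForm h n).ker := by
  refine Submodule.span_le.mpr (Set.range_subset_iff.mpr fun f => ?_)
  rw [SetLike.mem_coe, LinearMap.mem_ker]
  ext z
  induction z using PiTensorProduct.induction_on with
  | smul_tprod c g =>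
    rw [map_smulₛₗ, map_sub, LinearMap.sub_apply, preCircForm_rotate_left, sub_self, smul_zero,
      LinearMap.zero_apply]
  | add a b ha hb => rw [map_add, ha, hb, map_add]

/-- The inner product on circular tensors of length `n`. -/
def circForm (h : V →ₗ[ℂ] V →ₗ⋆[ℂ] ℂ) (n : ℕ) : CircTensor V n →ₗ[ℂ] CircTensor V n →ₗ⋆[ℂ] ℂ :=
  (rotationRel V n).liftQ
    { toFun := fun x => (rotationRel V n).liftQ (preCircForm h n x) (rotationRel_le_right h n x)
      map_add' := fun x y => LinearMap.ext fun z => by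
        obtain ⟨z, rfl⟩ := Submodule.Quotient.mk_surjective _ z
        exact LinearMap.congr_fun (map_add (preCircForm h n) x y) z
      map_smul' := fun c x => LinearMap.ext fun z => by
        obtain ⟨z, rfl⟩ := Submodule.Quotient.mk_surjective _ z
        exact LinearMap.congr_fun (map_smul (preCircForm h n) c x) z }
    (fun x hx => LinearMap.mem_ker.mpr (LinearMap.ext fun z => by
        obtain ⟨z, rfl⟩ := Submodule.Quotient.mk_surjective _ z
        exact LinearMap.congr_fun (LinearMap.mem_ker.mp (rotationRel_le_left h n hx)) z))

/-- The inner product `⟨·, ·⟩_cyc` of the cyclic Fock space. -/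
def cycForm (h : V →ₗ[ℂ] V →ₗ⋆[ℂ] ℂ) : CycFock V →ₗ[ℂ] CycFock V →ₗ⋆[ℂ] ℂ :=
  sumForm (circForm h)

theorem cycForm_circ (h : V →ₗ[ℂ] V →ₗ⋆[ℂ] ℂ) {n : ℕ} (f g : Fin n → V) :
    cycForm h (circ n (PiTensorProduct.tprod ℂ f)) (circ n (PiTensorProduct.tprod ℂ g)) =
      ∑ k ∈ Finset.range n, ∏ i, h (f i) (g ((finRotate n ^ k) i)) := by
  rw [← preCircForm_tprod]
  simp only [cycForm, circ, LinearMap.comp_apply]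
  rw [sumForm_of, DirectSum.lof_eq_of, DirectSum.of_eq_same]
  rfl

/-- The linear map `f₁ ⊗ ⋯ ⊗ f_{n+2} ↦ G(f₁, f_{n+2})(f₂, …, f_{n+1})`. -/
def pairEnds {W : Type*} [AddCommGroup W] [Module ℂ W] (n : ℕ)
    (G : V →ₗ[ℂ] V →ₗ[ℂ] MultilinearMap ℂ (fun _ : Fin n => V) W) : ⨂[ℂ]^(n + 2) V →ₗ[ℂ] W :=
  PiTensorProduct.lift (LinearMap.uncurryLeft (M := fun _ : Fin (n + 2) => V)
    { toFun := fun v => MultilinearMap.mk'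
        (fun m => G v (m (Fin.last n)) (fun i => m i.castSucc))
        (fun m i x y => by
          cases i using Fin.lastCases with
          | last => simp [Function.update_of_ne, (Fin.castSucc_lt_last _).ne]
          | cast i =>
            have (z : V) : (fun j : Fin n => Function.update m i.castSucc z j.castSucc) =
                Function.update (fun j : Fin n => m j.castSucc) i z :=
              Function.update_comp_eq_of_injective m (Fin.castSucc_injective n) i z
            simp [this, (Fin.castSucc_lt_last _).ne'])
        (fun m i c x => by
          cases i using Fin.lastCases with
          | last => simp [Function.update_of_ne, (Fin.castSucc_lt_last _).ne]
          | cast i =>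
            have (z : V) : (fun j : Fin n => Function.update m i.castSucc z j.castSucc) =
                Function.update (fun j : Fin n => m j.castSucc) i z :=
              Function.update_comp_eq_of_injective m (Fin.castSucc_injective n) i z
            simp [this, (Fin.castSucc_lt_last _).ne'])
      map_add' := fun v w => by ext m; simp
      map_smul' := fun c v => by ext m; simp })

theorem pairEnds_tprod {W : Type*} [AddCommGroup W] [Module ℂ W] (n : ℕ)
    (G : V →ₗ[ℂ] V →ₗ[ℂ] MultilinearMap ℂ (fun _ : Fin n => V) W) (f : Fin (n + 2) → V) :
    pairEnds n G (PiTensorProduct.tprod ℂ f) =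
      G (f 0) (f (Fin.last (n + 1))) (fun i => f i.castSucc.succ) := by
  simp [pairEnds, Fin.tail]

/-- `f₁ ⊗ ⋯ ⊗ f_{n+2} ↦ b(f₁, f_{n+2}) f₂ ⊗ ⋯ ⊗ f_{n+1}`. -/
def contractEnds (b : V →ₗ[ℂ] V →ₗ[ℂ] ℂ) (n : ℕ) : ⨂[ℂ]^(n + 2) V →ₗ[ℂ] ⨂[ℂ]^n V :=
  pairEnds n (LinearMap.mk₂ ℂ (fun v w => b v w • PiTensorProduct.tprod ℂ)
    (fun v v' w => by simp [add_smul]) (fun c v w => by simp [mul_smul])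
    (fun v w w' => by simp [add_smul]) (fun c v w => by simp [mul_smul]))

/-- `f₁ ⊗ ⋯ ⊗ f_{n+2} ↦ m(f_{n+2}, f₁) ⊗ f₂ ⊗ ⋯ ⊗ f_{n+1}`. -/
def mergeEnds (m : V →ₗ[ℂ] V →ₗ[ℂ] V) (n : ℕ) : ⨂[ℂ]^(n + 2) V →ₗ[ℂ] ⨂[ℂ]^(n + 1) V :=
  pairEnds n (LinearMap.mk₂ ℂ
    (fun v w => (PiTensorProduct.tprod ℂ (s := fun _ : Fin (n + 1) => V)).curryLeft (m w v))
    (fun v v' w => by simp) (fun c v w => by simp)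
    (fun v w w' => by simp) (fun c v w => by simp))

end Cyclic

/-! ### Semi-circular case -/

section SemiCircular

universe u

variable (E : Type u) [NormedAddCommGroup E] [InnerProductSpace ℝ E]

/-- The complexification of the real space `E`. -/
abbrev Cpx : Type u := ℂ ⊗[ℝ] E

variable {E} in
/-- The embedding of `E` into its complexification. -/
def toCpx (f : E) : Cpx E := (1 : ℂ) ⊗ₜ[ℝ] f

/-- The complex bilinear extension of the inner product of `E`. -/
def cpxBilin : Cpx E →ₗ[ℂ] Cpx E →ₗ[ℂ] ℂ :=
  LinearMap.BilinForm.baseChange ℂ (innerₗ E)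

/-- The conjugation of the complexification: `z ⊗ f ↦ conj z ⊗ f`. -/
def cpxConj : Cpx E →ₗ⋆[ℂ] Cpx E where
  toFun := TensorProduct.map (Complex.conjLIE.toLinearEquiv.toLinearMap : ℂ →ₗ[ℝ] ℂ) LinearMap.id
  map_add' := map_add _
  map_smul' c x := by
    induction x using TensorProduct.induction_on with
    | zero => simp
    | tmul z f => simp [TensorProduct.smul_tmul']
    | add x y hx hy => rw [smul_add, map_add, hx, hy, map_add, smul_add]

theorem cpxConj_tmul (z : ℂ) (f : E) :
    cpxConj E (z ⊗ₜ[ℝ] f) = (starRingEnd ℂ z) ⊗ₜ[ℝ] f := rfl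

theorem cpxBilin_tmul (z w : ℂ) (f g : E) :
    cpxBilin E (z ⊗ₜ[ℝ] f) (w ⊗ₜ[ℝ] g) = z * w * ((inner ℝ f g : ℝ) : ℂ) := by
  simp [cpxBilin, mul_comm]

/-- The inner product of the complexification, linear in the first argument:
`⟨z ⊗ f, w ⊗ g⟩ = z (conj w) ⟨f, g⟩`. -/
def cpxInner : Cpx E →ₗ[ℂ] Cpx E →ₗ⋆[ℂ] ℂ := (cpxBilin E).compl₂ (cpxConj E)

theorem cpxInner_tmul (z w : ℂ) (f g : E) :
    cpxInner E (z ⊗ₜ[ℝ] f) (w ⊗ₜ[ℝ] g) = z * (starRingEnd ℂ w) * ((inner ℝ f g : ℝ) : ℂ) := by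
  rw [cpxInner, LinearMap.compl₂_apply, cpxConj_tmul, cpxBilin_tmul]

theorem cpxInner_symm (x y : Cpx E) : cpxInner E x y = (starRingEnd ℂ) (cpxInner E y x) := by
  induction x using TensorProduct.induction_on with
  | zero => simp
  | add x x' hx hx' => rw [map_add, LinearMap.add_apply, hx, hx', map_add, map_add]
  | tmul z f =>
    induction y using TensorProduct.induction_on with
    | zero => simp
    | add x x' hx hx' => rw [map_add, hx, hx', map_add, LinearMap.add_apply, map_add]
    | tmul w g =>
      rw [cpxInner_tmul, cpxInner_tmul, real_inner_comm]
      simp [mul_comm]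

variable {E} in
/-- The operator `ω(f) = l(f) + l*(conj f)`, with adjoint `ω(conj f)`, on the full Fock space over
the complexification of `E`. -/
def omegaOp (f : Cpx E) : AdjOp (fockForm (cpxInner E)) where
  op := creation f + annihilation (cpxInner E) (cpxConj E f)
  adj := creation (cpxConj E f) + annihilation (cpxInner E) f
  rel x y := by
    simp only [LinearMap.add_apply, map_add]
    rw [creation_adjoint _ (cpxInner_symm E), annihilation_adjoint, add_comm]

/-- The unital `*`-algebra generated by all the `ω(f)`. -/
abbrev SemiAlg : Subalgebra ℂ (AdjOp (fockForm (cpxInner E))) :=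
  Algebra.adjoin ℂ (Set.range omegaOp)

variable {E} in
/-- `ω(f)` as an element of the algebra it generates with the others. -/
def omega (f : Cpx E) : SemiAlg E := ⟨omegaOp f, Algebra.subset_adjoin ⟨f, rfl⟩⟩

/-- The map `c` from tensors of length `n` to the cyclic Fock space: `c Ω = 0`, `c f = [f]`,
`c (f₁ ⊗ ⋯ ⊗ fₙ) = [f₁ ⊗ ⋯ ⊗ fₙ] + ⟨f₁, conj fₙ⟩ c (f₂ ⊗ ⋯ ⊗ f_{n-1})`. -/
def semiCAux : (n : ℕ) → ⨂[ℂ]^n (Cpx E) →ₗ[ℂ] CycFock (Cpx E)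
  | 0 => 0
  | 1 => circ 1
  | n + 2 => circ (n + 2) + (semiCAux n).comp (contractEnds (cpxBilin E) n)

/-- The map `c` from the full to the cyclic Fock space. -/
def semiC : Fock (Cpx E) →ₗ[ℂ] CycFock (Cpx E) := DirectSum.toModule ℂ ℕ _ (semiCAux E)

/-- `φ(a) = ⟨a Ω, Ω⟩`. -/
def semiPhi : SemiAlg E →ₗ[ℂ] ℂ where
  toFun a := fockForm (cpxInner E) (a.1.op (vacuum _)) (vacuum _)
  map_add' a b := by simp
  map_smul' c a := by simp

/-- `ρ(a, b) = ⟨c a Ω, c b* Ω⟩_cyc`. -/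
def semiRho : SemiAlg E →ₗ[ℂ] SemiAlg E →ₗ[ℂ] ℂ :=
  LinearMap.mk₂ ℂ (fun a b =>
      cycForm (cpxInner E) (semiC E (a.1.op (vacuum _))) (semiC E (b.1.adj (vacuum _))))
    (fun a a' b => by simp) (fun c a b => by simp)
    (fun a b b' => by simp) (fun c a b => by simp)

end SemiCircular

/-! ### Compound Poisson case -/

section Poisson

universe u

/-- A tracial state on a unital `*`-algebra. -/
structure TracialState (D : Type u) [Ring D] [StarRing D] [Algebra ℂ D] where
  toFun : D →ₗ[ℂ] ℂ
  map_one : toFun 1 = 1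
  nonneg_re : ∀ d, 0 ≤ (toFun (star d * d)).re
  nonneg_im : ∀ d, (toFun (star d * d)).im = 0
  trace : ∀ d e, toFun (d * e) = toFun (e * d)

variable {D : Type u} [Ring D] [StarRing D] [Algebra ℂ D] [StarModule ℂ D]

theorem TracialState.map_star (ψ : TracialState D) (d : D) :
    ψ.toFun (star d) = (starRingEnd ℂ) (ψ.toFun d) := by
  have h0 := ψ.nonneg_im d
  have h1 := ψ.nonneg_im (d + 1)
  have h2 := ψ.nonneg_im (d + Complex.I • (1 : D))
  simp only [star_add, star_one, star_smul, add_mul, mul_add, one_mul, mul_one, map_add, ψ.map_one,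
    Algebra.smul_mul_assoc, Algebra.mul_smul_comm, map_smul, smul_eq_mul, Complex.add_im,
    RCLike.star_def, Complex.conj_I, Complex.mul_im, Complex.neg_im, Complex.neg_re, Complex.I_im,
    Complex.I_re, Complex.one_im] at h1 h2
  apply Complex.ext
  · rw [Complex.conj_re]; linarith
  · rw [Complex.conj_im]; linarith

/-- The inner product `⟨d, e⟩ = ψ(e* d)`. -/
def stateForm (ψ : TracialState D) : D →ₗ[ℂ] D →ₗ⋆[ℂ] ℂ :=
  LinearMap.mk₂'ₛₗ (RingHom.id ℂ) (starRingEnd ℂ) (fun d e => ψ.toFun (star e * d))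
    (fun d d' e => by simp [mul_add]) (fun c d e => by simp)
    (fun d e e' => by simp [add_mul]) (fun c d e => by simp)

theorem stateForm_apply (ψ : TracialState D) (d e : D) :
    stateForm ψ d e = ψ.toFun (star e * d) := rfl

theorem stateForm_symm (ψ : TracialState D) (d e : D) :
    stateForm ψ d e = (starRingEnd ℂ) (stateForm ψ e d) := by
  rw [stateForm_apply, stateForm_apply, ← ψ.map_star, star_mul, star_star]

/-- The operator `p(d) = l(d) + l*(d*) + Λ(d) + ψ(d) 1`, with adjoint `p(d*)`, on the full Fock space
over `D`. -/
def poissonOp (ψ : TracialState D) (d : D) : AdjOp (fockForm (stateForm ψ)) where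
  op := creation d + annihilation (stateForm ψ) (star d) +
    preservation (LinearMap.mulLeft ℂ d) + ψ.toFun d • 1
  adj := creation (star d) + annihilation (stateForm ψ) (star (star d)) +
    preservation (LinearMap.mulLeft ℂ (star d)) + ψ.toFun (star d) • 1
  rel x y := by
    simp only [LinearMap.add_apply, map_add, LinearMap.smul_apply, Module.End.one_apply, map_smul,
      map_smulₛₗ, star_star]
    rw [creation_adjoint _ (stateForm_symm ψ), annihilation_adjoint,
      preservation_adjoint _ _ (LinearMap.mulLeft ℂ (star d)), ψ.map_star, Complex.conj_conj]
    · ring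
    · intro v w
      simp [stateForm_apply, mul_assoc]

/-- The unital `*`-algebra generated by all the `p(d)`. -/
abbrev PoissonAlg (ψ : TracialState D) : Subalgebra ℂ (AdjOp (fockForm (stateForm ψ))) :=
  Algebra.adjoin ℂ (Set.range (poissonOp ψ))

/-- `p(d)` as an element of the algebra it generates with the others. -/
def poisson (ψ : TracialState D) (d : D) : PoissonAlg ψ :=
  ⟨poissonOp ψ d, Algebra.subset_adjoin ⟨d, rfl⟩⟩

/-- The map `c` from tensors of length `n` to the cyclic Fock space: `c Ω = 0`, `c d = [d]`,
`c (d₁ ⊗ ⋯ ⊗ dₙ) = [d₁ ⊗ ⋯ ⊗ dₙ] + [dₙd₁ ⊗ d₂ ⊗ ⋯ ⊗ d_{n-1}] + ψ(d₁dₙ) c (d₂ ⊗ ⋯ ⊗ d_{n-1})`. -/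
def poissonCAux (ψ : TracialState D) : (n : ℕ) → ⨂[ℂ]^n D →ₗ[ℂ] CycFock D
  | 0 => 0
  | 1 => circ 1
  | n + 2 => circ (n + 2) + (circ (n + 1)).comp (mergeEnds (LinearMap.mul ℂ D) n) +
      (poissonCAux ψ n).comp (contractEnds ((LinearMap.mul ℂ D).compr₂ ψ.toFun) n)

/-- The map `c` from the full to the cyclic Fock space. -/
def poissonC (ψ : TracialState D) : Fock D →ₗ[ℂ] CycFock D :=
  DirectSum.toModule ℂ ℕ _ (poissonCAux ψ)

/-- `φ(a) = ⟨a Ω, Ω⟩`. -/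
def poissonPhi (ψ : TracialState D) : PoissonAlg ψ →ₗ[ℂ] ℂ where
  toFun a := fockForm (stateForm ψ) (a.1.op (vacuum _)) (vacuum _)
  map_add' a b := by simp
  map_smul' c a := by simp

/-- `ρ(a, b) = ⟨c a Ω, c b* Ω⟩_cyc`. -/
def poissonRho (ψ : TracialState D) : PoissonAlg ψ →ₗ[ℂ] PoissonAlg ψ →ₗ[ℂ] ℂ :=
  LinearMap.mk₂ ℂ (fun a b =>
      cycForm (stateForm ψ) (poissonC ψ (a.1.op (vacuum _))) (poissonC ψ (b.1.adj (vacuum _))))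
    (fun a a' b => by simp) (fun c a b => by simp)
    (fun a b b' => by simp) (fun c a b => by simp)

/-- The sequence of families `(D₁⁽ᴺ⁾, …, D_p⁽ᴺ⁾)` of `N × N` matrices converges in distribution to
`(d₁, …, d_p)` in `(D, ψ)`: the normalized traces of all words converge. -/
def ConvergesInDistribution {I : Type*} (M : ∀ N : ℕ, I → Matrix (Fin N) (Fin N) ℂ)
    (ψ : TracialState D) (d : I → D) : Prop :=
  ∀ w : List I, Tendsto (fun N : ℕ => (N : ℂ)⁻¹ * Matrix.trace ((w.map (M N)).prod)) atTop
    (𝓝 (ψ.toFun (w.map d).prod))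

end Poisson

end SecondOrder

end

universe u w

/-! Both halves are instances of one statement about a semigroup `L` with a function `ψ` satisfying
`ψ (a * b) = ψ (b * a)`. Lists of letters are the basis of a formal Fock space, on which `opF ψ d`
creates the letter `d`, multiplies the first letter by `d`, annihilates it with coefficient `ψ (d *
e)`, and adds the constant `ψ d`. For the Poisson operators `L` is the multiplicative semigroup of
`D`. For the semi-circular ones it is `SemiLetter`, where the product of two vectors is their
covariance, a letter with vector part zero; the multiplication terms therefore die when lists become
tensors.

The engine is a pair of Schwinger-Dyson equations. Writing `W = U g V`, `phiWord_cons` says that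
φ(dW) = ψ(d) φ(W) + ∑ φ(U(gd)) φ(V). `rhoWord_cons` gives ρ(dW, Z) as the linearization of this
equation in `W`, plus a sum over Z = U e V of φ(W V U (ed)), which joins the two cyclic words. The
first rests on `annF_state`. The second uses the Wick product, which expresses words through their
vacuum vectors (`wickF_state`), the operator `lastF` acting on the last letter, and the identity
`cutF_eq` for the map `c` followed by the sum over rotations. Traciality of φ is the symmetry of the
pairing `pairF`. Traciality of ρ follows by induction, because `Z` enters the equation only through
all of its rotations.

For freeness the letters are coloured so that products of letters of different colours are zero.
Then a centred alternating product applied to the vacuum is, up to lists containing the letter `0`,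
the concatenation of its blocks; the map `c` does nothing to a cyclically alternating one, since its
end letters have different colours. In the cyclic inner product only rotations matching block with
block survive, and these give the sum over `k` of products of φ.

For the random matrices, Gaussian integration by parts shows that the traces of words satisfy the
same equations up to factors 1/N (`IsSchwingerDyson`). Every term on the right has fewer letters, so
induction on their number (`tendsto_schwingerDyson`) gives the limit φ for the normalized mean
traces, and shows that mixed moments of centred traces tend to Wick sums over pairings with
covariance ρ. Hence the second cumulants tend to ρ and the higher ones to zero. Multilinearity of
cumulants passes from words to polynomials.

The algebras of the theorem are quotients of free algebras on the letters, and φ, ρ pull back to the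
formal functionals (`lift_phi`, `lift_rho`), so all results transfer. -/

namespace SecondOrder

noncomputable section

/-! ### Sums over the positions of a list -/

section SplitSum

variable {L L' M M' : Type*} [AddCommMonoid M] [AddCommMonoid M']

/-- The sum of `F U g V` over all decompositions `W = U ++ g :: V`. -/
def splitSum : (List L → L → List L → M) → List L → M
  | _, [] => 0
  | F, g :: V => F [] g V + splitSum (fun U h V' => F (g :: U) h V') V

@[simp] theorem splitSum_nil (F : List L → L → List L → M) : splitSum F [] = 0 := rfl

@[simp] theorem splitSum_cons (F : List L → L → List L → M) (g : L) (V : List L) :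
    splitSum F (g :: V) = F [] g V + splitSum (fun U h V' => F (g :: U) h V') V := rfl

theorem splitSum_congr {F G : List L → L → List L → M} {W : List L}
    (h : ∀ U g V, W = U ++ g :: V → F U g V = G U g V) : splitSum F W = splitSum G W := by
  induction W generalizing F G with
  | nil => rfl
  | cons g V ih =>
    rw [splitSum_cons, splitSum_cons, h [] g V rfl]
    congr 1
    exact ih fun U k V' hV => h (g :: U) k V' (by rw [hV]; rfl)

theorem splitSum_eq_zero {F : List L → L → List L → M} {W : List L}
    (h : ∀ U g V, W = U ++ g :: V → F U g V = 0) : splitSum F W = 0 := by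
  induction W generalizing F with
  | nil => rfl
  | cons g V ih =>
    rw [splitSum_cons, h [] g V rfl, zero_add]
    exact ih fun U k V' hV => h (g :: U) k V' (by rw [hV]; rfl)

theorem splitSum_append (F : List L → L → List L → M) (A B : List L) :
    splitSum F (A ++ B) =
      splitSum (fun U g V => F U g (V ++ B)) A + splitSum (fun U g V => F (A ++ U) g V) B := by
  induction A generalizing F with
  | nil => simp
  | cons g A ih => simp [ih, add_assoc]

theorem splitSum_add (F G : List L → L → List L → M) (W : List L) :
    splitSum (fun U g V => F U g V + G U g V) W = splitSum F W + splitSum G W := by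
  induction W generalizing F G with
  | nil => simp
  | cons g V ih => simp [ih, add_add_add_comm]

theorem map_splitSum {T : Type*} [FunLike T M M'] [AddMonoidHomClass T M M'] (f : T)
    (F : List L → L → List L → M) (W : List L) :
    f (splitSum F W) = splitSum (fun U g V => f (F U g V)) W := by
  induction W generalizing F with
  | nil => simp
  | cons g V ih => simp [ih]

theorem splitSum_smul {R : Type*} [DistribSMul R M] (c : R)
    (F : List L → L → List L → M) (W : List L) :
    c • splitSum F W = splitSum (fun U g V => c • F U g V) W :=
  map_splitSum (DistribSMul.toAddMonoidHom M c) F W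

theorem mul_splitSum {R : Type*} [NonUnitalNonAssocSemiring R] (c : R)
    (F : List L → L → List L → R) (W : List L) :
    c * splitSum F W = splitSum (fun U g V => c * F U g V) W :=
  map_splitSum (AddMonoidHom.mulLeft c) F W

theorem splitSum_mul {R : Type*} [NonUnitalNonAssocSemiring R] (c : R)
    (F : List L → L → List L → R) (W : List L) :
    splitSum F W * c = splitSum (fun U g V => F U g V * c) W :=
  map_splitSum (AddMonoidHom.mulRight c) F W

theorem splitSum_map (f : L' → L) (F : List L → L → List L → M) (W : List L') :
    splitSum F (W.map f) = splitSum (fun U g V => F (U.map f) (f g) (V.map f)) W := by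
  induction W generalizing F with
  | nil => rfl
  | cons g V ih => simp [ih]

theorem splitSum_const (m : M) (W : List L) :
    splitSum (fun _ _ _ => m) W = W.length • m := by
  induction W with
  | nil => simp
  | cons g V ih => simp [ih, add_smul, add_comm]

/-- Both sides run over pairs of positions with `k` to the left of `g`; they differ in which of the
two is chosen first. -/
theorem splitSum_swap (F : List L → L → List L → L → List L → M) (W : List L) :
    splitSum (fun U g V => splitSum (fun U₁ k U₂ => F U₁ k U₂ g V) U) W =
      splitSum (fun U₁ k X => splitSum (fun U₂ g V => F U₁ k U₂ g V) X) W := by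
  induction W generalizing F with
  | nil => rfl
  | cons g V ih =>
    simp only [splitSum_cons, splitSum_nil, zero_add, splitSum_add]
    rw [ih]

/-- Moving the marked letter from the prefix to the suffix. -/
theorem splitSum_shift {M : Type*} [AddCommGroup M] (F : List L → List L → M) (W : List L) :
    splitSum (fun U g V => F (U ++ [g]) V) W + F [] W =
      splitSum (fun U g V => F U (g :: V)) W + F W [] := by
  induction W generalizing F with
  | nil => simp
  | cons g V ih =>
    have := ih (fun U V => F (g :: U) V)
    simp only [splitSum_cons, List.cons_append, List.nil_append] at this ⊢
    rw [add_right_comm, add_comm (F [] _), add_assoc, add_comm (F [] _), ← add_assoc,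
      add_comm (F [g] V), this]
    abel

theorem splitSum_reverse (F : List L → L → List L → M) (W : List L) :
    splitSum F W.reverse = splitSum (fun U g V => F V.reverse g U.reverse) W := by
  induction W generalizing F with
  | nil => rfl
  | cons g V ih =>
    rw [List.reverse_cons, splitSum_append, ih]
    simp [add_comm]

theorem splitSum_ofFn {n : ℕ} (h : Fin n → L) (F : List L → L → List L → M) :
    splitSum F (List.ofFn h) =
      ∑ k : Fin n, F ((List.ofFn h).take k) (h k) ((List.ofFn h).drop (k + 1)) := by
  induction n generalizing F with
  | zero => simp
  | succ n ih =>
    rw [List.ofFn_succ, splitSum_cons, Fin.sum_univ_succ, ih]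
    simp

theorem tendsto_splitSum {α : Type*} {M : Type*} [AddCommMonoid M] [TopologicalSpace M]
    [ContinuousAdd M] {l : Filter α}
    {F : α → List L → L → List L → M} {G : List L → L → List L → M} {W : List L}
    (h : ∀ U g V, W = U ++ g :: V → Tendsto (fun a => F a U g V) l (𝓝 (G U g V))) :
    Tendsto (fun a => splitSum (F a) W) l (𝓝 (splitSum G W)) := by
  induction W generalizing F G with
  | nil => exact tendsto_const_nhds
  | cons g V ih =>
    exact (h [] g V rfl).add
      (ih (F := fun a U k V' => F a (g :: U) k V') (G := fun U k V' => G (g :: U) k V')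
        fun U k V' hV => h (g :: U) k V' (by rw [hV]; rfl))

end SplitSum

/-! ### Formal linear combinations of lists -/

section FormalFock

variable {L : Type*}

/-- Formal linear combinations of lists of letters; multiplication is concatenation. -/
abbrev FormalFock (L : Type*) : Type _ := MonoidAlgebra ℂ (FreeMonoid L)

/-- A list as an element of the formal Fock space. -/
def lst (ξ : List L) : FormalFock L := MonoidAlgebra.single (FreeMonoid.ofList ξ) 1

theorem lst_nil : lst ([] : List L) = 1 := rfl

theorem lst_mul (ξ η : List L) : lst ξ * lst η = lst (ξ ++ η) := by
  simp [lst, MonoidAlgebra.single_mul_single]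

/-- The linear map determined by its values on lists. -/
def linExt {M : Type*} [AddCommMonoid M] [Module ℂ M] (f : List L → M) : FormalFock L →ₗ[ℂ] M :=
  (Finsupp.linearCombination ℂ fun ξ : FreeMonoid L => f ξ.toList).comp
    (MonoidAlgebra.coeffLinearEquiv ℂ).toLinearMap

@[simp] theorem linExt_lst {M : Type*} [AddCommMonoid M] [Module ℂ M] (f : List L → M)
    (ξ : List L) : linExt f (lst ξ) = f ξ := by
  simp [linExt, lst]

theorem formal_induction {p : FormalFock L → Prop} (x : FormalFock L) (hl : ∀ ξ, p (lst ξ))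
    (ha : ∀ x y, p x → p y → p (x + y)) (hs : ∀ (c : ℂ) x, p x → p (c • x)) : p x := by
  induction x using MonoidAlgebra.induction_on with
  | of ξ => exact hl ξ.toList
  | add x y hx hy => exact ha x y hx hy
  | smul c x hx => exact hs c x hx

end FormalFock

/-! ### Operators on the formal Fock space -/

section FormalOperators

variable {L : Type*} [Semigroup L] (ψ : L → ℂ)

/-- Annihilation: `e :: ξ ↦ ψ (d * e) ξ`. -/
def annF (d : L) : FormalFock L →ₗ[ℂ] FormalFock L :=
  linExt fun
    | [] => 0
    | e :: ξ => ψ (d * e) • lst ξ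

/-- Preservation: `e :: ξ ↦ (d * e) :: ξ`. -/
def presF (d : L) : FormalFock L →ₗ[ℂ] FormalFock L :=
  linExt fun
    | [] => 0
    | e :: ξ => lst (d * e :: ξ)

/-- The formal counterpart of `p(d)`. -/
def opF (d : L) : Module.End ℂ (FormalFock L) :=
  LinearMap.mulLeft ℂ (lst [d]) + presF d + annF ψ d + ψ d • LinearMap.id

/-- The coefficient of the empty list. -/
def vacF : FormalFock L →ₗ[ℂ] ℂ :=
  linExt fun
    | [] => 1
    | _ :: _ => 0

@[simp] theorem annF_nil (d : L) : annF ψ d (1 : FormalFock L) = 0 := by simp [annF, ← lst_nil]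
@[simp] theorem annF_cons (d e : L) (ξ : List L) :
    annF ψ d (lst (e :: ξ)) = ψ (d * e) • lst ξ := by simp [annF]
@[simp] theorem presF_nil (d : L) : presF d (1 : FormalFock L) = 0 := by simp [presF, ← lst_nil]
@[simp] theorem presF_cons (d e : L) (ξ : List L) :
    presF d (lst (e :: ξ)) = lst (d * e :: ξ) := by simp [presF]
omit [Semigroup L] in
@[simp] theorem vacF_one : vacF (1 : FormalFock L) = 1 := by simp [vacF, ← lst_nil]
omit [Semigroup L] in
@[simp] theorem vacF_cons (e : L) (ξ : List L) : vacF (lst (e :: ξ)) = 0 := by simp [vacF]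

theorem opF_apply (d : L) (x : FormalFock L) :
    opF ψ d x = lst [d] * x + presF d x + annF ψ d x + ψ d • x := by simp [opF]

@[simp] theorem opF_one (d : L) : opF ψ d (1 : FormalFock L) = lst [d] + ψ d • 1 := by
  simp [opF_apply]

@[simp] theorem opF_cons (d e : L) (ξ : List L) :
    opF ψ d (lst (e :: ξ)) =
      lst (d :: e :: ξ) + lst (d * e :: ξ) + ψ (d * e) • lst ξ + ψ d • lst (e :: ξ) := by
  simp [opF_apply, lst_mul]

/-- The operator sees only the first letter, so the tail may be any element. This is needed when the
tail has already been modified by `lastF`. -/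
theorem opF_cons_mul (d e : L) (x : FormalFock L) :
    opF ψ d (lst [e] * x) =
      lst [d] * (lst [e] * x) + lst [d * e] * x + ψ (d * e) • x + ψ d • (lst [e] * x) := by
  induction x using formal_induction with
  | hl ξ => simp [lst_mul]
  | ha x y hx hy => simp only [mul_add, map_add, hx, hy, smul_add]; abel
  | hs c x hx =>
    simp only [mul_smul_comm, map_smul, hx, smul_add]
    simp only [smul_comm c]

theorem vacF_opF (d : L) (x : FormalFock L) :
    vacF (opF ψ d x) = ψ d * vacF x + vacF (annF ψ d x) := by
  induction x using formal_induction with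
  | hl ξ => cases ξ <;> simp [lst_nil]
  | ha x y hx hy => simp only [map_add, hx, hy]; ring
  | hs c x hx => simp only [map_smul, hx, smul_eq_mul]; ring

/-- Commuting annihilation past an operator: the created letter `h` is removed at once, the
multiplied first letter is removed with coefficient `ψ (d * h * e)`, and the other two parts are
passed through. -/
theorem annF_opF (d h : L) (x : FormalFock L) :
    annF ψ d (opF ψ h x) =
      ψ (d * h) • x + annF ψ (d * h) x + ψ h • annF ψ d x + annF ψ d (annF ψ h x) := by
  induction x using formal_induction with
  | hl ξ => cases ξ <;> simp [lst_nil, mul_assoc]; abel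
  | ha x y hx hy => simp only [map_add, hx, hy, smul_add]; abel
  | hs c x hx => simp only [map_smul, hx, smul_add, smul_comm c]

/-- The product of the operators of the letters of a word. -/
def opWord (W : List L) : Module.End ℂ (FormalFock L) := (W.map (opF ψ)).prod

/-- A word applied to the vacuum. -/
def state (W : List L) : FormalFock L := opWord ψ W 1

@[simp] theorem opWord_nil : opWord ψ ([] : List L) = 1 := rfl
@[simp] theorem opWord_cons (d : L) (W : List L) :
    opWord ψ (d :: W) = opF ψ d * opWord ψ W := by simp [opWord]
theorem opWord_append (U V : List L) :
    opWord ψ (U ++ V) = opWord ψ U * opWord ψ V := by simp [opWord]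
@[simp] theorem state_nil : state ψ ([] : List L) = 1 := rfl
@[simp] theorem state_cons (d : L) (W : List L) :
    state ψ (d :: W) = opF ψ d (state ψ W) := by simp [state]
theorem state_append (U V : List L) :
    state ψ (U ++ V) = opWord ψ U (state ψ V) := by simp [state, opWord_append]

/-- The moment functional on words. -/
def phiWord (W : List L) : ℂ := vacF (state ψ W)

theorem phiWord_singleton (d : L) : phiWord ψ [d] = ψ d := by simp [phiWord]

/-- The annihilation by `d` is finally paired with some letter `g` of the word, and everything to
the left of `g` must then close up to a vacuum expectation. The proof moves `annF ψ d` past the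
first letter `h`. A bound on the length replaces structural induction because the hypothesis is also
applied to the suffixes `V` and to `U ++ [g * d]`. -/
theorem annF_state (hψ : ∀ a b, ψ (a * b) = ψ (b * a)) (n : ℕ) (W : List L) (hn : W.length ≤ n)
    (d : L) :
    annF ψ d (state ψ W) = splitSum (fun U g V => phiWord ψ (U ++ [g * d]) • state ψ V) W := by
  induction n generalizing W d with
  | zero =>
    have : W = [] := List.length_eq_zero_iff.mp (by omega)
    simp [this]
  | succ n ih =>
    rcases W with _ | ⟨h, W⟩
    · simp
    have hW : W.length ≤ n := by simpa using hn
    have h1 : splitSum (fun U g V => phiWord ψ (h :: U ++ [g * d]) • state ψ V) W =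
        annF ψ (d * h) (state ψ W) + ψ h • annF ψ d (state ψ W) +
          annF ψ d (annF ψ h (state ψ W)) := by
      rw [ih W hW, ih W hW d, ih W hW h, splitSum_smul, map_splitSum, ← splitSum_add]
      -- The double annihilation removes one letter paired with `h` and a later one paired with `d`.
      -- Summing first over the later letter lets the terms be compared at a fixed `g`.
      have h2 : splitSum (fun U g V => annF ψ d (phiWord ψ (U ++ [g * h]) • state ψ V)) W =
          splitSum (fun U₁ k X => splitSum (fun U₂ g V =>
            (phiWord ψ (U₁ ++ [k * h]) * phiWord ψ (U₂ ++ [g * d])) • state ψ V) X) W := by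
        refine splitSum_congr fun U g V hUV => ?_
        have : V.length ≤ n := by
          have := congrArg List.length hUV; simp at this; omega
        rw [map_smul, ih V this d, splitSum_smul]
        simp only [mul_smul]
      rw [h2, ← splitSum_swap, ← splitSum_add]
      refine splitSum_congr fun U g V hUV => ?_
      have hU : (U ++ [g * d]).length ≤ n := by
        have := congrArg List.length hUV; simp at this ⊢; omega
      -- The Schwinger-Dyson expansion of the coefficient at its first letter `h`: it is paired with
      -- a letter `k` of `U` or with the final letter `g * d`.
      have h3 : phiWord ψ (h :: U ++ [g * d]) = ψ h * phiWord ψ (U ++ [g * d]) +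
          (splitSum (fun U₁ k U₂ => phiWord ψ (U₁ ++ [k * h]) * phiWord ψ (U₂ ++ [g * d])) U +
            phiWord ψ (U ++ [g * (d * h)])) := by
        rw [phiWord, List.cons_append, state_cons, vacF_opF, ih _ hU, splitSum_append]
        simp only [map_add, map_splitSum, map_smul, smul_eq_mul]
        simp [phiWord, mul_assoc]
      rw [h3, add_smul, add_smul]
      have h4 : splitSum (fun U₁ k U₂ => (phiWord ψ (U₁ ++ [k * h]) *
          phiWord ψ (U₂ ++ [g * d])) • state ψ V) U = splitSum (fun U₁ k U₂ =>
            phiWord ψ (U₁ ++ [k * h]) * phiWord ψ (U₂ ++ [g * d])) U • state ψ V := by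
        rw [← LinearMap.toSpanSingleton_apply ℂ, map_splitSum]
        simp
      rw [h4, mul_smul]
      abel
    -- The term `g = h` carries `ψ (h * d)` while the commutation produced `ψ (d * h)`.
    rw [state_cons, annF_opF, splitSum_cons, List.nil_append, phiWord_singleton, hψ h d, h1]
    abel

/-- The Schwinger-Dyson equation for `phiWord`. -/
theorem phiWord_cons (hψ : ∀ a b, ψ (a * b) = ψ (b * a)) (d : L) (W : List L) :
    phiWord ψ (d :: W) = ψ d * phiWord ψ W +
      splitSum (fun U g V => phiWord ψ (U ++ [g * d]) * phiWord ψ V) W := by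
  rw [phiWord, state_cons, vacF_opF, annF_state ψ hψ _ W le_rfl]
  simp [map_splitSum, phiWord]

/-! ### The operator acting on the last letter -/

/-- `ξ ++ [f] ↦ ξ ++ [f * d] + ψ (f * d) ξ`. -/
def lastList (d : L) : List L → FormalFock L
  | [] => 0
  | [f] => lst [f * d] + ψ (f * d) • 1
  | e :: f :: ξ => lst [e] * lastList d (f :: ξ)

theorem lastList_concat (d : L) (ξ : List L) (f : L) :
    lastList ψ d (ξ ++ [f]) = lst (ξ ++ [f * d]) + ψ (f * d) • lst ξ := by
  induction ξ with
  | nil => rfl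
  | cons e ξ ih =>
    have : lastList ψ d (e :: ξ ++ [f]) = lst [e] * lastList ψ d (ξ ++ [f]) := by
      cases ξ <;> rfl
    rw [this, ih, mul_add, mul_smul_comm, lst_mul, lst_mul]
    rfl

/-- Linear extension of `lastList`. -/
def lastF (d : L) : FormalFock L →ₗ[ℂ] FormalFock L := linExt (lastList ψ d)

@[simp] theorem lastF_one (d : L) : lastF ψ d (1 : FormalFock L) = 0 := by
  simp [lastF, ← lst_nil, lastList]

theorem lastF_concat (d : L) (ξ : List L) (f : L) :
    lastF ψ d (lst (ξ ++ [f])) = lst (ξ ++ [f * d]) + ψ (f * d) • lst ξ := by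
  simp [lastF, lastList_concat]

theorem lastF_single (d f : L) : lastF ψ d (lst [f]) = lst [f * d] + ψ (f * d) • 1 :=
  lastF_concat ψ d [] f

theorem lastF_cons_cons (d e f : L) (ξ : List L) :
    lastF ψ d (lst (e :: f :: ξ)) = lst [e] * lastF ψ d (lst (f :: ξ)) := by
  simp [lastF, lastList]

/-- Actions on the two ends of a list commute unless a letter is created on the vacuum, where the
new letter `h` is first and last at the same time. -/
theorem lastF_opF (d h : L) (x : FormalFock L) :
    lastF ψ d (opF ψ h x) = opF ψ h (lastF ψ d x) + vacF x • opF ψ (h * d) 1 := by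
  induction x using formal_induction with
  | hl ξ =>
    rcases ξ with _ | ⟨e, _ | ⟨f, ξ⟩⟩
    · simp [lst_nil, lastF_single]
    · rw [opF_cons]
      simp only [map_add, map_smul, lst_nil, lastF_one, lastF_single, lastF_cons_cons, vacF_cons,
        opF_one, opF_cons, smul_zero, zero_smul, add_zero, mul_add, mul_smul_comm, mul_one,
        lst_mul, smul_add, mul_assoc]
      simp only [List.cons_append, List.nil_append, smul_comm (ψ h)]
      abel
    · rw [opF_cons]
      simp only [map_add, map_smul, lastF_cons_cons, vacF_cons, zero_smul, add_zero]
      rw [opF_cons_mul]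
  | ha x y hx hy => simp only [map_add, hx, hy, add_smul]; abel
  | hs c x hx => simp only [map_smul, hx, smul_add, smul_assoc]

theorem lastF_state (d : L) (W : List L) :
    lastF ψ d (state ψ W) = splitSum (fun U g V => phiWord ψ V • state ψ (U ++ [g * d])) W := by
  induction W with
  | nil => simp
  | cons h W ih =>
    rw [state_cons, lastF_opF, ih, map_splitSum, splitSum_cons, add_comm]
    simp [phiWord]

/-! ### The Wick product -/

/-- The Wick expansion of a product, the first factor being given in reverse order. -/
def wickList : List L → List L → FormalFock L
  | [], η => lst η
  | x :: ζ, [] => lst (x :: ζ).reverse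
  | x :: ζ, y :: η => lst (ζ.reverse ++ x :: y :: η) + lst (ζ.reverse ++ (x * y) :: η) +
      ψ (x * y) • wickList ζ η

theorem wickList_nil_right (ζ : List L) : wickList ψ ζ [] = lst ζ.reverse := by
  cases ζ <;> rfl

theorem wickList_singleton (e : L) (η : List L) :
    wickList ψ [e] η + ψ e • lst η = opF ψ e (lst η) := by
  cases η <;> simp [wickList, lst_nil]

/-- The list level form of `wickF_opF`. The first factor is reversed, so its leading letter `a`
stands at the far end, while the Wick recursion works at the near end; hence the induction on `z`
never disturbs the action of `e`. -/
theorem opF_wickList (e a : L) (z η : List L) :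
    wickList ψ (z ++ [a, e]) η + wickList ψ (z ++ [e * a]) η + ψ (e * a) • wickList ψ z η +
      ψ e • wickList ψ (z ++ [a]) η = opF ψ e (wickList ψ (z ++ [a]) η) := by
  induction z generalizing η with
  | nil =>
    rcases η with _ | ⟨y, η⟩
    · simp [wickList]
    · have := wickList_singleton ψ e η
      simp only [List.nil_append, wickList, List.reverse_cons, List.reverse_nil,
        List.cons_append, map_add, map_smul, opF_cons, ← this, smul_add, mul_assoc]
      simp only [smul_comm (ψ e)]
      abel
  | cons x z ih =>
    rcases η with _ | ⟨y, η⟩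
    · simp [wickList_nil_right]
    · simp only [List.cons_append, wickList, List.reverse_append, List.reverse_cons,
        List.reverse_nil, List.nil_append, map_add, map_smul, opF_cons, ← ih, smul_add]
      simp only [smul_comm (ψ e), smul_comm (ψ (e * a))]
      abel

/-- The Wick expansion of a product. -/
def wickF : FormalFock L →ₗ[ℂ] FormalFock L →ₗ[ℂ] FormalFock L :=
  linExt fun ξ => linExt fun η => wickList ψ ξ.reverse η

@[simp] theorem wickF_lst (ξ η : List L) :
    wickF ψ (lst ξ) (lst η) = wickList ψ ξ.reverse η := by simp [wickF]

@[simp] theorem wickF_one (y : FormalFock L) : wickF ψ 1 y = y := by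
  induction y using formal_induction with
  | hl η => rw [← lst_nil, wickF_lst]; rfl
  | ha x y hx hy => rw [map_add, hx, hy]
  | hs c x hx => rw [map_smul, hx]

theorem wickF_opF (e : L) (x y : FormalFock L) :
    wickF ψ (opF ψ e x) y = opF ψ e (wickF ψ x y) := by
  induction x using formal_induction with
  | hl ξ =>
    induction y using formal_induction with
    | hl η =>
      rcases ξ with _ | ⟨a, ξ⟩
      · rw [lst_nil, opF_one, wickF_one, ← wickList_singleton]
        simp
      · rw [opF_cons, wickF_lst, List.reverse_cons, ← opF_wickList]
        simp
    | ha x y hx hy => simp only [map_add, hx, hy]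
    | hs c x hx => simp only [map_smul, hx]
  | ha x y hx hy => simp only [map_add, LinearMap.add_apply, hx, hy]
  | hs c x hx => simp only [map_smul, LinearMap.smul_apply, hx]

/-- An operator word is determined by its vacuum vector: acting by the word is Wick multiplication
by `state ψ W`. -/
theorem wickF_state (W : List L) (y : FormalFock L) :
    wickF ψ (state ψ W) y = opWord ψ W y := by
  induction W with
  | nil => simp
  | cons d W ih => rw [state_cons, wickF_opF, ih]; simp

/-! ### The bilinear pairing -/

/-- The pairing `∏ ψ (x_i y_i)` of lists of the same length. -/
def zipPair : List L → List L → ℂ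
  | [], [] => 1
  | x :: ζ, y :: η => ψ (x * y) * zipPair ζ η
  | [], _ :: _ => 0
  | _ :: _, [] => 0

/-- Only the complete contraction of both factors leaves the empty list. -/
theorem vacF_wickList (ζ η : List L) : vacF (wickList ψ ζ η) = zipPair ψ ζ η := by
  induction ζ generalizing η with
  | nil => cases η <;> simp [wickList, zipPair, lst_nil]
  | cons x ζ ih =>
    cases η with
    | nil =>
      rw [wickList, zipPair]
      obtain ⟨a, l, h⟩ := List.exists_cons_of_ne_nil (l := (x :: ζ).reverse) (by simp)
      rw [h, vacF_cons]
    | cons y η =>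
      have h (z : L) (l : List L) : vacF (lst (ζ.reverse ++ z :: l)) = 0 := by
        obtain ⟨a, l, h⟩ := List.exists_cons_of_ne_nil (l := ζ.reverse ++ z :: l) (by simp)
        rw [h, vacF_cons]
      simp [wickList, zipPair, h, ih]

theorem zipPair_of_length_ne {ζ η : List L} (h : ζ.length ≠ η.length) : zipPair ψ ζ η = 0 := by
  induction ζ generalizing η with
  | nil => cases η <;> simp_all [zipPair]
  | cons x ζ ih =>
    cases η with
    | nil => rfl
    | cons y η => rw [zipPair, ih (by simpa using h), mul_zero]

theorem zipPair_append {ζ ζ' η η' : List L} (h : ζ.length = η.length) :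
    zipPair ψ (ζ ++ ζ') (η ++ η') = zipPair ψ ζ η * zipPair ψ ζ' η' := by
  induction ζ generalizing η with
  | nil => cases η <;> simp_all [zipPair]
  | cons x ζ ih =>
    cases η with
    | nil => simp at h
    | cons y η =>
      simp only [List.cons_append, zipPair]
      rw [ih (by simpa using h), mul_assoc]

theorem zipPair_append_right {ζ ζ' η η' : List L} (h : ζ'.length = η'.length) :
    zipPair ψ (ζ ++ ζ') (η ++ η') = zipPair ψ ζ η * zipPair ψ ζ' η' := by
  by_cases hl : ζ.length = η.length
  · exact zipPair_append ψ hl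
  · rw [zipPair_of_length_ne ψ hl, zero_mul, zipPair_of_length_ne]
    simp; omega

theorem zipPair_reverse (ζ η : List L) : zipPair ψ ζ.reverse η.reverse = zipPair ψ ζ η := by
  induction ζ generalizing η with
  | nil =>
    cases η with
    | nil => rfl
    | cons y η => rw [zipPair_of_length_ne ψ (by simp), zipPair_of_length_ne ψ (by simp)]
  | cons x ζ ih =>
    cases η with
    | nil => rw [zipPair_of_length_ne ψ (by simp), zipPair_of_length_ne ψ (by simp)]
    | cons y η =>
      rw [List.reverse_cons, List.reverse_cons, zipPair_append_right ψ (by simp), ih]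
      simp [zipPair, mul_comm]

theorem zipPair_comm (hψ : ∀ a b, ψ (a * b) = ψ (b * a)) (ζ η : List L) :
    zipPair ψ ζ η = zipPair ψ η ζ := by
  induction ζ generalizing η with
  | nil => cases η <;> rfl
  | cons x ζ ih =>
    cases η with
    | nil => rfl
    | cons y η => rw [zipPair, zipPair, ih, hψ]

/-- The bilinear pairing of the formal Fock space: the first letter of the first argument is
paired with the last letter of the second one. -/
def pairF : FormalFock L →ₗ[ℂ] FormalFock L →ₗ[ℂ] ℂ :=
  linExt fun ξ => linExt fun η => zipPair ψ ξ.reverse η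

@[simp] theorem pairF_lst (ξ η : List L) :
    pairF ψ (lst ξ) (lst η) = zipPair ψ ξ.reverse η := by simp [pairF]

theorem pairF_comm (hψ : ∀ a b, ψ (a * b) = ψ (b * a)) (x y : FormalFock L) :
    pairF ψ x y = pairF ψ y x := by
  induction x using formal_induction with
  | hl ξ =>
    induction y using formal_induction with
    | hl η => rw [pairF_lst, pairF_lst, zipPair_comm ψ hψ, ← zipPair_reverse, List.reverse_reverse]
    | ha x y hx hy => simp only [map_add, LinearMap.add_apply, hx, hy]
    | hs c x hx => simp only [map_smul, LinearMap.smul_apply, hx]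
  | ha x y hx hy => simp only [map_add, LinearMap.add_apply, hx, hy]
  | hs c x hx => simp only [map_smul, LinearMap.smul_apply, hx]

theorem vacF_wickF (x y : FormalFock L) : vacF (wickF ψ x y) = pairF ψ x y := by
  induction x using formal_induction with
  | hl ξ =>
    induction y using formal_induction with
    | hl η => rw [wickF_lst, vacF_wickList, pairF_lst]
    | ha x y hx hy => simp only [map_add, hx, hy]
    | hs c x hx => simp only [map_smul, hx]
  | ha x y hx hy => simp only [map_add, LinearMap.add_apply, hx, hy]
  | hs c x hx => simp only [map_smul, LinearMap.smul_apply, hx]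

theorem pairF_state (W : List L) (y : FormalFock L) :
    pairF ψ (state ψ W) y = vacF (opWord ψ W y) := by
  rw [← vacF_wickF, wickF_state]

/-- The first letter of the left argument is paired with the last letter of the right one, so
creation and multiplication by `d` on the left become removal and multiplication of that last
letter; traciality of `ψ` cycles `d` around the pair. -/
theorem pairF_lastF (hψ : ∀ a b, ψ (a * b) = ψ (b * a)) (d : L) (x y : FormalFock L) :
    pairF ψ (lst [d] * x + presF d x) y = pairF ψ x (lastF ψ d y) := by
  induction x using formal_induction with
  | hl ξ =>
    induction y using formal_induction with
    | hl η =>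
      induction η using List.reverseRecOn with
      | nil =>
        rw [lst_nil, lastF_one, ← lst_nil, lst_mul]
        rcases ξ with _ | ⟨x, ξ⟩
        · rw [List.append_nil, lst_nil, presF_nil, add_zero, map_zero, ← lst_nil, pairF_lst,
            zipPair_of_length_ne ψ (by simp)]
        · simp only [presF_cons, map_add, LinearMap.add_apply, pairF_lst, map_zero]
          rw [zipPair_of_length_ne ψ (by simp), zipPair_of_length_ne ψ (by simp), add_zero]
      | append_singleton η f _ =>
        rw [lastF_concat, lst_mul, map_add, map_add, map_smul, LinearMap.add_apply, pairF_lst,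
          pairF_lst, pairF_lst, List.cons_append, List.nil_append, List.reverse_cons,
          zipPair_append_right ψ (by simp)]
        rcases ξ with _ | ⟨x, ξ⟩
        · rw [lst_nil, presF_nil, map_zero, LinearMap.zero_apply, add_zero, List.reverse_nil,
            zipPair_of_length_ne (ζ := []) (η := η ++ [f * d]) ψ (by simp), zero_add]
          simp [zipPair, hψ f d, mul_comm]
        · rw [presF_cons, pairF_lst, List.reverse_cons, List.reverse_cons,
            zipPair_append_right ψ (by simp), zipPair_append_right ψ (by simp)]
          simp only [zipPair, mul_one, smul_eq_mul, hψ f d]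
          rw [mul_assoc d, hψ d (x * f), mul_assoc, add_comm]
          ring
    | ha x y hx hy => simp only [map_add, LinearMap.add_apply] at hx hy ⊢; rw [← hx, ← hy]
    | hs c x hx => simp only [map_smul, hx]
  | ha x y hx hy =>
    simp only [mul_add, map_add, LinearMap.add_apply] at hx hy ⊢; rw [← hx, ← hy]; ring
  | hs c x hx =>
    rw [mul_smul_comm, map_smul, ← smul_add, map_smul, map_smul, LinearMap.smul_apply,
      LinearMap.smul_apply, hx]

end FormalOperators

/-! ### Rotations and the cyclic map -/

section Cyclic

variable {L : Type*}

/-- The sum of all rotations of a list. -/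
def rotF : FormalFock L →ₗ[ℂ] FormalFock L :=
  linExt fun ξ => splitSum (fun U g V => lst (V ++ (U ++ [g]))) ξ

theorem rotF_lst (ξ : List L) :
    rotF (lst ξ) = splitSum (fun U g V => lst (V ++ (U ++ [g]))) ξ := by simp [rotF]

/-- Rotations are indexed by cut points, and cutting before the first letter is the same as cutting
after the last one. -/
theorem rotF_lst' (ξ : List L) :
    rotF (lst ξ) = splitSum (fun U g V => lst (g :: (V ++ U))) ξ := by
  have := splitSum_shift (fun U V => lst (V ++ U)) ξ
  simpa [rotF_lst] using this

theorem rotF_cons (e : L) (ξ : List L) : rotF (lst (e :: ξ)) = rotF (lst (ξ ++ [e])) := by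
  simp only [rotF_lst, splitSum_cons, splitSum_append, splitSum_nil, add_zero, List.append_nil]
  rw [add_comm]
  simp

variable [Semigroup L] (ψ : L → ℂ)

/-- Moving the letter `e` from front to back moves its partner from the end to the front; this
interchanges the two indexings `rotF_lst` and `rotF_lst'` of the rotations. -/
theorem pairF_rot_cons (e : L) (ξ η : List L) :
    pairF ψ (lst (e :: ξ)) (rotF (lst η)) = pairF ψ (lst (ξ ++ [e])) (rotF (lst η)) := by
  conv_lhs => rw [rotF_lst, map_splitSum]
  conv_rhs => rw [rotF_lst', map_splitSum]
  refine splitSum_congr fun U g V _ => ?_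
  rw [pairF_lst, pairF_lst, List.reverse_cons, ← List.append_assoc,
    zipPair_append_right ψ (by simp), List.reverse_append]
  simp [zipPair, mul_comm]

theorem pairF_rot_append_comm (ζ ξ η : List L) :
    pairF ψ (lst (ζ ++ ξ)) (rotF (lst η)) = pairF ψ (lst (ξ ++ ζ)) (rotF (lst η)) := by
  induction ζ generalizing ξ with
  | nil => simp
  | cons e ζ ih =>
    rw [List.cons_append, pairF_rot_cons ψ, List.append_assoc, ih]
    simp

theorem pairF_rot_of_length_ne {ξ η : List L} (h : ξ.length ≠ η.length) :
    pairF ψ (lst ξ) (rotF (lst η)) = 0 := by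
  rw [rotF_lst, map_splitSum]
  refine splitSum_eq_zero fun U g V hη => ?_
  rw [pairF_lst, zipPair_of_length_ne]
  rw [hη] at h
  simp at h ⊢
  omega

/-- Rotating both arguments is symmetric and equals the length times rotating one argument. For
lists of equal positive length this factor can be cancelled. -/
theorem pairF_rot_comm (hψ : ∀ a b, ψ (a * b) = ψ (b * a)) (x y : FormalFock L) :
    pairF ψ x (rotF y) = pairF ψ y (rotF x) := by
  induction x using formal_induction with
  | hl ξ =>
    induction y using formal_induction with
    | hl η =>
      have key (ξ η : List L) : pairF ψ (rotF (lst ξ)) (rotF (lst η)) =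
          ξ.length * pairF ψ (lst ξ) (rotF (lst η)) := by
        rw [rotF_lst ξ, ← LinearMap.flip_apply, map_splitSum, ← nsmul_eq_mul, ← splitSum_const]
        refine splitSum_congr fun U g V hξ => ?_
        rw [LinearMap.flip_apply, pairF_rot_append_comm ψ, hξ]
        simp
      by_cases hl : ξ.length = η.length
      · rcases Nat.eq_zero_or_pos ξ.length with h0 | h0
        · have h1 : ξ = [] := List.length_eq_zero_iff.mp h0
          have h2 : η = [] := List.length_eq_zero_iff.mp (hl ▸ h0)
          rw [h1, h2]
        · have h1 := key ξ η
          rw [pairF_comm ψ hψ, key η ξ, ← hl] at h1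
          exact (mul_left_cancel₀ (by exact_mod_cast h0.ne') h1).symm
      · rw [pairF_rot_of_length_ne ψ hl, pairF_rot_of_length_ne ψ (Ne.symm hl)]
    | ha x y hx hy => simp only [map_add, LinearMap.add_apply, hx, hy]
    | hs c x hx => simp only [map_smul, LinearMap.smul_apply, hx]
  | ha x y hx hy => simp only [map_add, LinearMap.add_apply, hx, hy]
  | hs c x hx => simp only [map_smul, LinearMap.smul_apply, hx]

/-- The map `c` on lists. -/
def cycList : List L → FormalFock L
  | [] => 0
  | [e] => lst [e]
  | e :: f :: l => lst (e :: f :: l) +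
      lst ((f :: l).getLast (List.cons_ne_nil f l) * e :: (f :: l).dropLast) +
      ψ (e * (f :: l).getLast (List.cons_ne_nil f l)) • cycList (f :: l).dropLast
  termination_by l => l.length
  decreasing_by simp

/-- The recursion of `cycList` removes both ends of a list; this form fits the induction
`List.bidirectionalRec`. -/
theorem cycList_ends (e : L) (m : List L) (f : L) :
    cycList ψ (e :: (m ++ [f])) =
      lst (e :: (m ++ [f])) + lst (f * e :: m) + ψ (e * f) • cycList ψ m := by
  obtain ⟨a, l, h⟩ := List.exists_cons_of_ne_nil (l := m ++ [f]) (by simp)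
  rw [h, cycList]
  have h1 : (a :: l).getLast (List.cons_ne_nil a l) = f := by simp [← h]
  have h2 : (a :: l).dropLast = m := by simp [← h]
  rw [h1, h2]

/-- The map `c` on the formal Fock space, with circular tensors represented by tensors. -/
def cycF : FormalFock L →ₗ[ℂ] FormalFock L := linExt (cycList ψ)

@[simp] theorem cycF_lst (ξ : List L) : cycF ψ (lst ξ) = cycList ψ ξ := by simp [cycF]

@[simp] theorem cycF_one : cycF ψ (1 : FormalFock L) = 0 := by
  rw [← lst_nil, cycF_lst, cycList]

/-- A letter `d` put in front becomes the cyclic neighbour of the last letter `f`. The merging and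
contraction of these two that `c` performs are exactly the two terms of `lastF ψ d`, up to a
rotation of `(f * d) :: ξ`. -/
theorem rotF_cycF_opF (hψ : ∀ a b, ψ (a * b) = ψ (b * a)) (d : L) (x : FormalFock L) :
    rotF (cycF ψ (opF ψ d x)) = ψ d • rotF (cycF ψ x) + rotF (cycF ψ (annF ψ d x)) +
      rotF (cycF ψ (lastF ψ d x)) + rotF (lst [d] * x + presF d x) := by
  -- The constant and the annihilation part pass through linearly; only creation and multiplication
  -- interact with `c`.
  suffices h : rotF (cycF ψ (lst [d] * x + presF d x)) =
      rotF (cycF ψ (lastF ψ d x)) + rotF (lst [d] * x + presF d x) by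
    rw [opF_apply, map_add, map_add, map_add, map_add, h, map_smul, map_smul]
    abel
  induction x using formal_induction with
  | hl ξ =>
    induction ξ using List.bidirectionalRec with
    | nil => simp [lst_nil, cycList]
    | singleton e =>
      have h := cycList_ends ψ d [] e
      rw [List.nil_append] at h
      rw [lst_mul, presF_cons, lastF_single]
      simp only [List.cons_append, List.nil_append, map_add, map_smul, cycF_lst, h, cycF_one]
      simp only [cycList, smul_zero, map_zero, add_zero]
      abel
    | cons_append e m f _ =>
      have h1 : cycList ψ (d :: (e :: (m ++ [f]))) = _ := cycList_ends ψ d (e :: m) f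
      have h2 : lastF ψ d (lst (e :: (m ++ [f]))) = _ := lastF_concat ψ d (e :: m) f
      rw [lst_mul, presF_cons, h2]
      simp only [List.cons_append, List.nil_append, map_add, map_smul, cycF_lst, h1, cycList_ends,
        rotF_cons (f * d)]
      rw [hψ d f, mul_assoc f d e, mul_assoc d e f, hψ d (e * f), mul_assoc e f d]
      abel
  | ha x y hx hy => simp only [mul_add, map_add] at hx hy ⊢; rw [add_add_add_comm, hx, hy]; abel
  | hs c x hx =>
    simp only [mul_smul_comm, map_smul, ← smul_add, map_add] at hx ⊢; rw [hx]

/-! ### Cyclic derivatives -/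

/-- The sum over all positions of a list of the Wick product of the suffix with the image under
`Y` of the prefix, the marked letter being multiplied by `d`. -/
def cutF (d : L) (Y : Module.End ℂ (FormalFock L)) : FormalFock L →ₗ[ℂ] FormalFock L :=
  linExt fun ξ => splitSum (fun U g V => wickF ψ (lst V) (Y (lastF ψ d (lst (U ++ [g]))))) ξ

theorem cutF_lst (d : L) (Y : Module.End ℂ (FormalFock L)) (ξ : List L) :
    cutF ψ d Y (lst ξ) =
      splitSum (fun U g V => wickF ψ (lst V) (Y (lastF ψ d (lst (U ++ [g]))))) ξ := by
  simp [cutF]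

/-- A letter put in front is either the marked one, or it belongs to the prefix of the marked one,
and is then absorbed into `Y`. The parameter `Y` exists for this induction. -/
theorem cutF_opF (d e : L) (Y : Module.End ℂ (FormalFock L)) (x : FormalFock L) :
    cutF ψ d Y (opF ψ e x) =
      wickF ψ x (Y (opF ψ (e * d) 1)) + cutF ψ d (Y * opF ψ e) x := by
  induction x using formal_induction with
  | hl ξ =>
    rcases ξ with _ | ⟨f, ξ⟩
    · rw [lst_nil, opF_one, map_add, map_smul, ← lst_nil, cutF_lst, cutF_lst, cutF_lst]
      simp [lst_nil, lastF_single]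
    · have h1 : ∀ U g V, f :: ξ = U ++ g :: V →
          wickF ψ (lst V) ((Y * opF ψ e) (lastF ψ d (lst (U ++ [g])))) =
          wickF ψ (lst V) (Y (lastF ψ d (opF ψ e (lst (U ++ [g]))))) := by
        intro U g V _
        -- The list `U ++ [g]` is not empty, so the vacuum correction in `lastF_opF` is absent.
        obtain ⟨a, l, h⟩ := List.exists_cons_of_ne_nil (l := U ++ [g]) (by simp)
        rw [h, lastF_opF, vacF_cons, zero_smul, add_zero, Module.End.mul_apply]
      rw [cutF_lst ψ d (Y * opF ψ e), splitSum_congr h1, opF_cons]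
      simp only [map_add, map_smul, cutF_lst, splitSum_cons, List.nil_append, List.cons_append,
        opF_cons, splitSum_add, ← splitSum_smul, lastF_single, opF_one, smul_add, lst_nil,
        lastF_one, map_zero, smul_zero]
      abel
  | ha x y hx hy => simp only [map_add, LinearMap.add_apply, hx, hy]; abel
  | hs c x hx => simp only [map_smul, LinearMap.smul_apply, hx, smul_add]

/-- On words, `cutF` with `Y = 1` is a cyclic derivative: it opens the cyclic word at each of its
letters and multiplies that letter by `d`. -/
theorem cutF_state (d : L) (Y : Module.End ℂ (FormalFock L)) (Z : List L) :
    cutF ψ d Y (state ψ Z) =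
      splitSum (fun U e V => opWord ψ V (Y (state ψ (U ++ [e * d])))) Z := by
  induction Z generalizing Y with
  | nil => rw [state_nil, ← lst_nil, cutF_lst]; simp
  | cons e Z ih =>
    rw [state_cons, cutF_opF, ih, wickF_state]
    simp

/-- The Wick product acts at the junction of the two lists and `lastF` at the far end, so the
recursion of the Wick product survives, even when a single letter `e` remains and both actions meet
there. -/
theorem wickF_lastF (d f e : L) (V η : List L) :
    wickF ψ (lst (V ++ [f])) (lastF ψ d (lst (e :: η))) =
      lastF ψ d (lst (V ++ f :: e :: η)) + lastF ψ d (lst (V ++ (f * e) :: η)) +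
        ψ (f * e) • wickF ψ (lst V) (lastF ψ d (lst η)) := by
  have key (y : L) (l : List L) : wickF ψ (lst (V ++ [f])) (lst (y :: l)) =
      lst (V ++ f :: y :: l) + lst (V ++ (f * y) :: l) + ψ (f * y) • wickF ψ (lst V) (lst l) := by
    simp [wickList]
  induction η using List.reverseRecOn with
  | nil =>
    rw [lastF_single, map_add, map_smul, key, ← lst_nil, lst_nil, lastF_one, lastF_concat,
      show V ++ [f, e] = (V ++ [f]) ++ [e] by simp, lastF_concat, ← lst_nil, wickF_lst, wickF_lst,
      wickList_nil_right, wickList_nil_right]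
    simp [mul_assoc]
    abel
  | append_singleton η g _ =>
    rw [← List.cons_append, lastF_concat, lastF_concat, List.cons_append, map_add, map_smul, key,
      List.cons_append, key,
      show V ++ f :: e :: (η ++ [g]) = (V ++ f :: e :: η) ++ [g] by simp,
      show V ++ (f * e) :: (η ++ [g]) = (V ++ (f * e) :: η) ++ [g] by simp,
      lastF_concat, lastF_concat]
    simp only [map_add, map_smul, smul_add, List.append_assoc, List.cons_append]
    simp only [smul_comm (ψ (g * d))]
    abel

/-- The Wick product of suffix and prefix contracts or merges the two ends of the list, which is
what `c` does to a circular tensor. Peeling off both ends `e` and `f` gives the same recursion on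
either side. -/
theorem cutF_eq (hψ : ∀ a b, ψ (a * b) = ψ (b * a)) (d : L) (x : FormalFock L) :
    cutF ψ d 1 x = lastF ψ d (rotF (cycF ψ x)) := by
  induction x using formal_induction with
  | hl ξ =>
    induction ξ using List.bidirectionalRec with
    | nil => rw [cutF_lst]; simp [cycList]
    | singleton e => rw [cutF_lst]; simp [cycList, rotF_lst, lst_nil]
    | cons_append e m f ih =>
      rw [cycF_lst] at ih
      rw [cycF_lst, cycList_ends, hψ e f, map_add, map_add, map_add, map_add, map_smul, map_smul, ← ih,
        cutF_lst, cutF_lst, rotF_lst, rotF_lst, splitSum_cons, splitSum_append, splitSum_cons,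
        splitSum_cons, splitSum_append]
      simp only [splitSum_cons, splitSum_nil, List.nil_append, List.append_nil, add_zero,
        List.cons_append, Module.End.one_apply, wickF_lastF, lst_nil, wickF_one, lastF_one,
        map_zero, smul_zero, splitSum_add, splitSum_smul, map_add, map_splitSum,
        List.append_assoc]
      abel
  | ha x y hx hy => simp only [map_add, hx, hy]
  | hs c x hx => simp only [map_smul, hx]

/-! ### The second order functional -/

/-- The bilinear form `(x, y) ↦ ⟨c x, c y⟩` of the formal Fock space. -/
def rhoF : FormalFock L →ₗ[ℂ] FormalFock L →ₗ[ℂ] ℂ :=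
  (pairF ψ).compl₁₂ (cycF ψ) (rotF ∘ₗ cycF ψ)

theorem rhoF_apply (x y : FormalFock L) :
    rhoF ψ x y = pairF ψ (cycF ψ x) (rotF (cycF ψ y)) := rfl

theorem rhoF_comm (hψ : ∀ a b, ψ (a * b) = ψ (b * a)) (x y : FormalFock L) :
    rhoF ψ x y = rhoF ψ y x := pairF_rot_comm ψ hψ _ _

/-- The second order functional on words. -/
def rhoWord (W Z : List L) : ℂ := rhoF ψ (state ψ W) (state ψ Z)

theorem rhoWord_nil_left (Z : List L) : rhoWord ψ [] Z = 0 := by simp [rhoWord, rhoF_apply]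

/-- The Schwinger-Dyson equation for `rhoWord`. -/
theorem rhoWord_cons (hψ : ∀ a b, ψ (a * b) = ψ (b * a)) (d : L) (W Z : List L) :
    rhoWord ψ (d :: W) Z = ψ d * rhoWord ψ W Z +
      splitSum (fun U g V => phiWord ψ (U ++ [g * d]) * rhoWord ψ V Z +
        phiWord ψ V * rhoWord ψ (U ++ [g * d]) Z) W +
      splitSum (fun U e V => phiWord ψ (W ++ (V ++ (U ++ [e * d])))) Z := by
  have h0 (x y : FormalFock L) : rhoF ψ x y = pairF ψ (rotF (cycF ψ x)) (cycF ψ y) := by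
    rw [rhoF_comm ψ hψ, rhoF_apply, pairF_comm ψ hψ]
  -- The term joining the two words. Symmetry moves the rotations to the other argument,
  -- `pairF_lastF` turns the creation of `d` into `lastF`, and `cutF_eq` with `cutF_state` opens `Z`
  -- at each letter `e`.
  have h1 : pairF ψ (rotF (lst [d] * state ψ W + presF d (state ψ W))) (cycF ψ (state ψ Z)) =
      splitSum (fun U e V => phiWord ψ (W ++ (V ++ (U ++ [e * d])))) Z := by
    rw [pairF_comm ψ hψ, pairF_rot_comm ψ hψ, pairF_lastF ψ hψ, ← cutF_eq ψ hψ, cutF_state,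
      map_splitSum]
    refine splitSum_congr fun U e V _ => ?_
    rw [pairF_state, Module.End.one_apply, phiWord, state_append ψ W,
      state_append ψ V, state_append ψ U]
  rw [rhoWord, h0, state_cons, rotF_cycF_opF ψ hψ, map_add, LinearMap.add_apply, h1,
    annF_state ψ hψ _ W le_rfl, lastF_state, splitSum_add]
  have h2 (F : List L → L → List L → FormalFock L) (y : FormalFock L) :
      pairF ψ (rotF (cycF ψ (splitSum F W))) y =
        splitSum (fun U g V => pairF ψ (rotF (cycF ψ (F U g V))) y) W :=
    map_splitSum ((pairF ψ).flip y ∘ₗ rotF ∘ₗ cycF ψ) F W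
  rw [map_add, map_add, LinearMap.add_apply, LinearMap.add_apply, h2, h2]
  simp only [map_smul, LinearMap.smul_apply, ← h0, smul_eq_mul]
  rw [add_assoc (ψ d * _)]
  rfl

/-- In `rhoWord_cons` the word `Z` occurs only inside ρ with a shorter first word and in a sum over
all its rotations. The bound `n` covers `U ++ [g * d]`, which is not a sublist of `W`. -/
theorem rhoWord_rotate_right (hψ : ∀ a b, ψ (a * b) = ψ (b * a)) (n : ℕ) (W : List L)
    (hn : W.length ≤ n) (f : L) (Z : List L) :
    rhoWord ψ W (f :: Z) = rhoWord ψ W (Z ++ [f]) := by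
  induction n generalizing W with
  | zero =>
    have : W = [] := List.length_eq_zero_iff.mp (by omega)
    rw [this, rhoWord_nil_left, rhoWord_nil_left]
  | succ n ih =>
    rcases W with _ | ⟨d, W⟩
    · rw [rhoWord_nil_left, rhoWord_nil_left]
    have hW : W.length ≤ n := by simpa using hn
    have h1 : splitSum (fun U g V => phiWord ψ (U ++ [g * d]) * rhoWord ψ V (f :: Z) +
        phiWord ψ V * rhoWord ψ (U ++ [g * d]) (f :: Z)) W =
        splitSum (fun U g V => phiWord ψ (U ++ [g * d]) * rhoWord ψ V (Z ++ [f]) +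
        phiWord ψ V * rhoWord ψ (U ++ [g * d]) (Z ++ [f])) W := by
      refine splitSum_congr fun U g V hUV => ?_
      have hl : W.length = U.length + (V.length + 1) := by simp [hUV]
      rw [ih V (by omega), ih (U ++ [g * d]) (by rw [List.length_append, List.length_singleton]; omega)]
    rw [rhoWord_cons ψ hψ, rhoWord_cons ψ hψ, ih W hW, h1, splitSum_cons, splitSum_append,
      splitSum_cons, splitSum_nil, add_zero, add_comm (phiWord ψ _)]
    simp

theorem rhoWord_append_comm_right (hψ : ∀ a b, ψ (a * b) = ψ (b * a)) (W Z Z' : List L) :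
    rhoWord ψ W (Z ++ Z') = rhoWord ψ W (Z' ++ Z) := by
  induction Z generalizing Z' with
  | nil => simp
  | cons f Z ih =>
    rw [List.cons_append, rhoWord_rotate_right ψ hψ _ W le_rfl, List.append_assoc, ih]
    simp

end Cyclic

/-! ### Transfer along homomorphisms -/

section Transfer

variable {A B : Type*} [Ring A] [Algebra ℂ A] [Ring B] [Algebra ℂ B]
  {φ : A →ₗ[ℂ] ℂ} {ρ : A →ₗ[ℂ] A →ₗ[ℂ] ℂ} {φ' : B →ₗ[ℂ] ℂ} {ρ' : B →ₗ[ℂ] B →ₗ[ℂ] ℂ}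

theorem IsSecondOrderSpace.of_surjective (h : IsSecondOrderSpace φ' ρ') (f : B →ₐ[ℂ] A)
    (hf : Function.Surjective f) (hφ : ∀ t, φ (f t) = φ' t)
    (hρ : ∀ s t, ρ (f s) (f t) = ρ' s t) : IsSecondOrderSpace φ ρ where
  map_one := by rw [← _root_.map_one f, hφ, h.map_one]
  trace a b := by
    obtain ⟨a, rfl⟩ := hf a
    obtain ⟨b, rfl⟩ := hf b
    rw [← map_mul, ← map_mul, hφ, hφ, h.trace]
  trace_left a b c := by
    obtain ⟨a, rfl⟩ := hf a
    obtain ⟨b, rfl⟩ := hf b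
    obtain ⟨c, rfl⟩ := hf c
    rw [← map_mul, ← map_mul, hρ, hρ, h.trace_left]
  trace_right a b c := by
    obtain ⟨a, rfl⟩ := hf a
    obtain ⟨b, rfl⟩ := hf b
    obtain ⟨c, rfl⟩ := hf c
    rw [← map_mul, ← map_mul, hρ, hρ, h.trace_right]
  one_right a := by
    obtain ⟨a, rfl⟩ := hf a
    rw [← _root_.map_one f, hρ, h.one_right]
  one_left a := by
    obtain ⟨a, rfl⟩ := hf a
    rw [← _root_.map_one f, hρ, h.one_left]

theorem map_tupleProd (f : B →ₐ[ℂ] A) {n : ℕ} (a : Fin n → B) :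
    f (tupleProd a) = tupleProd (fun k => f (a k)) := by
  simp [tupleProd, map_list_prod, List.map_ofFn, Function.comp_def]

/-- Tuples lift entry by entry along `f`, and centredness and all values are preserved because the
functionals are pulled back; injectivity of `f` plays no role. -/
theorem IsSecondOrderFree.of_map {ι : Type*} {C : ι → Subalgebra ℂ B} {D : ι → Subalgebra ℂ A}
    (h : IsSecondOrderFree φ' ρ' C) (f : B →ₐ[ℂ] A) (hD : ∀ i, D i ≤ (C i).map f)
    (hφ : ∀ t, φ (f t) = φ' t) (hρ : ∀ s t, ρ (f s) (f t) = ρ' s t) :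
    IsSecondOrderFree φ ρ D := by
  have lift {n : ℕ} {a : Fin n → A} {i : Fin n → ι} (ha : ∀ k, a k ∈ D (i k)) :
      ∃ t : Fin n → B, (∀ k, t k ∈ C (i k)) ∧ a = fun k => f (t k) := by
    choose t ht hta using fun k => Subalgebra.mem_map.mp (hD _ (ha k))
    exact ⟨t, ht, funext fun k => (hta k).symm⟩
  have cyc {n : ℕ} {a : Fin n → A} (ha : IsCyclicallyAlternating D a) :
      ∃ t : Fin n → B, IsCyclicallyAlternating C t ∧ a = fun k => f (t k) := by
    obtain ⟨i, hi, hc⟩ := ha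
    obtain ⟨t, ht, rfl⟩ := lift hi
    exact ⟨t, ⟨i, ht, hc⟩, rfl⟩
  have cen {n : ℕ} {t : Fin n → B} (ht : IsCentered φ fun k => f (t k)) : IsCentered φ' t :=
    fun k => by rw [← hφ]; exact ht k
  constructor
  · intro n a i hn ha hi hc
    obtain ⟨t, ht, rfl⟩ := lift ha
    rw [← map_tupleProd, hφ]
    exact h.free n t i hn ht hi (cen hc)
  · intro n m a b hn hm ha hb hca hcb hnm
    obtain ⟨s, hs, rfl⟩ := cyc ha
    obtain ⟨t, ht, rfl⟩ := cyc hb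
    rw [← map_tupleProd, ← map_tupleProd, hρ]
    exact h.of_ne n m s t hn hm hs ht (cen hca) (cen hcb) hnm
  · intro i j hij a ha b hb
    obtain ⟨s, hs, rfl⟩ := Subalgebra.mem_map.mp (hD _ ha)
    obtain ⟨t, ht, rfl⟩ := Subalgebra.mem_map.mp (hD _ hb)
    exact (hρ s t).trans (h.single i j hij s hs t ht)
  · intro n a b hn ha hb hca hcb
    obtain ⟨s, hs, rfl⟩ := cyc ha
    obtain ⟨t, ht, rfl⟩ := cyc hb
    rw [← map_tupleProd, ← map_tupleProd, hρ, h.of_eq n s t hn hs ht (cen hca) (cen hcb)]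
    simp only [← map_mul, hφ]

end Transfer

/-! ### Multilinear maps and spans -/

theorem multilinear_ext_span {M N : Type*} [AddCommGroup M] [Module ℂ M] [AddCommGroup N]
    [Module ℂ N] {n : ℕ} {f g : MultilinearMap ℂ (fun _ : Fin n => M) N} (S : Fin n → Set M)
    (h : ∀ a, (∀ k, a k ∈ S k) → f a = g a) (a : Fin n → M)
    (ha : ∀ k, a k ∈ Submodule.span ℂ (S k)) : f a = g a := by
  -- The set `s` collects the coordinates already released from `S k` to its span; they are released
  -- one at a time.
  suffices H : ∀ (s : Finset (Fin n)) (a : Fin n → M), (∀ k, a k ∈ Submodule.span ℂ (S k)) →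
      (∀ k, k ∉ s → a k ∈ S k) → f a = g a from
    H Finset.univ a ha fun k hk => absurd (Finset.mem_univ k) hk
  intro s
  induction s using Finset.induction_on with
  | empty => exact fun a _ ha' => h a fun k => ha' k (Finset.notMem_empty k)
  | insert k s _ ih =>
    intro a ha ha'
    have key : ∀ x ∈ Submodule.span ℂ (S k),
        f (Function.update a k x) = g (Function.update a k x) := by
      intro x hx
      induction hx using Submodule.span_induction with
      | mem x hx =>
        refine ih _ (fun l => ?_) (fun l hl => ?_)
        · rcases eq_or_ne l k with rfl | hlk
          · rw [Function.update_self]; exact Submodule.subset_span hx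
          · rw [Function.update_of_ne hlk]; exact ha l
        · rcases eq_or_ne l k with rfl | hlk
          · rw [Function.update_self]; exact hx
          · rw [Function.update_of_ne hlk]
            exact ha' l (by simp [hlk, hl])
      | zero => simp
      | add x y _ _ hx hy => rw [f.map_update_add, g.map_update_add, hx, hy]
      | smul c x _ hx => rw [f.map_update_smul, g.map_update_smul, hx]
    have := key (a k) (ha k)
    rwa [Function.update_eq_self] at this

/-! ### The free algebra on the letters -/

section FreeLevel

variable {L : Type*} [Semigroup L] (ψ : L → ℂ)

/-- The product of the generators of a word. -/
def freeWord {L : Type*} (W : List L) : FreeAlgebra ℂ L := (W.map (FreeAlgebra.ι ℂ)).prod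

theorem freeWord_append {L : Type*} (U V : List L) :
    freeWord (U ++ V) = freeWord U * freeWord V := by simp [freeWord]

theorem span_freeWord {L : Type*} :
    Submodule.span ℂ (Set.range (freeWord (L := L))) = ⊤ := by
  refine eq_top_iff.mpr fun t _ => ?_
  induction t using FreeAlgebra.induction with
  | grade0 c =>
    rw [Algebra.algebraMap_eq_smul_one]
    exact Submodule.smul_mem _ _ (Submodule.subset_span ⟨[], rfl⟩)
  | grade1 x => exact Submodule.subset_span ⟨[x], by simp [freeWord]⟩
  | add a b ha hb => exact add_mem (ha trivial) (hb trivial)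
  | mul a b ha hb =>
    have := Submodule.mul_mem_mul (ha trivial) (hb trivial)
    rw [Submodule.span_mul_span] at this
    refine Submodule.span_mono ?_ this
    rintro _ ⟨_, ⟨U, rfl⟩, _, ⟨V, rfl⟩, rfl⟩
    exact ⟨U ++ V, freeWord_append U V⟩

theorem free_induction {L : Type*} {p : FreeAlgebra ℂ L → Prop} (t : FreeAlgebra ℂ L)
    (hw : ∀ W, p (freeWord W)) (ha : ∀ s t, p s → p t → p (s + t))
    (hs : ∀ (c : ℂ) t, p t → p (c • t)) : p t := by
  have h : t ∈ Submodule.span ℂ (Set.range (freeWord (L := L))) := span_freeWord ▸ trivial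
  induction h using Submodule.span_induction with
  | mem x hx => obtain ⟨W, rfl⟩ := hx; exact hw W
  | zero => simpa using hs 0 _ (hw [])
  | add x y _ _ hx hy => exact ha x y hx hy
  | smul c x _ hx => exact hs c x hx

/-- The action of the free algebra on the formal Fock space. -/
def freeOp : FreeAlgebra ℂ L →ₐ[ℂ] Module.End ℂ (FormalFock L) := FreeAlgebra.lift ℂ (opF ψ)

/-- An element of the free algebra applied to the vacuum. -/
def freeVec : FreeAlgebra ℂ L →ₗ[ℂ] FormalFock L :=
  (LinearMap.applyₗ (1 : FormalFock L)).comp (freeOp ψ).toLinearMap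

theorem freeVec_apply (t : FreeAlgebra ℂ L) : freeVec ψ t = freeOp ψ t 1 := rfl

theorem freeOp_freeWord (W : List L) : freeOp ψ (freeWord W) = opWord ψ W := by
  simp [freeOp, freeWord, opWord, map_list_prod, Function.comp_def]

theorem freeVec_freeWord (W : List L) : freeVec ψ (freeWord W) = state ψ W := by
  rw [freeVec_apply, freeOp_freeWord, state]

theorem freeVec_mul (s t : FreeAlgebra ℂ L) : freeVec ψ (s * t) = freeOp ψ s (freeVec ψ t) := by
  simp [freeVec_apply]

/-- The first order functional on the free algebra. -/
def phiFree : FreeAlgebra ℂ L →ₗ[ℂ] ℂ := vacF ∘ₗ freeVec ψ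

/-- The second order functional on the free algebra. -/
def rhoFree : FreeAlgebra ℂ L →ₗ[ℂ] FreeAlgebra ℂ L →ₗ[ℂ] ℂ :=
  (rhoF ψ).compl₁₂ (freeVec ψ) (freeVec ψ)

theorem phiFree_apply (t : FreeAlgebra ℂ L) : phiFree ψ t = vacF (freeVec ψ t) := rfl

theorem rhoFree_apply (s t : FreeAlgebra ℂ L) :
    rhoFree ψ s t = rhoF ψ (freeVec ψ s) (freeVec ψ t) := rfl

theorem phiFree_freeWord (W : List L) : phiFree ψ (freeWord W) = phiWord ψ W := by
  rw [phiFree_apply, freeVec_freeWord, phiWord]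

theorem rhoFree_freeWord (W Z : List L) :
    rhoFree ψ (freeWord W) (freeWord Z) = rhoWord ψ W Z := by
  rw [rhoFree_apply, freeVec_freeWord, freeVec_freeWord, rhoWord]

/-- The pairing of vacuum vectors is the moment of the product, so symmetry of `pairF` becomes
traciality of φ and products of pairings become products of moments. -/
theorem pairF_freeVec (s t : FreeAlgebra ℂ L) :
    pairF ψ (freeVec ψ s) (freeVec ψ t) = phiFree ψ (s * t) := by
  induction s using free_induction with
  | hw W =>
    rw [freeVec_freeWord, pairF_state, phiFree_apply, freeVec_mul, freeOp_freeWord]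
  | ha s t hs ht => simp only [map_add, LinearMap.add_apply, add_mul, hs, ht]
  | hs c t ht => simp only [map_smul, LinearMap.smul_apply, smul_mul_assoc, ht]

theorem rhoFree_comm (hψ : ∀ a b, ψ (a * b) = ψ (b * a)) (s t : FreeAlgebra ℂ L) :
    rhoFree ψ s t = rhoFree ψ t s := rhoF_comm ψ hψ _ _

theorem isSecondOrderSpace_free (hψ : ∀ a b, ψ (a * b) = ψ (b * a)) :
    IsSecondOrderSpace (phiFree ψ) (rhoFree ψ) := by
  have tr (a b c : FreeAlgebra ℂ L) : rhoFree ψ a (b * c) = rhoFree ψ a (c * b) := by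
    induction a using free_induction with
    | hw W =>
      induction b using free_induction with
      | hw U =>
        induction c using free_induction with
        | hw V =>
          rw [← freeWord_append, ← freeWord_append, rhoFree_freeWord, rhoFree_freeWord,
            rhoWord_append_comm_right ψ hψ]
        | ha s t hs ht => simp only [mul_add, add_mul, map_add, hs, ht]
        | hs c t ht => simp only [mul_smul_comm, smul_mul_assoc, map_smul, ht]
      | ha s t hs ht => simp only [mul_add, add_mul, map_add, hs, ht]
      | hs c t ht => simp only [mul_smul_comm, smul_mul_assoc, map_smul, ht]
    | ha s t hs ht => simp only [map_add, LinearMap.add_apply, hs, ht]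
    | hs c t ht => simp only [map_smul, LinearMap.smul_apply, ht]
  have one (a : FreeAlgebra ℂ L) : rhoFree ψ a 1 = 0 := by
    simp [rhoFree_apply, freeVec_apply, rhoF_apply]
  refine ⟨by simp [phiFree_apply, freeVec_apply], fun a b => ?_, fun a b c => ?_, tr, one,
    fun b => ?_⟩
  · rw [← pairF_freeVec, pairF_comm ψ hψ, pairF_freeVec]
  · rw [rhoFree_comm ψ hψ, tr, rhoFree_comm ψ hψ]
  · rw [rhoFree_comm ψ hψ, one]

end FreeLevel

/-! ### Lists of blocks of letters -/

theorem exists_forall₂_of_append_right {α β : Type*} {R : α → β → Prop} {l : List α}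
    {A B : List β} (h : List.Forall₂ R l (A ++ B)) :
    ∃ l₁ l₂, List.Forall₂ R l₁ A ∧ List.Forall₂ R l₂ B ∧ l = l₁ ++ l₂ :=
  ⟨_, _, List.forall₂_take_append l A B h, List.forall₂_drop_append l A B h,
    (List.take_append_drop _ _).symm⟩

theorem exists_forall₂_of_append_left {α β : Type*} {R : α → β → Prop} {A B : List α}
    {l : List β} (h : List.Forall₂ R (A ++ B) l) :
    ∃ l₁ l₂, List.Forall₂ R A l₁ ∧ List.Forall₂ R B l₂ ∧ l = l₁ ++ l₂ := by
  obtain ⟨l₁, l₂, h₁, h₂, rfl⟩ := exists_forall₂_of_append_right h.flip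
  exact ⟨l₁, l₂, h₁.flip, h₂.flip, rfl⟩

section Blocks

variable {L ι : Type*} [SemigroupWithZero L] {ψ : L → ℂ} {S : ι → Set L}

/-- Nonempty lists of letters of the colour `i`. -/
def blocks (S : ι → Set L) (i : ι) : Set (List L) := {ξ | ξ ≠ [] ∧ ∀ x ∈ ξ, x ∈ S i}

/-- The pairing of lists of blocks. -/
def blockPair (ψ : L → ℂ) : List (List L) → List (List L) → ℂ
  | [], [] => 1
  | x :: X, y :: Y => zipPair ψ x y * blockPair ψ X Y
  | [], _ :: _ => 0
  | _ :: _, [] => 0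

/-- Blocks of different lengths cannot be aligned. If the colours `i` and `j` differ, the first
letters already give zero. If they agree, the first surplus letter `f` of the longer block meets the
next block on the other side, whose colour `k` is different from `i`. -/
theorem zipPair_block_lt (h0 : ψ 0 = 0)
    (hS : ∀ i j, i ≠ j → ∀ a ∈ S i, ∀ b ∈ S j, a * b = 0) {I : List ι} {X : List (List L)}
    (hX : List.Forall₂ (fun i ξ => ξ ∈ blocks S i) I X) {i j : ι} (hI : ∀ k ∈ I.head?, i ≠ k)
    {x y R : List L} (hx : x ∈ blocks S i) (hy : y ∈ blocks S j) (hxy : x.length < y.length) :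
    zipPair ψ (x ++ X.flatten) (y ++ R) = 0 := by
  obtain ⟨y₁, y₂, rfl, hl⟩ : ∃ y₁ y₂, y = y₁ ++ y₂ ∧ x.length = y₁.length :=
    ⟨y.take x.length, y.drop x.length, (List.take_append_drop _ _).symm, by simp; omega⟩
  rw [List.append_assoc, zipPair_append ψ hl]
  rcases y₂ with _ | ⟨f, y₂⟩
  · simp at hxy; omega
  cases hX with
  | nil => rw [List.flatten_nil, zipPair_of_length_ne ψ (ζ := []) (by simp), mul_zero]
  | @cons k ξ I X hξ _ =>
    obtain ⟨hξ0, hξ⟩ := hξ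
    obtain ⟨e, ξ, rfl⟩ := List.exists_cons_of_ne_nil hξ0
    obtain ⟨e₀, x, rfl⟩ := List.exists_cons_of_ne_nil hx.1
    obtain ⟨f₀, y₁, rfl⟩ := List.exists_cons_of_ne_nil (l := y₁) (by rintro rfl; simp at hl)
    have hik : i ≠ k := hI k (by simp)
    simp only [List.flatten_cons, List.cons_append, zipPair]
    by_cases hij : i = j
    · rw [hS k j (hij ▸ hik.symm) e (hξ e (by simp)) f (hy.2 f (by simp)), h0]
      simp
    · rw [hS i j hij e₀ (hx.2 e₀ (by simp)) f₀ (hy.2 f₀ (by simp)), h0]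
      simp

/-- Pairing letter by letter equals pairing block by block, since any misalignment of the blocks
pairs letters of different colours. -/
theorem zipPair_flatten (hψ : ∀ a b, ψ (a * b) = ψ (b * a)) (h0 : ψ 0 = 0)
    (hS : ∀ i j, i ≠ j → ∀ a ∈ S i, ∀ b ∈ S j, a * b = 0) {I J : List ι} {X Y : List (List L)}
    (hX : List.Forall₂ (fun i ξ => ξ ∈ blocks S i) I X)
    (hY : List.Forall₂ (fun i ξ => ξ ∈ blocks S i) J Y)
    (hI : I.IsChain (· ≠ ·)) (hJ : J.IsChain (· ≠ ·)) :
    zipPair ψ X.flatten Y.flatten = blockPair ψ X Y := by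
  induction hX generalizing J Y with
  | nil =>
    cases hY with
    | nil => rfl
    | cons hη _ =>
      obtain ⟨f, η, rfl⟩ := List.exists_cons_of_ne_nil hη.1
      rfl
  | @cons i x I X hx hX ih =>
    cases hY with
    | nil =>
      obtain ⟨f, η, rfl⟩ := List.exists_cons_of_ne_nil hx.1
      rfl
    | @cons j y J Y hy hY =>
      rw [List.isChain_cons] at hI hJ
      rw [List.flatten_cons, List.flatten_cons, blockPair]
      rcases lt_trichotomy x.length y.length with hl | hl | hl
      · rw [zipPair_block_lt h0 hS hX hI.1 hx hy hl, zipPair_of_length_ne ψ hl.ne, zero_mul]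
      · rw [zipPair_append ψ hl, ih hY hI.2 hJ.2]
      · rw [zipPair_comm ψ hψ, zipPair_block_lt h0 hS hY hJ.1 hy hx hl,
          zipPair_of_length_ne ψ hl.ne', zero_mul]

omit [SemigroupWithZero L] in
theorem splitSum_flatten {M : Type*} [AddCommMonoid M] (F : List L → L → List L → M)
    (H : List (List L)) :
    splitSum F H.flatten = splitSum (fun H₁ η H₂ => splitSum (fun U g V =>
      F (H₁.flatten ++ U) g (V ++ H₂.flatten)) η) H := by
  induction H generalizing F with
  | nil => rfl
  | cons η H ih => simp [splitSum_append, ih]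

/-- Used for rotations cutting through a block, where only the outermost letters on each side are
controlled. -/
theorem zipPair_ends_zero {x y e f : L} (h : ψ (x * y) = 0 ∨ ψ (e * f) = 0) (m m' : List L) :
    zipPair ψ (x :: (m ++ [e])) (y :: (m' ++ [f])) = 0 := by
  rw [zipPair, zipPair_append_right ψ (by simp)]
  rcases h with h | h <;> simp [zipPair, h]

theorem blockPair_of_length_ne {X Y : List (List L)} (h : X.length ≠ Y.length) :
    blockPair ψ X Y = 0 := by
  induction X generalizing Y with
  | nil => cases Y <;> simp_all [blockPair]
  | cons x X ih =>
    cases Y with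
    | nil => rfl
    | cons y Y => rw [blockPair, ih (by simpa using h), mul_zero]

theorem blockPair_ofFn {n : ℕ} (x y : Fin n → List L) :
    blockPair ψ (List.ofFn x) (List.ofFn y) = ∏ j, zipPair ψ (x j) (y j) := by
  induction n with
  | zero => simp [blockPair]
  | succ n ih => rw [List.ofFn_succ, List.ofFn_succ, blockPair, ih, Fin.prod_univ_succ]

/-- The pairing of a cyclically alternating product of blocks with all rotations of another
product of blocks. -/
theorem pairF_rot_flatten (hψ : ∀ a b, ψ (a * b) = ψ (b * a)) (h0 : ψ 0 = 0)
    (hS : ∀ i j, i ≠ j → ∀ a ∈ S i, ∀ b ∈ S j, a * b = 0) {i₁ i₂ : ι} {I J : List ι}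
    {X H : List (List L)}
    (hX : List.Forall₂ (fun i ξ => ξ ∈ blocks S i) (i₁ :: (I ++ [i₂])) X)
    (hH : List.Forall₂ (fun i ξ => ξ ∈ blocks S i) J H)
    (hI : (i₁ :: (I ++ [i₂])).IsChain (· ≠ ·)) (h12 : i₁ ≠ i₂)
    (hJ : ∀ J₁ j J₂, J = J₁ ++ j :: J₂ → (J₂ ++ (J₁ ++ [j])).IsChain (· ≠ ·)) :
    pairF ψ (lst X.flatten) (rotF (lst H.flatten)) =
      splitSum (fun H₁ η H₂ => blockPair ψ X
        ((H₂ ++ (H₁ ++ [η])).reverse.map List.reverse)) H := by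
  obtain ⟨e, m, e', hflat, he, he'⟩ : ∃ e m e', X.flatten = e :: (m ++ [e']) ∧ e ∈ S i₁ ∧
      e' ∈ S i₂ := by
    cases hX with
    | @cons _ x _ X hx hX =>
      obtain ⟨X₁, X₂, h1, h2, rfl⟩ := exists_forall₂_of_append_left hX
      rcases h2 with _ | ⟨hx₂, h2⟩
      cases h2
      obtain ⟨e, x, rfl⟩ := List.exists_cons_of_ne_nil hx.1
      rename_i y
      obtain ⟨y', f, rfl⟩ : ∃ y' f, y = y' ++ [f] := ⟨_, _, (List.dropLast_append_getLast hx₂.1).symm⟩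
      exact ⟨e, x ++ (X₁.flatten ++ y'), f, by simp, hx.2 e (by simp), hx₂.2 f (by simp)⟩
  rw [rotF_lst, splitSum_flatten, map_splitSum]
  refine splitSum_congr fun H₁ η H₂ hHH => ?_
  rw [hHH] at hH
  obtain ⟨J₁, J₂', h1, h2, rfl⟩ := exists_forall₂_of_append_right hH
  cases h2 with
  | @cons j _ J₂ _ hη h2 =>
  obtain ⟨η', g, rfl⟩ : ∃ η' g, η = η' ++ [g] :=
    ⟨_, _, (List.dropLast_append_getLast hη.1).symm⟩
  -- Of the rotations cutting in the block `η` only the one after its last letter `g` respects the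
  -- blocks; all others vanish.
  rw [map_splitSum, splitSum_append, splitSum_eq_zero, zero_add]
  · have h3 : List.Forall₂ (fun i ξ => ξ ∈ blocks S i) (J₂ ++ (J₁ ++ [j])).reverse
        ((H₂ ++ (H₁ ++ [η' ++ [g]])).reverse.map List.reverse) := by
      rw [List.forall₂_map_right_iff]
      have h4 : List.Forall₂ (fun i ξ => ξ ∈ blocks S i) (J₂ ++ (J₁ ++ [j]))
          (H₂ ++ (H₁ ++ [η' ++ [g]])) :=
        List.rel_append h2 (List.rel_append h1 (List.Forall₂.cons hη List.Forall₂.nil))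
      refine (List.forall₂_reverse_iff.mpr h4).imp fun i ξ h => ?_
      exact ⟨by simpa using h.1, by simpa using h.2⟩
    rw [← zipPair_flatten hψ h0 hS hX h3 hI (by
      rw [List.isChain_reverse]
      exact (hJ J₁ j J₂ rfl).imp fun a b h => h.symm)]
    rw [splitSum_cons, splitSum_nil, add_zero, pairF_lst, ← zipPair_reverse]
    simp [List.reverse_flatten]
  · intro U k V hUV
    obtain ⟨v, V', hV⟩ := List.exists_cons_of_ne_nil (l := V ++ [g]) (by simp)
    have hv : v ∈ S j := hη.2 v (by
      rw [hUV]; simp only [List.append_assoc, List.cons_append, hV]; simp)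
    have hk : k ∈ S j := hη.2 k (by rw [hUV]; simp)
    -- A cut inside `η` leaves letters of colour `j` at both ends, facing the colours `i₁` and `i₂`.
    -- These differ, so at least one end pairs to zero.
    have hz : ψ (e' * v) = 0 ∨ ψ (e * k) = 0 := by
      by_cases h : i₁ = j
      · exact Or.inl (by rw [hS i₂ j (h ▸ h12.symm) e' he' v hv, h0])
      · exact Or.inr (by rw [hS i₁ j h e he k hk, h0])
    rw [pairF_lst, hflat, hV]
    have := zipPair_ends_zero hz m.reverse (V' ++ (H₂.flatten ++ (H₁.flatten ++ U)))
    simpa using this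

end Blocks

/-! ### Tuples of blocks and their cyclic rotations -/

section Tuples

variable {L ι : Type*} [SemigroupWithZero L] {ψ : L → ℂ} {S : ι → Set L}

theorem finRotate_val {n : ℕ} (k : Fin n) : (finRotate n k : ℕ) = (k + 1) % n := by
  rcases n with _ | n
  · exact k.elim0
  · rw [finRotate_apply, Fin.val_add]
    simp

theorem isChain_rotate_ofFn {n : ℕ} {i : Fin n → ι} (hn : 2 ≤ n)
    (hi : ∀ k, i k ≠ i (finRotate n k)) (s : ℕ) : ((List.ofFn i).rotate s).IsChain (· ≠ ·) := by
  rw [List.isChain_iff_getElem]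
  intro k hk
  simp only [List.length_rotate, List.length_ofFn] at hk
  simp only [List.getElem_rotate, List.getElem_ofFn, List.length_ofFn]
  have h := hi ⟨(k + s) % n, Nat.mod_lt _ (by omega)⟩
  convert! h using 2
  refine Fin.ext ?_
  rw [finRotate_val]
  simp [add_right_comm]

theorem forall₂_ofFn {n : ℕ} {α β : Type*} {R : α → β → Prop} {a : Fin n → α} {b : Fin n → β}
    (h : ∀ k, R (a k) (b k)) : List.Forall₂ R (List.ofFn a) (List.ofFn b) := by
  induction n with
  | zero => simp
  | succ n ih =>
    rw [List.ofFn_succ, List.ofFn_succ]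
    exact .cons (h 0) (ih fun k => h k.succ)

theorem ofFn_eq_ends {n : ℕ} {α : Type*} (hn : 2 ≤ n) (i : Fin n → α) :
    ∃ I, List.ofFn i = i ⟨0, by omega⟩ :: (I ++ [i ⟨n - 1, by omega⟩]) := by
  obtain ⟨n, rfl⟩ : ∃ m, n = m + 2 := ⟨n - 2, by omega⟩
  refine ⟨List.ofFn fun k : Fin n => i k.castSucc.succ, ?_⟩
  rw [List.ofFn_succ, List.ofFn_succ', List.concat_eq_append]
  rfl

theorem rotation_ofFn {n : ℕ} {α : Type*} (η : Fin n → α) (k : Fin n) :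
    (List.ofFn η).drop (k + 1) ++ ((List.ofFn η).take k ++ [η k]) =
      (List.ofFn η).rotate (k + 1) := by
  have hk : (k : ℕ) < (List.ofFn η).length := by simp
  rw [List.rotate_eq_drop_append_take (by simp), List.take_add_one,
    List.getElem?_eq_getElem hk]
  simp

/-- The pairing of two tuples of blocks, up to rotations. -/
theorem pairF_rot_tuple (hψ : ∀ a b, ψ (a * b) = ψ (b * a)) (h0 : ψ 0 = 0)
    (hS : ∀ i j, i ≠ j → ∀ a ∈ S i, ∀ b ∈ S j, a * b = 0) {n m : ℕ} (hn : 2 ≤ n)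
    {ξ : Fin n → List L} {η : Fin m → List L} {i : Fin n → ι} {j : Fin m → ι}
    (hi : ∀ k, i k ≠ i (finRotate n k)) (hj : 2 ≤ m → ∀ k, j k ≠ j (finRotate m k))
    (hξ : ∀ k, ξ k ∈ blocks S (i k)) (hη : ∀ k, η k ∈ blocks S (j k)) :
    pairF ψ (lst (List.ofFn ξ).flatten) (rotF (lst (List.ofFn η).flatten)) =
      ∑ k : Fin m, blockPair ψ (List.ofFn ξ)
        (((List.ofFn η).rotate (k + 1)).reverse.map List.reverse) := by
  obtain ⟨I, hI⟩ := ofFn_eq_ends hn i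
  have hc := isChain_rotate_ofFn hn hi 0
  have h12 : i ⟨0, by omega⟩ ≠ i ⟨n - 1, by omega⟩ := by
    have := hi ⟨n - 1, by omega⟩
    convert! this.symm
    rw [finRotate_val]
    simp [Nat.sub_add_cancel (by omega : 1 ≤ n)]
  rw [List.rotate_zero, hI] at hc
  rw [pairF_rot_flatten (J := List.ofFn j) hψ h0 hS (hI ▸ forall₂_ofFn hξ) (forall₂_ofFn hη)
    hc h12, splitSum_ofFn]
  · simp only [rotation_ofFn]
  · intro J₁ j' J₂ hJ
    have hl : (J₁ ++ [j']).length ≤ (List.ofFn j).length := by rw [hJ]; simp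
    have : J₂ ++ (J₁ ++ [j']) = (List.ofFn j).rotate (J₁ ++ [j']).length := by
      have h : J₁ ++ j' :: J₂ = (J₁ ++ [j']) ++ J₂ := by simp
      rw [hJ, h, List.rotate_append_length_eq]
    rw [this]
    -- For `m ≤ 1` nothing is assumed about neighbours, and a list of at most one colour is
    -- trivially alternating.
    by_cases hm : 2 ≤ m
    · exact isChain_rotate_ofFn hm (hj hm) _
    · have : ((List.ofFn j).rotate (J₁ ++ [j']).length).length ≤ 1 := by
        rw [List.length_rotate, List.length_ofFn]; omega
      match (List.ofFn j).rotate (J₁ ++ [j']).length, this with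
      | [], _ => exact List.isChain_nil
      | [_], _ => exact List.isChain_singleton _

theorem pairF_rot_tuple_ne (hψ : ∀ a b, ψ (a * b) = ψ (b * a)) (h0 : ψ 0 = 0)
    (hS : ∀ i j, i ≠ j → ∀ a ∈ S i, ∀ b ∈ S j, a * b = 0) {n m : ℕ} (hn : 2 ≤ n)
    {ξ : Fin n → List L} {η : Fin m → List L} {i : Fin n → ι} {j : Fin m → ι}
    (hi : ∀ k, i k ≠ i (finRotate n k)) (hj : 2 ≤ m → ∀ k, j k ≠ j (finRotate m k))
    (hξ : ∀ k, ξ k ∈ blocks S (i k)) (hη : ∀ k, η k ∈ blocks S (j k)) (hnm : n ≠ m) :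
    pairF ψ (lst (List.ofFn ξ).flatten) (rotF (lst (List.ofFn η).flatten)) = 0 := by
  rw [pairF_rot_tuple hψ h0 hS hn hi hj hξ hη]
  exact Finset.sum_eq_zero fun k _ => blockPair_of_length_ne (by simpa using hnm)

theorem pairF_rot_tuple_eq (hψ : ∀ a b, ψ (a * b) = ψ (b * a)) (h0 : ψ 0 = 0)
    (hS : ∀ i j, i ≠ j → ∀ a ∈ S i, ∀ b ∈ S j, a * b = 0) {n : ℕ} (hn : 2 ≤ n)
    {ξ η : Fin n → List L} {i j : Fin n → ι}
    (hi : ∀ k, i k ≠ i (finRotate n k)) (hj : ∀ k, j k ≠ j (finRotate n k))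
    (hξ : ∀ k, ξ k ∈ blocks S (i k)) (hη : ∀ k, η k ∈ blocks S (j k)) :
    pairF ψ (lst (List.ofFn ξ).flatten) (rotF (lst (List.ofFn η).flatten)) =
      ∑ k : Fin n, ∏ l : Fin n, pairF ψ (lst (ξ l)) (lst (η (Fin.rev l + k))) := by
  -- Cutting after the block `k` rotates by `k + 1`, whereas the formula of freeness shifts by `k`;
  -- the sum is reindexed by `finRotate`.
  rw [pairF_rot_tuple hψ h0 hS hn hi (fun _ => hj) hξ hη,
    ← Equiv.sum_comp (finRotate n) fun k =>
      ∏ l : Fin n, pairF ψ (lst (ξ l)) (lst (η (Fin.rev l + k)))]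
  refine Finset.sum_congr rfl fun k _ => ?_
  have : ((List.ofFn η).rotate (k + 1)).reverse.map List.reverse =
      List.ofFn fun l => (η (Fin.rev l + finRotate n k)).reverse := by
    refine List.ext_getElem (by simp) fun l h1 h2 => ?_
    simp only [List.getElem_map, List.getElem_reverse, List.getElem_rotate, List.getElem_ofFn,
      List.length_rotate, List.length_ofFn]
    refine congrArg (fun x => (η x).reverse) (Fin.ext ?_)
    rw [Fin.val_add, finRotate_val, Fin.val_rev]
    simp only [Nat.add_mod_mod]
    congr 1
    omega
  rw [this, blockPair_ofFn]
  refine Finset.prod_congr rfl fun l _ => ?_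
  rw [pairF_lst, ← zipPair_reverse, List.reverse_reverse]

omit [SemigroupWithZero L] in
theorem prod_lst {n : ℕ} (ξ : Fin n → List L) :
    (List.ofFn fun k => lst (ξ k)).prod = lst (List.ofFn ξ).flatten := by
  induction n with
  | zero => simp [lst_nil]
  | succ n ih => rw [List.ofFn_succ, List.ofFn_succ, List.prod_cons, ih, List.flatten_cons, lst_mul]

/-- Linear combinations of nonempty lists of letters of the colour `i`. -/
def blockSpan (S : ι → Set L) (i : ι) : Submodule ℂ (FormalFock L) :=
  Submodule.span ℂ (lst '' blocks S i)

theorem pairF_tuple_ne (hψ : ∀ a b, ψ (a * b) = ψ (b * a)) (h0 : ψ 0 = 0)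
    (hS : ∀ i j, i ≠ j → ∀ a ∈ S i, ∀ b ∈ S j, a * b = 0) {n m : ℕ} (hn : 2 ≤ n)
    {x : Fin n → FormalFock L} {y : Fin m → FormalFock L} {i : Fin n → ι} {j : Fin m → ι}
    (hi : ∀ k, i k ≠ i (finRotate n k)) (hj : 2 ≤ m → ∀ k, j k ≠ j (finRotate m k))
    (hx : ∀ k, x k ∈ blockSpan S (i k)) (hy : ∀ k, y k ∈ blockSpan S (j k)) (hnm : n ≠ m) :
    pairF ψ (tupleProd x) (rotF (tupleProd y)) = 0 := by
  let F (y : Fin m → FormalFock L) : MultilinearMap ℂ (fun _ : Fin n => FormalFock L) ℂ :=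
    ((pairF ψ).flip (rotF (tupleProd y))).compMultilinearMap
      (MultilinearMap.mkPiAlgebraFin ℂ n (FormalFock L))
  let G (x : Fin n → FormalFock L) : MultilinearMap ℂ (fun _ : Fin m => FormalFock L) ℂ :=
    (pairF ψ (tupleProd x) ∘ₗ rotF).compMultilinearMap
      (MultilinearMap.mkPiAlgebraFin ℂ m (FormalFock L))
  refine multilinear_ext_span (f := F y) (g := 0) (fun k => lst '' blocks S (i k))
    (fun x hx => ?_) x hx
  refine multilinear_ext_span (f := G x) (g := 0) (fun k => lst '' blocks S (j k))
    (fun y hy => ?_) y hy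
  choose ξ hξ hξx using hx
  choose η hη hηy using hy
  obtain rfl : (fun k => lst (ξ k)) = x := funext hξx
  obtain rfl : (fun k => lst (η k)) = y := funext hηy
  change pairF ψ (List.ofFn fun k => lst (ξ k)).prod (rotF (List.ofFn fun k => lst (η k)).prod) = 0
  rw [prod_lst, prod_lst]
  exact pairF_rot_tuple_ne hψ h0 hS hn hi hj hξ hη hnm

theorem pairF_tuple_eq (hψ : ∀ a b, ψ (a * b) = ψ (b * a)) (h0 : ψ 0 = 0)
    (hS : ∀ i j, i ≠ j → ∀ a ∈ S i, ∀ b ∈ S j, a * b = 0) {n : ℕ} (hn : 2 ≤ n)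
    {x y : Fin n → FormalFock L} {i j : Fin n → ι}
    (hi : ∀ k, i k ≠ i (finRotate n k)) (hj : ∀ k, j k ≠ j (finRotate n k))
    (hx : ∀ k, x k ∈ blockSpan S (i k)) (hy : ∀ k, y k ∈ blockSpan S (j k)) :
    pairF ψ (tupleProd x) (rotF (tupleProd y)) =
      ∑ k : Fin n, ∏ l : Fin n, pairF ψ (x l) (y (Fin.rev l + k)) := by
  have : NeZero n := ⟨by omega⟩
  let F (y : Fin n → FormalFock L) : MultilinearMap ℂ (fun _ : Fin n => FormalFock L) ℂ :=
    ((pairF ψ).flip (rotF (tupleProd y))).compMultilinearMap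
      (MultilinearMap.mkPiAlgebraFin ℂ n (FormalFock L))
  let F' (y : Fin n → FormalFock L) : MultilinearMap ℂ (fun _ : Fin n => FormalFock L) ℂ :=
    ∑ k : Fin n, (MultilinearMap.mkPiAlgebra ℂ (Fin n) ℂ).compLinearMap
      fun l => (pairF ψ).flip (y (Fin.rev l + k))
  let G (x : Fin n → FormalFock L) : MultilinearMap ℂ (fun _ : Fin n => FormalFock L) ℂ :=
    (pairF ψ (tupleProd x) ∘ₗ rotF).compMultilinearMap
      (MultilinearMap.mkPiAlgebraFin ℂ n (FormalFock L))
  -- Multilinearity in `y` requires a product indexed by the positions of `y`, so the pairing is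
  -- reindexed by `l ↦ Fin.rev l + k`.
  let σ (k : Fin n) : Equiv.Perm (Fin n) := Fin.revPerm.trans (Equiv.addRight k)
  let G' (x : Fin n → FormalFock L) : MultilinearMap ℂ (fun _ : Fin n => FormalFock L) ℂ :=
    ∑ k : Fin n, ((MultilinearMap.mkPiAlgebra ℂ (Fin n) ℂ).compLinearMap
      fun l => pairF ψ (x l)).domDomCongr (σ k)
  have hF' (x y : Fin n → FormalFock L) :
      F' y x = ∑ k : Fin n, ∏ l : Fin n, pairF ψ (x l) (y (Fin.rev l + k)) := by
    simp [F']
  have hG' (x y : Fin n → FormalFock L) :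
      G' x y = ∑ k : Fin n, ∏ l : Fin n, pairF ψ (x l) (y (Fin.rev l + k)) := by
    simp [G', σ]
  rw [← hF']
  refine multilinear_ext_span (f := F y) (g := F' y) (fun k => lst '' blocks S (i k))
    (fun x hx => ?_) x hx
  rw [hF', ← hG']
  refine multilinear_ext_span (f := G x) (g := G' x) (fun k => lst '' blocks S (j k))
    (fun y hy => ?_) y hy
  rw [hG']
  choose ξ hξ hξx using hx
  choose η hη hηy using hy
  obtain rfl : (fun k => lst (ξ k)) = x := funext hξx
  obtain rfl : (fun k => lst (η k)) = y := funext hηy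
  change pairF ψ (List.ofFn fun k => lst (ξ k)).prod (rotF (List.ofFn fun k => lst (η k)).prod) = _
  rw [prod_lst, prod_lst]
  exact pairF_rot_tuple_eq hψ h0 hS hn hi hj hξ hη

end Tuples

section FormalFreeness

variable {L ι : Type*} [SemigroupWithZero L] {ψ : L → ℂ} {S : ι → Set L}

/-! ### Lists with a vanishing letter -/

variable (L) in
/-- Linear combinations of lists containing the letter `0`. -/
def nullF : Submodule ℂ (FormalFock L) := Submodule.span ℂ (lst '' {ξ : List L | 0 ∈ ξ})

theorem lst_mem_nullF {ξ : List L} (h : 0 ∈ ξ) : lst ξ ∈ nullF L :=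
  Submodule.subset_span ⟨ξ, h, rfl⟩

theorem nullF_induction {p : FormalFock L → Prop} {x : FormalFock L} (hx : x ∈ nullF L)
    (hl : ∀ ξ : List L, 0 ∈ ξ → p (lst ξ)) (ha : ∀ x y, p x → p y → p (x + y))
    (hs : ∀ (c : ℂ) x, p x → p (c • x)) : p x := by
  induction hx using Submodule.span_induction with
  | mem x hx => obtain ⟨ξ, h, rfl⟩ := hx; exact hl ξ h
  | zero => simpa using hs 0 _ (hl [0] (by simp))
  | add x y _ _ hx hy => exact ha x y hx hy
  | smul c x _ hx => exact hs c x hx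

/-- The formal letter `0` is not the vector zero, so lists containing it have to be shown
negligible: they are stable under the operators and under `c`, and vanish under the functionals. -/
theorem opF_mem_nullF (h0 : ψ 0 = 0) (d : L) {x : FormalFock L} (hx : x ∈ nullF L) :
    opF ψ d x ∈ nullF L := by
  refine nullF_induction (p := fun x => opF ψ d x ∈ nullF L) hx
    (fun ξ h => ?_) (fun x x' hx hx' => ?_) (fun c x hx => ?_)
  · rcases ξ with _ | ⟨e, ξ⟩
    · simp at h
    · rw [opF_cons]
      refine add_mem (add_mem (add_mem (lst_mem_nullF (by simp_all)) ?_) ?_)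
        (Submodule.smul_mem _ _ (lst_mem_nullF h))
      · rcases List.mem_cons.mp h with h | h
        · exact lst_mem_nullF (by simp [← h])
        · exact lst_mem_nullF (by simp [h])
      · rcases List.mem_cons.mp h with h | h
        · simp [← h, h0]
        · exact Submodule.smul_mem _ _ (lst_mem_nullF h)
  · rw [map_add]; exact add_mem hx hx'
  · rw [map_smul]; exact Submodule.smul_mem _ c hx

theorem freeOp_mem_nullF (h0 : ψ 0 = 0) (t : FreeAlgebra ℂ L) {x : FormalFock L}
    (hx : x ∈ nullF L) : freeOp ψ t x ∈ nullF L := by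
  induction t using FreeAlgebra.induction generalizing x with
  | grade0 c => simpa using Submodule.smul_mem _ c hx
  | grade1 d => simpa [freeOp] using opF_mem_nullF h0 d hx
  | add s t hs ht => rw [map_add]; exact add_mem (hs hx) (ht hx)
  | mul s t hs ht => rw [map_mul]; exact hs (ht hx)

theorem vacF_nullF {x : FormalFock L} (hx : x ∈ nullF L) : vacF x = 0 := by
  refine nullF_induction (p := fun x => vacF x = 0) hx
    (fun ξ h => ?_) (fun x x' hx hx' => ?_) (fun c x hx => ?_)
  · rcases ξ with _ | ⟨e, ξ⟩
    · simp at h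
    · simp
  · rw [map_add, hx, hx', add_zero]
  · rw [map_smul, hx, smul_zero]

theorem zipPair_null (h0 : ψ 0 = 0) {ξ : List L} (h : 0 ∈ ξ) (η : List L) :
    zipPair ψ ξ η = 0 := by
  induction ξ generalizing η with
  | nil => simp at h
  | cons x ξ ih =>
    cases η with
    | nil => rfl
    | cons y η =>
      rw [zipPair]
      rcases List.mem_cons.mp h with h | h
      · simp [← h, h0]
      · simp [ih h]

theorem pairF_nullF (h0 : ψ 0 = 0) {x : FormalFock L} (hx : x ∈ nullF L) (y : FormalFock L) :
    pairF ψ x y = 0 := by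
  refine nullF_induction (p := fun x => pairF ψ x y = 0) hx
    (fun ξ h => ?_) (fun x x' hx hx' => ?_) (fun c x hx => ?_)
  · induction y using formal_induction with
    | hl η => rw [pairF_lst]; exact zipPair_null h0 (by simpa using h) η
    | ha y y' hy hy' => rw [map_add, hy, hy', add_zero]
    | hs c y hy => rw [map_smul, hy, smul_zero]
  · rw [map_add, LinearMap.add_apply, hx, hx', add_zero]
  · rw [map_smul, LinearMap.smul_apply, hx, smul_zero]

theorem cycF_mem_nullF (h0 : ψ 0 = 0) {x : FormalFock L} (hx : x ∈ nullF L) :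
    cycF ψ x ∈ nullF L := by
  refine nullF_induction (p := fun x => cycF ψ x ∈ nullF L) hx
    (fun ξ h => ?_) (fun x x' hx hx' => ?_) (fun c x hx => ?_)
  · rw [cycF_lst]
    induction ξ using List.bidirectionalRec with
    | nil => simp at h
    | singleton e => rw [cycList]; exact lst_mem_nullF h
    | cons_append e m f ih =>
      rw [cycList_ends]
      refine add_mem (add_mem (lst_mem_nullF h) ?_) ?_
      · refine lst_mem_nullF ?_
        simp only [List.mem_cons, List.mem_append, List.not_mem_nil, or_false] at h ⊢
        rcases h with h | h | h
        · simp [← h]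
        · simp [h]
        · simp [← h]
      · simp only [List.mem_cons, List.mem_append, List.not_mem_nil, or_false] at h
        rcases h with h | h | h
        · simp [← h, h0]
        · exact Submodule.smul_mem _ _ (ih h)
        · simp [← h, h0]
  · rw [map_add]; exact add_mem hx hx'
  · rw [map_smul]; exact Submodule.smul_mem _ c hx

theorem pairF_rot_congr (hψ : ∀ a b, ψ (a * b) = ψ (b * a)) (h0 : ψ 0 = 0)
    {x x' y y' : FormalFock L} (hx : x - x' ∈ nullF L) (hy : y - y' ∈ nullF L) :
    pairF ψ x (rotF y) = pairF ψ x' (rotF y') := by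
  have h1 := pairF_nullF h0 hx (rotF y)
  have h2 := pairF_nullF h0 hy (rotF x')
  rw [map_sub, LinearMap.sub_apply, sub_eq_zero] at h1
  rw [map_sub, LinearMap.sub_apply, sub_eq_zero] at h2
  rw [h1, pairF_rot_comm ψ hψ, h2, pairF_rot_comm ψ hψ]

/-! ### The algebra generated by one colour -/

/-- Linear combinations of lists of letters of the colour `i`. -/
def colorSpan (S : ι → Set L) (i : ι) : Submodule ℂ (FormalFock L) :=
  Submodule.span ℂ (lst '' {ξ : List L | ∀ x ∈ ξ, x ∈ S i})

/-- Linear combinations of lists which do not start with the colour `i`. -/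
def headSpan (S : ι → Set L) (i : ι) : Submodule ℂ (FormalFock L) :=
  Submodule.span ℂ (lst '' {η : List L | ∀ e ∈ η.head?, ∃ j, j ≠ i ∧ e ∈ S j})

/-- The subalgebra of the free algebra generated by the letters of colour `i`. -/
def colorAlg (S : ι → Set L) (i : ι) : Subalgebra ℂ (FreeAlgebra ℂ L) :=
  Algebra.adjoin ℂ (FreeAlgebra.ι ℂ '' S i)

theorem opF_mem_colorSpan (hcl : ∀ i, ∀ a ∈ S i, ∀ b ∈ S i, a * b ∈ S i) {i : ι} {d : L}
    (hd : d ∈ S i) {x : FormalFock L} (hx : x ∈ colorSpan S i) : opF ψ d x ∈ colorSpan S i := by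
  have mem {ξ : List L} (h : ∀ x ∈ ξ, x ∈ S i) : lst ξ ∈ colorSpan S i :=
    Submodule.subset_span ⟨ξ, h, rfl⟩
  induction hx using Submodule.span_induction with
  | mem x hx =>
    obtain ⟨ξ, h, rfl⟩ := hx
    rcases ξ with _ | ⟨e, ξ⟩
    · rw [lst_nil, opF_one, ← lst_nil]
      exact add_mem (mem (by simpa)) (Submodule.smul_mem _ _ (mem (by simp)))
    · rw [opF_cons]
      have he := h e (by simp)
      have hξ : ∀ x ∈ ξ, x ∈ S i := fun x hx => h x (by simp [hx])
      refine add_mem (add_mem (add_mem (mem ?_) (mem ?_)) (Submodule.smul_mem _ _ (mem hξ)))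
        (Submodule.smul_mem _ _ (mem h))
      · exact List.forall_mem_cons.mpr ⟨hd, h⟩
      · exact List.forall_mem_cons.mpr ⟨hcl i d hd e he, hξ⟩
  | zero => simp
  | add x y _ _ hx hy => rw [map_add]; exact add_mem hx hy
  | smul c x _ hx => rw [map_smul]; exact Submodule.smul_mem _ c hx

theorem freeOp_mem_colorSpan (hcl : ∀ i, ∀ a ∈ S i, ∀ b ∈ S i, a * b ∈ S i) {i : ι}
    {t : FreeAlgebra ℂ L} (ht : t ∈ colorAlg S i) {x : FormalFock L} (hx : x ∈ colorSpan S i) :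
    freeOp ψ t x ∈ colorSpan S i := by
  induction ht using Algebra.adjoin_induction generalizing x with
  | mem t ht =>
    obtain ⟨d, hd, rfl⟩ := ht
    simpa [freeOp] using opF_mem_colorSpan hcl hd hx
  | algebraMap c => simpa using Submodule.smul_mem _ c hx
  | add s t _ _ hs ht => rw [map_add]; exact add_mem (hs hx) (ht hx)
  | mul s t _ _ hs ht => rw [map_mul]; exact hs (ht hx)

/-- An operator of colour `i` acts on a concatenation through its first factor only. The exceptional
case is an empty first factor: multiplying the head of the second gives the letter `0`, and
contracting with it gives `ψ 0 = 0`. -/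
theorem opF_mul_sub_mem (h0 : ψ 0 = 0) (hS : ∀ i j, i ≠ j → ∀ a ∈ S i, ∀ b ∈ S j, a * b = 0)
    {i : ι} {d : L} (hd : d ∈ S i) (x : FormalFock L)
    {y : FormalFock L} (hy : y ∈ headSpan S i) : opF ψ d (x * y) - opF ψ d x * y ∈ nullF L := by
  induction hy using Submodule.span_induction with
  | mem y hy =>
    obtain ⟨η, h, rfl⟩ := hy
    induction x using formal_induction with
    | hl ξ =>
      rcases ξ with _ | ⟨e, ξ⟩
      · rcases η with _ | ⟨e, η⟩
        · simp [lst_nil]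
        · obtain ⟨j, hj, he⟩ := h e rfl
          rw [lst_nil, one_mul, opF_cons, hS i j hj.symm d hd e he, h0, opF_one, add_mul, lst_mul,
            smul_mul_assoc, one_mul]
          simpa using lst_mem_nullF (by simp : (0 : L) ∈ 0 :: η)
      · simp [lst_mul, add_mul]
    | ha x x' hx hx' =>
      convert! add_mem hx hx' using 1
      simp only [add_mul, map_add]
      abel
    | hs c x hx =>
      convert! Submodule.smul_mem _ c hx using 1
      simp only [smul_mul_assoc, map_smul, smul_sub]
  | zero => simp
  | add y y' _ _ hy hy' =>
    convert! add_mem hy hy' using 1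
    simp only [mul_add, map_add]
    abel
  | smul c y _ hy =>
    convert! Submodule.smul_mem _ c hy using 1
    simp only [mul_smul_comm, map_smul, smul_sub]

theorem freeOp_mul_sub_mem (h0 : ψ 0 = 0) (hS : ∀ i j, i ≠ j → ∀ a ∈ S i, ∀ b ∈ S j, a * b = 0)
    {i : ι} {t : FreeAlgebra ℂ L} (ht : t ∈ colorAlg S i) (x : FormalFock L)
    {y : FormalFock L} (hy : y ∈ headSpan S i) :
    freeOp ψ t (x * y) - freeOp ψ t x * y ∈ nullF L := by
  induction ht using Algebra.adjoin_induction generalizing x with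
  | mem t ht =>
    obtain ⟨d, hd, rfl⟩ := ht
    simpa [freeOp] using opF_mul_sub_mem h0 hS hd x hy
  | algebraMap c => simp
  | add s t _ _ hs ht =>
    convert! add_mem (hs x) (ht x) using 1
    simp only [map_add, LinearMap.add_apply, add_mul]
    abel
  | mul s t _ _ hs ht =>
    convert! add_mem (freeOp_mem_nullF h0 s (ht x)) (hs (freeOp ψ t x)) using 1
    simp only [map_mul, Module.End.mul_apply, map_sub]
    abel

theorem freeVec_mem_colorSpan (hcl : ∀ i, ∀ a ∈ S i, ∀ b ∈ S i, a * b ∈ S i) {i : ι}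
    {t : FreeAlgebra ℂ L} (ht : t ∈ colorAlg S i) : freeVec ψ t ∈ colorSpan S i :=
  freeOp_mem_colorSpan hcl ht (Submodule.subset_span ⟨[], by simp, lst_nil⟩)

omit [SemigroupWithZero L] in
theorem sub_vacF_mem_blockSpan {i : ι} {x : FormalFock L} (hx : x ∈ colorSpan S i) :
    x - vacF x • 1 ∈ blockSpan S i := by
  induction hx using Submodule.span_induction with
  | mem x hx =>
    obtain ⟨ξ, h, rfl⟩ := hx
    rcases ξ with _ | ⟨e, ξ⟩
    · simp [lst_nil]
    · have : lst (e :: ξ) ∈ blockSpan S i := Submodule.subset_span ⟨_, ⟨by simp, h⟩, rfl⟩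
      simpa using this
  | zero => simp
  | add x y _ _ hx hy =>
    convert! add_mem hx hy using 1
    simp only [map_add, add_smul]
    abel
  | smul c x _ hx =>
    convert! Submodule.smul_mem _ c hx using 1
    simp only [map_smul, smul_eq_mul, mul_smul, smul_sub]

/-- Centredness is the absence of the empty list in the vacuum vector. -/
theorem freeVec_mem_blockSpan (hcl : ∀ i, ∀ a ∈ S i, ∀ b ∈ S i, a * b ∈ S i) {i : ι}
    {t : FreeAlgebra ℂ L} (ht : t ∈ colorAlg S i) (h : phiFree ψ t = 0) :
    freeVec ψ t ∈ blockSpan S i := by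
  have := sub_vacF_mem_blockSpan (freeVec_mem_colorSpan (ψ := ψ) hcl ht)
  rwa [← phiFree_apply, h, zero_smul, sub_zero] at this

theorem cycF_mem_blockSpan (hcl : ∀ i, ∀ a ∈ S i, ∀ b ∈ S i, a * b ∈ S i) {i : ι}
    {x : FormalFock L} (hx : x ∈ colorSpan S i) : cycF ψ x ∈ blockSpan S i := by
  induction hx using Submodule.span_induction with
  | mem x hx =>
    obtain ⟨ξ, h, rfl⟩ := hx
    rw [cycF_lst]
    have mem {ξ : List L} (h1 : ξ ≠ []) (h : ∀ x ∈ ξ, x ∈ S i) : lst ξ ∈ blockSpan S i :=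
      Submodule.subset_span ⟨ξ, ⟨h1, h⟩, rfl⟩
    induction ξ using List.bidirectionalRec with
    | nil => rw [cycList]; exact zero_mem _
    | singleton e => rw [cycList]; exact mem (by simp) h
    | cons_append e m f ih =>
      have he : e ∈ S i := h e (by simp)
      have hf : f ∈ S i := h f (by simp)
      have hm : ∀ x ∈ m, x ∈ S i := fun x hx => h x (by simp [hx])
      rw [cycList_ends]
      exact add_mem (add_mem (mem (by simp) h)
        (mem (by simp) (List.forall_mem_cons.mpr ⟨hcl i f hf e he, hm⟩)))
        (Submodule.smul_mem _ _ (ih hm))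
  | zero => simp
  | add x y _ _ hx hy => rw [map_add]; exact add_mem hx hy
  | smul c x _ hx => rw [map_smul]; exact Submodule.smul_mem _ c hx

/-! ### Products of centred elements -/

omit [SemigroupWithZero L] in
theorem blockSpan_mul_mem_headSpan {i j : ι} (hij : j ≠ i) {x : FormalFock L}
    (hx : x ∈ blockSpan S j) (y : FormalFock L) : x * y ∈ headSpan S i := by
  induction hx using Submodule.span_induction with
  | mem x hx =>
    obtain ⟨ξ, ⟨h1, h2⟩, rfl⟩ := hx
    induction y using formal_induction with
    | hl η =>
      rw [lst_mul]
      refine Submodule.subset_span ⟨_, fun e he => ⟨j, hij, ?_⟩, rfl⟩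
      rcases ξ with _ | ⟨a, ξ⟩
      · exact absurd rfl h1
      · obtain rfl : a = e := by simpa using he
        exact h2 a (by simp)
    | ha y y' hy hy' => rw [mul_add]; exact add_mem hy hy'
    | hs c y hy => rw [mul_smul_comm]; exact Submodule.smul_mem _ c hy
  | zero => simp
  | add x x' _ _ hx hx' => rw [add_mul]; exact add_mem hx hx'
  | smul c x _ hx => rw [smul_mul_assoc]; exact Submodule.smul_mem _ c hx

omit [SemigroupWithZero L] in
theorem vacF_blockSpan_mul {j : ι} {x : FormalFock L}
    (hx : x ∈ blockSpan S j) (y : FormalFock L) : vacF (x * y) = 0 := by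
  induction hx using Submodule.span_induction with
  | mem x hx =>
    obtain ⟨ξ, ⟨h1, h2⟩, rfl⟩ := hx
    induction y using formal_induction with
    | hl η =>
      rcases ξ with _ | ⟨a, ξ⟩
      · exact absurd rfl h1
      · simp [lst_mul]
    | ha y y' hy hy' => rw [mul_add, map_add, hy, hy', add_zero]
    | hs c y hy => rw [mul_smul_comm, map_smul, hy, smul_zero]
  | zero => simp
  | add x x' _ _ hx hx' => rw [add_mul, map_add, hx, hx', add_zero]
  | smul c x _ hx => rw [smul_mul_assoc, map_smul, hx, smul_zero]

theorem tupleProd_succ {A : Type*} [Ring A] {n : ℕ} (a : Fin (n + 1) → A) :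
    tupleProd a = a 0 * tupleProd fun k => a k.succ := by
  simp [tupleProd, List.ofFn_succ]

/-- Each factor leaves the vectors of the later ones untouched, since the next block starts with
another colour and, by centredness, is not empty. -/
theorem freeVec_tupleProd (hcl : ∀ i, ∀ a ∈ S i, ∀ b ∈ S i, a * b ∈ S i) (h0 : ψ 0 = 0)
    (hS : ∀ i j, i ≠ j → ∀ a ∈ S i, ∀ b ∈ S j, a * b = 0) {n : ℕ} {a : Fin n → FreeAlgebra ℂ L}
    {i : Fin n → ι} (ha : ∀ k, a k ∈ colorAlg S (i k))
    (hi : ∀ k l : Fin n, (k : ℕ) + 1 = l → i k ≠ i l) (hc : IsCentered (phiFree ψ) a) :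
    freeVec ψ (tupleProd a) - tupleProd (fun k => freeVec ψ (a k)) ∈ nullF L := by
  induction n with
  | zero => simp [tupleProd, freeVec_apply]
  | succ n ih =>
    have h1 := ih (fun k => ha k.succ) (fun k l hkl => hi k.succ l.succ (by simpa using hkl))
      (fun k => hc k.succ)
    have h2 : (tupleProd fun k : Fin n => freeVec ψ (a k.succ)) ∈ headSpan S (i 0) := by
      rcases n with _ | n
      · exact Submodule.subset_span ⟨[], by simp, by simp [tupleProd, lst_nil]⟩
      · rw [tupleProd_succ]
        exact blockSpan_mul_mem_headSpan (hi 0 1 (by simp)).symm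
          (freeVec_mem_blockSpan hcl (ha (Fin.succ 0)) (hc _)) _
    have h3 := freeOp_mul_sub_mem h0 hS (ha 0) 1 h2
    convert! add_mem (freeOp_mem_nullF h0 (a 0) h1) h3 using 1
    rw [tupleProd_succ, tupleProd_succ, freeVec_mul, map_sub, one_mul, freeVec_apply ψ (a 0)]
    abel

/-- The first and last letters have different colours, so the term of `c` merging them contains the
letter `0` and the term contracting them has coefficient `ψ 0 = 0`. -/
theorem cycF_tupleProd (h0 : ψ 0 = 0)
    (hS : ∀ i j, i ≠ j → ∀ a ∈ S i, ∀ b ∈ S j, a * b = 0) {n : ℕ} (hn : 2 ≤ n)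
    {x : Fin n → FormalFock L} {i : Fin n → ι} (hi : ∀ k, i k ≠ i (finRotate n k))
    (hx : ∀ k, x k ∈ blockSpan S (i k)) :
    cycF ψ (tupleProd x) - tupleProd x ∈ nullF L := by
  -- In the quotient by `nullF L` the claim is an equality of multilinear maps, which need only be
  -- checked on single blocks.
  rw [← Submodule.Quotient.mk_eq_zero, Submodule.Quotient.mk_sub, sub_eq_zero]
  refine multilinear_ext_span
    (f := ((nullF L).mkQ ∘ₗ cycF ψ).compMultilinearMap
      (MultilinearMap.mkPiAlgebraFin ℂ n (FormalFock L)))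
    (g := (nullF L).mkQ.compMultilinearMap
      (MultilinearMap.mkPiAlgebraFin ℂ n (FormalFock L))) (fun k => lst '' blocks S (i k))
    (fun x hx => ?_) x hx
  choose ξ hξ hξx using hx
  obtain rfl : (fun k => lst (ξ k)) = x := funext hξx
  simp only [LinearMap.compMultilinearMap_apply, MultilinearMap.mkPiAlgebraFin_apply,
    LinearMap.comp_apply, Submodule.mkQ_apply, prod_lst]
  rw [← sub_eq_zero, ← Submodule.Quotient.mk_sub, Submodule.Quotient.mk_eq_zero, cycF_lst]
  obtain ⟨I, hI⟩ := ofFn_eq_ends hn ξ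
  set k₀ : Fin n := ⟨0, by omega⟩
  set k₁ : Fin n := ⟨n - 1, by omega⟩
  have h12 : i k₁ ≠ i k₀ := by
    convert! hi k₁
    refine Fin.ext ?_
    rw [finRotate_val]
    simp [k₁, k₀, Nat.sub_add_cancel (by omega : 1 ≤ n)]
  obtain ⟨e, m₀, he⟩ := List.exists_cons_of_ne_nil (hξ k₀).1
  obtain ⟨m₁, f, hf⟩ := List.eq_nil_or_concat' (ξ k₁) |>.resolve_left (hξ k₁).1
  have hee : e ∈ S (i k₀) := (hξ k₀).2 e (by simp [he])
  have hff : f ∈ S (i k₁) := (hξ k₁).2 f (by simp [hf])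
  have hfl : (List.ofFn ξ).flatten = e :: ((m₀ ++ (I.flatten ++ m₁)) ++ [f]) := by
    rw [hI, he, hf]; simp
  rw [hfl, cycList_ends, hS _ _ h12 f hff e hee, hS _ _ h12.symm e hee f hff, h0]
  simpa using lst_mem_nullF (by simp)

/-- After any rotation the pairing contains a factor `ψ` of a product of two letters of different
colours, and there is at least one such factor. -/
theorem pairF_rot_single (h0 : ψ 0 = 0) (hS : ∀ i j, i ≠ j → ∀ a ∈ S i, ∀ b ∈ S j, a * b = 0)
    {i j : ι} (hij : i ≠ j) {x y : FormalFock L} (hx : x ∈ blockSpan S i)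
    (hy : y ∈ blockSpan S j) : pairF ψ x (rotF y) = 0 := by
  induction hx using Submodule.span_induction with
  | mem x hx =>
    obtain ⟨ξ, ⟨h1, h2⟩, rfl⟩ := hx
    induction hy using Submodule.span_induction with
    | mem y hy =>
      obtain ⟨η, ⟨_, h3⟩, rfl⟩ := hy
      rw [rotF_lst', map_splitSum]
      refine splitSum_eq_zero fun U g V h => ?_
      rw [pairF_lst]
      obtain ⟨a, l, hl⟩ := List.exists_cons_of_ne_nil (l := ξ.reverse) (by simpa using h1)
      have ha : a ∈ S i := h2 a (List.mem_reverse.mp (by simp [hl]))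
      rw [hl, zipPair, hS i j hij a ha g (h3 g (by simp [h])), h0, zero_mul]
    | zero => simp
    | add y y' _ _ hy hy' => rw [map_add, map_add, hy, hy', add_zero]
    | smul c y _ hy => rw [map_smul, map_smul, hy, smul_zero]
  | zero => simp
  | add x x' _ _ hx hx' => rw [map_add, LinearMap.add_apply, hx, hx', add_zero]
  | smul c x _ hx => rw [map_smul, LinearMap.smul_apply, hx, smul_zero]

theorem exists_centered_tuple (hcl : ∀ i, ∀ a ∈ S i, ∀ b ∈ S i, a * b ∈ S i) (h0 : ψ 0 = 0)
    (hS : ∀ i j, i ≠ j → ∀ a ∈ S i, ∀ b ∈ S j, a * b = 0) {n : ℕ} (hn : 2 ≤ n)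
    {a : Fin n → FreeAlgebra ℂ L} (ha : IsCyclicallyAlternating (colorAlg S) a)
    (hc : IsCentered (phiFree ψ) a) :
    ∃ i : Fin n → ι, (∀ k, i k ≠ i (finRotate n k)) ∧
      (∀ k, freeVec ψ (a k) ∈ blockSpan S (i k)) ∧
      cycF ψ (freeVec ψ (tupleProd a)) - tupleProd (fun k => freeVec ψ (a k)) ∈ nullF L := by
  obtain ⟨i, hai, hi⟩ := ha
  have hb : ∀ k, freeVec ψ (a k) ∈ blockSpan S (i k) := fun k =>
    freeVec_mem_blockSpan hcl (hai k) (hc k)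
  refine ⟨i, hi hn, hb, ?_⟩
  have h1 := freeVec_tupleProd hcl h0 hS hai (fun k l hkl => ?_) hc
  · have h2 := cycF_tupleProd h0 hS hn (hi hn) hb
    convert! add_mem (cycF_mem_nullF h0 h1) h2 using 1
    rw [map_sub]
    abel
  · convert! hi hn k
    refine Fin.ext ?_
    rw [finRotate_val, Nat.mod_eq_of_lt (by omega), hkl]

/-- Letters of different colours, the products of which vanish, are free of second order. -/
theorem isSecondOrderFree_free (hψ : ∀ a b, ψ (a * b) = ψ (b * a)) (h0 : ψ 0 = 0)
    (hcl : ∀ i, ∀ a ∈ S i, ∀ b ∈ S i, a * b ∈ S i)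
    (hS : ∀ i j, i ≠ j → ∀ a ∈ S i, ∀ b ∈ S j, a * b = 0) :
    IsSecondOrderFree (phiFree ψ) (rhoFree ψ) (colorAlg S) := by
  have ne (n m : ℕ) (a : Fin n → FreeAlgebra ℂ L) (b : Fin m → FreeAlgebra ℂ L) (hn : 2 ≤ n)
      (hm : 1 ≤ m) (ha : IsCyclicallyAlternating (colorAlg S) a)
      (hb : IsCyclicallyAlternating (colorAlg S) b) (hca : IsCentered (phiFree ψ) a)
      (hcb : IsCentered (phiFree ψ) b) (hnm : n ≠ m) :
      rhoFree ψ (tupleProd a) (tupleProd b) = 0 := by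
    obtain ⟨i, hi, hai, hna⟩ := exists_centered_tuple hcl h0 hS hn ha hca
    rw [rhoFree_apply, rhoF_apply]
    by_cases h2 : 2 ≤ m
    · obtain ⟨j, hj, hbj, hnb⟩ := exists_centered_tuple hcl h0 hS h2 hb hcb
      rw [pairF_rot_congr hψ h0 hna hnb]
      exact pairF_tuple_ne hψ h0 hS hn hi (fun _ => hj) hai hbj hnm
    -- A single element carries no cyclic alternation, so `c` may change it, but the result still
    -- lies in the span of blocks of its colour and can be treated as a tuple of length one.
    · obtain rfl : m = 1 := by omega
      obtain ⟨j, hbj, -⟩ := hb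
      have hy := cycF_mem_blockSpan (ψ := ψ) hcl (freeVec_mem_colorSpan (ψ := ψ) hcl (hbj 0))
      have hb1 : tupleProd b = b 0 := by simp [tupleProd]
      have hy1 (y : FormalFock L) : y = tupleProd fun _ : Fin 1 => y := by simp [tupleProd]
      rw [hb1, pairF_rot_congr hψ h0 hna (y' := cycF ψ (freeVec ψ (b 0))) (by simp), hy1 (cycF _ _)]
      exact pairF_tuple_ne (j := fun _ => j 0) hψ h0 hS hn hi (fun h => absurd h (by omega)) hai
        (fun _ => hy) hnm
  constructor
  · intro n a i hn ha hi hc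
    have h1 := vacF_nullF (freeVec_tupleProd hcl h0 hS ha hi hc)
    rw [map_sub, sub_eq_zero] at h1
    rw [phiFree_apply, h1]
    obtain ⟨n, rfl⟩ : ∃ m, n = m + 1 := ⟨n - 1, by omega⟩
    rw [tupleProd_succ]
    exact vacF_blockSpan_mul (freeVec_mem_blockSpan hcl (ha 0) (hc 0)) _
  · intro n m a b hn hm ha hb hca hcb hnm
    by_cases h2 : 2 ≤ n
    · exact ne n m a b h2 hm ha hb hca hcb hnm
    -- Here `n = 1`, hence `m ≥ 2`, and symmetry of ρ exchanges the two tuples.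
    · rw [rhoFree_comm ψ hψ]
      exact ne m n b a (by omega) hn hb ha hcb hca hnm.symm
  · intro i j hij a ha b hb
    rw [rhoFree_apply, rhoF_apply]
    exact pairF_rot_single h0 hS hij (cycF_mem_blockSpan hcl (freeVec_mem_colorSpan hcl ha))
      (cycF_mem_blockSpan hcl (freeVec_mem_colorSpan hcl hb))
  · intro n a b hn ha hb hca hcb
    obtain ⟨i, hi, hai, hna⟩ := exists_centered_tuple hcl h0 hS hn ha hca
    obtain ⟨j, hj, hbj, hnb⟩ := exists_centered_tuple hcl h0 hS hn hb hcb
    rw [rhoFree_apply, rhoF_apply, pairF_rot_congr hψ h0 hna hnb,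
      pairF_tuple_eq hψ h0 hS hn hi hj hai hbj]
    simp only [pairF_freeVec]

end FormalFreeness

/-! ### From formal lists to the Fock space -/

section ListWords

variable {V : Type*} [AddCommGroup V] [Module ℂ V]

/-- The elementary tensor of a list. -/
def wordL (l : List V) : Fock V := word l.get

/-- The circular tensor of a list. -/
def circL (l : List V) : CycFock V := circ l.length (PiTensorProduct.tprod ℂ l.get)

theorem wordL_ofFn {n : ℕ} (f : Fin n → V) : wordL (List.ofFn f) = word f := by
  have key (l : List V) (hl : l.length = n) (hf : ∀ i : Fin n, l.get (i.cast hl.symm) = f i) :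
      wordL l = word f := by
    subst hl
    exact congrArg word (funext hf)
  exact key _ (by simp) (by simp)

theorem circL_ofFn {n : ℕ} (f : Fin n → V) :
    circL (List.ofFn f) = circ n (PiTensorProduct.tprod ℂ f) := by
  have key (l : List V) (hl : l.length = n) (hf : ∀ i : Fin n, l.get (i.cast hl.symm) = f i) :
      circL l = circ n (PiTensorProduct.tprod ℂ f) := by
    subst hl
    exact congrArg (fun f => circ _ (PiTensorProduct.tprod ℂ f)) (funext hf)
  exact key _ (by simp) (by simp)

theorem vacuum_eq : vacuum V = wordL [] := congrArg word (Subsingleton.elim _ _)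

theorem creation_wordL (f : V) (l : List V) : creation f (wordL l) = wordL (f :: l) := by
  rw [wordL, creation_word]
  refine congrArg word (funext fun i => ?_)
  refine Fin.cases ?_ (fun j => ?_) i <;> rfl

theorem annihilation_wordL (h : V →ₗ[ℂ] V →ₗ⋆[ℂ] ℂ) (f g : V) (l : List V) :
    annihilation h f (wordL (g :: l)) = h g f • wordL l :=
  annihilation_word h f _

theorem annihilation_wordL_nil (h : V →ₗ[ℂ] V →ₗ⋆[ℂ] ℂ) (f : V) :
    annihilation h f (wordL []) = 0 :=
  annihilation_vacuum h f _

theorem preservation_wordL (T : Module.End ℂ V) (g : V) (l : List V) :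
    preservation T (wordL (g :: l)) = wordL (T g :: l) := by
  rw [wordL]
  refine (preservation_word T _).trans (congrArg word (funext fun i => ?_))
  refine Fin.cases ?_ (fun j => ?_) i <;> rfl

theorem preservation_wordL_nil (T : Module.End ℂ V) : preservation T (wordL []) = 0 :=
  preservation_vacuum T _

/-- With `circL_cons_zero`, this removes the merged letters in the semi-circular case, since their
vector part is zero. -/
theorem wordL_cons_zero (l : List V) : wordL ((0 : V) :: l) = 0 := by
  rw [← creation_wordL, creation]
  induction wordL l using fock_induction with
  | hs c x hx => rw [map_smul, hx, smul_zero]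
  | ha x y hx hy => rw [map_add, hx, hy, add_zero]
  | hw n f => simp [word]

/-- Appending instead of prepending a letter is one application of `finRotate`, hence a defining
relation of the circular tensors. -/
theorem circL_rotate (a : V) (l : List V) : circL (l ++ [a]) = circL (a :: l) := by
  have h1 : l ++ [a] = List.ofFn (Fin.snoc (α := fun _ => V) l.get a) := by
    rw [List.ofFn_succ', List.concat_eq_append]
    simp
  have h2 : a :: l = List.ofFn (Fin.cons (α := fun _ => V) a l.get) := by simp
  rw [h1, h2, circL_ofFn, circL_ofFn, Fin.snoc_eq_cons_rotate, eq_comm]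
  refine congrArg (DirectSum.lof ℂ ℕ (fun n => CircTensor V n) (l.length + 1))
    ((Submodule.Quotient.eq _).mpr (Submodule.subset_span ⟨_, rfl⟩))

theorem circL_cons_zero (l : List V) : circL ((0 : V) :: l) = 0 := by
  have : PiTensorProduct.tprod ℂ ((0 : V) :: l).get = 0 :=
    (PiTensorProduct.tprod ℂ).map_coord_zero ⟨0, by simp⟩ rfl
  rw [circL, this, map_zero]

theorem finRotate_pow_val {n : ℕ} (k : ℕ) (i : Fin n) :
    ((finRotate n ^ k) i : ℕ) = (i + k) % n := by
  induction k with
  | zero => simp [Nat.mod_eq_of_lt i.isLt]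
  | succ k ih => rw [pow_succ', Equiv.Perm.mul_apply, finRotate_val, ih]; simp [add_assoc]

end ListWords

theorem zipPair_ofFn {L : Type*} [Semigroup L] (ψ : L → ℂ) {n : ℕ} (x y : Fin n → L) :
    zipPair ψ (List.ofFn x) (List.ofFn y) = ∏ i, ψ (x i * y i) := by
  induction n with
  | zero => simp [zipPair]
  | succ n ih => rw [List.ofFn_succ, List.ofFn_succ, zipPair, ih, Fin.prod_univ_succ]

/-! ### The adjoint on formal lists -/

section Star

variable {L : Type*} [Semigroup L] [StarMul L]

/-- The adjoint of a word. -/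
def starList (ξ : List L) : List L := ξ.reverse.map star

/-- The antilinear extension of the adjoint of words. -/
def starF : FormalFock L →ₗ⋆[ℂ] FormalFock L where
  toFun x := linExt (fun ξ => lst (starList ξ))
    (MonoidAlgebra.mapRingHom (FreeMonoid L) (starRingEnd ℂ) x)
  map_add' x y := by simp
  map_smul' c x := by
    rw [← map_smul]
    congr 1
    ext m
    simp

theorem starF_lst (ξ : List L) : starF (lst ξ) = lst (starList ξ) := by
  simp [starF, lst, linExt]

theorem starF_one : starF (1 : FormalFock L) = 1 := by rw [← lst_nil, starF_lst]; rfl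

variable {ψ : L → ℂ}

theorem starF_wickList (hs : ∀ a, ψ (star a) = (starRingEnd ℂ) (ψ a)) (ζ η : List L) :
    starF (wickList ψ ζ η) = wickList ψ (η.map star) (ζ.map star) := by
  induction ζ generalizing η with
  | nil => rw [wickList, starF_lst, List.map_nil, wickList_nil_right, starList, List.map_reverse]
  | cons x ζ ih =>
    cases η with
    | nil => simp [wickList, starF_lst, starList]
    | cons y η =>
      rw [wickList, map_add, map_add, map_smulₛₗ, ih, List.map_cons, List.map_cons, wickList,
        starF_lst, starF_lst, ← hs]
      simp [starList]

theorem starF_wickF (hs : ∀ a, ψ (star a) = (starRingEnd ℂ) (ψ a)) (x y : FormalFock L) :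
    starF (wickF ψ x y) = wickF ψ (starF y) (starF x) := by
  induction x using formal_induction with
  | hl ξ =>
    induction y using formal_induction with
    | hl η =>
      rw [wickF_lst, starF_wickList hs, starF_lst, starF_lst, wickF_lst]
      simp [starList]
    | ha x y hx hy => simp only [map_add, LinearMap.add_apply, hx, hy]
    | hs c x hx => simp only [map_smul, map_smulₛₗ, LinearMap.smul_apply, hx]
  | ha x y hx hy => simp only [map_add, LinearMap.add_apply, hx, hy]
  | hs c x hx => simp only [map_smul, map_smulₛₗ, LinearMap.smul_apply, hx]

/-- The vacuum vector of a word is a Wick product of vectors of single letters, and the adjoint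
reverses Wick products; only one letter has to be checked. -/
theorem starF_state (hs : ∀ a, ψ (star a) = (starRingEnd ℂ) (ψ a)) (W : List L) :
    starF (state ψ W) = state ψ (starList W) := by
  induction W with
  | nil => exact starF_one
  | cons d W ih =>
    have h1 : state ψ [d] = lst [d] + ψ d • 1 := by simp
    have h2 : starF (state ψ [d]) = state ψ [star d] := by
      simp [starF_lst, starF_one, hs, starList]
    have h3 : starList (d :: W) = starList W ++ [star d] := by simp [starList]
    have h4 : state ψ (d :: W) = wickF ψ (state ψ [d]) (state ψ W) := by
      rw [wickF_state]; simp
    rw [h4, starF_wickF hs, ih, h2, wickF_state, h3, state_append]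

end Star

/-! ### Comparison of the formal and the actual Fock space -/

section Bridge

variable {L V : Type*} [Semigroup L] [StarMul L] [AddCommGroup V] [Module ℂ V] {ψ : L → ℂ}
  {h : V →ₗ[ℂ] V →ₗ⋆[ℂ] ℂ} {v : L → V} {P : L → AdjOp (fockForm h)} {C : Fock V →ₗ[ℂ] CycFock V}

/-- Lists of letters as elementary tensors. -/
def toFock (v : L → V) : FormalFock L →ₗ[ℂ] Fock V := linExt fun ξ => wordL (ξ.map v)

/-- Lists of letters as circular tensors. -/
def toCyc (v : L → V) : FormalFock L →ₗ[ℂ] CycFock V := linExt fun ξ => circL (ξ.map v)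

omit [Semigroup L] [StarMul L] in
theorem toFock_one (v : L → V) : toFock v 1 = vacuum V := by
  rw [← lst_nil, toFock, linExt_lst, vacuum_eq, List.map_nil]

omit [StarMul L] in
theorem lift_op (hP : ∀ d ξ, (P d).op (toFock v (lst ξ)) = toFock v (opF ψ d (lst ξ)))
    (t : FreeAlgebra ℂ L) (x : FormalFock L) :
    (FreeAlgebra.lift ℂ P t).op (toFock v x) = toFock v (freeOp ψ t x) := by
  induction t using FreeAlgebra.induction generalizing x with
  | grade0 c => simp [Algebra.algebraMap_eq_smul_one]
  | grade1 d =>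
    rw [FreeAlgebra.lift_ι_apply, freeOp, FreeAlgebra.lift_ι_apply]
    induction x using formal_induction with
    | hl ξ => exact hP d ξ
    | ha x y hx hy => simp only [map_add, hx, hy]
    | hs c x hx => simp only [map_smul, hx]
  | add s t hs ht => simp [hs, ht]
  | mul s t hs ht => simp [hs, ht]

omit [StarMul L] in
theorem lift_op_vacuum (hP : ∀ d ξ, (P d).op (toFock v (lst ξ)) = toFock v (opF ψ d (lst ξ)))
    (t : FreeAlgebra ℂ L) :
    (FreeAlgebra.lift ℂ P t).op (vacuum V) = toFock v (freeVec ψ t) := by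
  rw [← toFock_one v, lift_op hP, freeVec_apply]

theorem lift_adj_vacuum (hs : ∀ a, ψ (star a) = (starRingEnd ℂ) (ψ a))
    (hP : ∀ d ξ, (P d).op (toFock v (lst ξ)) = toFock v (opF ψ d (lst ξ)))
    (hadj : ∀ d, (P d).adj = (P (star d)).op) (t : FreeAlgebra ℂ L) :
    (FreeAlgebra.lift ℂ P t).adj (vacuum V) = toFock v (starF (freeVec ψ t)) := by
  have key (W : List L) :
      (FreeAlgebra.lift ℂ P (freeWord W)).adj = (FreeAlgebra.lift ℂ P (freeWord (starList W))).op := by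
    induction W with
    | nil => simp [freeWord, starList]
    | cons d W ih =>
      have h3 : starList (d :: W) = starList W ++ [star d] := by simp [starList]
      have h4 : freeWord (d :: W) = FreeAlgebra.ι ℂ d * freeWord W := by simp [freeWord]
      have h5 : freeWord [star d] = FreeAlgebra.ι ℂ (star d) := by simp [freeWord]
      rw [h3, h4, freeWord_append, h5, map_mul, map_mul, AdjOp.mul_adj, AdjOp.mul_op, ih,
        FreeAlgebra.lift_ι_apply, FreeAlgebra.lift_ι_apply, hadj]
  induction t using free_induction with
  | hw W => rw [key, lift_op_vacuum hP, freeVec_freeWord, freeVec_freeWord, starF_state hs]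
  | ha s t hs ht => simp only [map_add, AdjOp.add_adj, LinearMap.add_apply, hs, ht]
  | hs c t ht => simp only [map_smul, AdjOp.smul_adj, LinearMap.smul_apply, ht, map_smulₛₗ]

omit [Semigroup L] [StarMul L] in
theorem fockForm_toFock_vacuum (x : FormalFock L) :
    fockForm h (toFock v x) (vacuum V) = vacF x := by
  induction x using formal_induction with
  | hl ξ =>
    rw [toFock, linExt_lst]
    rcases ξ with _ | ⟨e, ξ⟩
    · rw [lst_nil, vacuum, List.map_nil, wordL]
      refine (fockForm_word h _ _).trans ?_
      simp
    · rw [vacuum, wordL, fockForm_word_ne h (by simp)]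
      simp
  | ha x y hx hy => simp only [map_add, LinearMap.add_apply, hx, hy]
  | hs c x hx => simp only [map_smul, LinearMap.smul_apply, hx]

omit [Semigroup L] [StarMul L] in
theorem exists_ofFn {l : List L} {n : ℕ} (h : l.length = n) :
    ∃ x : Fin n → L, l = List.ofFn x := by
  subst h
  exact ⟨l.get, by simp⟩

/-- The bilinear pairing reverses one list and the adjoint of words reverses again, so the letters
meet in the order prescribed by the sesquilinear form. The lists are parametrized by functions on
`Fin n` to match rotations with powers of `finRotate`. -/
theorem cycForm_circL (hψ : ∀ a b, ψ (a * b) = ψ (b * a))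
    (hh : ∀ x y, h (v x) (v y) = ψ (star y * x)) (ξ η : List L) :
    cycForm h (circL (ξ.map v)) (circL ((starList η).map v)) =
      pairF ψ (lst ξ) (rotF (lst η)) := by
  by_cases hl : ξ.length = η.length
  · obtain ⟨n, hn⟩ : ∃ n, ξ.length = n := ⟨_, rfl⟩
    obtain ⟨y, hy⟩ := exists_ofFn (l := η.reverse) (n := n) (by simp [← hl, hn])
    obtain ⟨x, rfl⟩ := exists_ofFn hn
    obtain rfl : η = (List.ofFn y).reverse := by rw [← hy, List.reverse_reverse]
    have h1 : (starList (List.ofFn y).reverse).map v = List.ofFn fun i => v (star (y i)) := by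
      simp [starList, List.map_ofFn, Function.comp_def]
    rw [h1, List.map_ofFn, circL_ofFn, circL_ofFn, cycForm_circ, rotF_lst, map_splitSum,
      splitSum_reverse, splitSum_ofFn, ← Fin.sum_univ_eq_sum_range
        (fun k => ∏ i, h ((v ∘ x) i) (v (star (y ((finRotate n ^ k) i)))))]
    refine Finset.sum_congr rfl fun k _ => ?_
    rw [pairF_lst, ← zipPair_reverse, List.reverse_reverse]
    have h2 : (((List.ofFn y).take k).reverse ++ (((List.ofFn y).drop (k + 1)).reverse ++
        [y k])).reverse = List.ofFn fun i => y ((finRotate n ^ (k : ℕ)) i) := by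
      have h3 : (((List.ofFn y).take k).reverse ++ (((List.ofFn y).drop (k + 1)).reverse ++
          [y k])).reverse = (List.ofFn y).rotate k := by
        have hk : (k : ℕ) < (List.ofFn y).length := by simp
        rw [List.rotate_eq_drop_append_take hk.le, List.drop_eq_getElem_cons hk]
        simp
      rw [h3]
      refine List.ext_getElem (by simp) fun i h1 h2 => ?_
      simp only [List.getElem_rotate, List.getElem_ofFn, List.length_ofFn]
      exact congrArg y (Fin.ext (finRotate_pow_val (k : ℕ) ⟨i, by simpa using h2⟩).symm)
    rw [h2, zipPair_ofFn]
    refine Finset.prod_congr rfl fun i _ => ?_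
    rw [Function.comp_apply, hh, star_star, hψ]
  · rw [pairF_rot_of_length_ne ψ hl, circL, circL, circ, circ, LinearMap.comp_apply,
      LinearMap.comp_apply, cycForm, sumForm_of, DirectSum.lof_eq_of, DirectSum.of_eq_of_ne, map_zero]
    simpa [starList] using hl

theorem cycForm_toCyc (hψ : ∀ a b, ψ (a * b) = ψ (b * a))
    (hh : ∀ x y, h (v x) (v y) = ψ (star y * x)) (x y : FormalFock L) :
    cycForm h (toCyc v x) (toCyc v (starF y)) = pairF ψ x (rotF y) := by
  induction x using formal_induction with
  | hl ξ =>
    induction y using formal_induction with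
    | hl η => rw [starF_lst, toCyc, linExt_lst, linExt_lst, cycForm_circL hψ hh]
    | ha x y hx hy => simp only [map_add, hx, hy]
    | hs c x hx => simp only [map_smul, map_smulₛₗ, hx, RingHomCompTriple.comp_apply,
        RingHom.id_apply]
  | ha x y hx hy => simp only [map_add, LinearMap.add_apply, hx, hy]
  | hs c x hx => simp only [map_smul, LinearMap.smul_apply, hx]

/-- The adjoint and `c` commute only after passing to circular tensors: the letter merged from the
two ends is put in front by `c` and moved to the back by the adjoint. -/
theorem toCyc_cycF_starF (hs : ∀ a, ψ (star a) = (starRingEnd ℂ) (ψ a)) (y : FormalFock L) :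
    toCyc v (cycF ψ (starF y)) = toCyc v (starF (cycF ψ y)) := by
  induction y using formal_induction with
  | hl η =>
    rw [starF_lst, cycF_lst, cycF_lst]
    induction η using List.bidirectionalRec with
    | nil => simp [starList, cycList]
    | singleton e => simp [starList, cycList, starF_lst]
    | cons_append e m f ih =>
      have h1 : starList (e :: (m ++ [f])) = star f :: (starList m ++ [star e]) := by
        simp [starList]
      have h2 : starList (f * e :: m) = starList m ++ [star e * star f] := by simp [starList]
      rw [h1, cycList_ends, cycList_ends]
      simp only [map_add, map_smul, map_smulₛₗ, starF_lst, ih, h1, h2, ← hs, star_mul]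
      congr 2
      · rw [toCyc, linExt_lst, linExt_lst, List.map_append, List.map_cons, List.map_cons,
          List.map_nil, circL_rotate]
  | ha x y hx hy => simp only [map_add, hx, hy]
  | hs c x hx => simp only [map_smul, map_smulₛₗ, hx]

omit [StarMul L] in
theorem lift_phi (hP : ∀ d ξ, (P d).op (toFock v (lst ξ)) = toFock v (opF ψ d (lst ξ)))
    (t : FreeAlgebra ℂ L) :
    fockForm h ((FreeAlgebra.lift ℂ P t).op (vacuum V)) (vacuum V) = phiFree ψ t := by
  rw [lift_op_vacuum hP, fockForm_toFock_vacuum, phiFree_apply]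

/-- The right argument of ρ enters through its adjoint and a conjugate linear slot. The two
conjugations cancel, which leaves the bilinear formal functional. -/
theorem lift_rho (hψ : ∀ a b, ψ (a * b) = ψ (b * a))
    (hs : ∀ a, ψ (star a) = (starRingEnd ℂ) (ψ a))
    (hh : ∀ x y, h (v x) (v y) = ψ (star y * x))
    (hP : ∀ d ξ, (P d).op (toFock v (lst ξ)) = toFock v (opF ψ d (lst ξ)))
    (hadj : ∀ d, (P d).adj = (P (star d)).op)
    (hC : ∀ ξ, C (wordL (ξ.map v)) = toCyc v (cycList ψ ξ)) (s t : FreeAlgebra ℂ L) :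
    cycForm h (C ((FreeAlgebra.lift ℂ P s).op (vacuum V)))
      (C ((FreeAlgebra.lift ℂ P t).adj (vacuum V))) = rhoFree ψ s t := by
  have hC' (x : FormalFock L) : C (toFock v x) = toCyc v (cycF ψ x) := by
    induction x using formal_induction with
    | hl ξ => rw [toFock, linExt_lst, hC, cycF_lst]
    | ha x y hx hy => simp only [map_add, hx, hy]
    | hs c x hx => simp only [map_smul, hx]
  rw [lift_op_vacuum hP, lift_adj_vacuum hs hP hadj, hC', hC', toCyc_cycF_starF hs,
    cycForm_toCyc hψ hh, rhoFree_apply, rhoF_apply]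

end Bridge

theorem adjoin_surjective {A B : Type*} [Ring A] [Algebra ℂ A] [Ring B] [Algebra ℂ B] {s : Set A}
    (f : B →ₐ[ℂ] Algebra.adjoin ℂ s) (hf : ∀ x ∈ s, ∃ b, (f b : A) = x) :
    Function.Surjective f := by
  rintro ⟨a, ha⟩
  suffices h : ∃ b, (f b : A) = a by
    obtain ⟨b, hb⟩ := h
    exact ⟨b, Subtype.ext hb⟩
  induction ha using Algebra.adjoin_induction with
  | mem x hx => exact hf x hx
  | algebraMap c => exact ⟨algebraMap ℂ B c, by simp⟩
  | add x y _ _ hx hy =>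
    obtain ⟨b, hb⟩ := hx
    obtain ⟨b', hb'⟩ := hy
    exact ⟨b + b', by simp [hb, hb']⟩
  | mul x y _ _ hx hy =>
    obtain ⟨b, hb⟩ := hx
    obtain ⟨b', hb'⟩ := hy
    exact ⟨b * b', by simp [hb, hb']⟩

/-! ### The map `c` on lists -/

section Ends

variable {V : Type*} [AddCommGroup V] [Module ℂ V]

omit [AddCommGroup V] [Module ℂ V] in
theorem ends_eq_ofFn (e : V) {n : ℕ} (g : Fin n → V) (f : V) :
    e :: (List.ofFn g ++ [f]) = List.ofFn (Fin.cons (α := fun _ => V) e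
      (Fin.snoc (α := fun _ => V) g f : Fin (n + 1) → V)) := by
  rw [List.ofFn_succ]
  simp only [Fin.cons_zero, Fin.cons_succ]
  rw [List.ofFn_succ', List.concat_eq_append]
  simp

theorem contractEnds_cons_snoc (b : V →ₗ[ℂ] V →ₗ[ℂ] ℂ) (e : V) {n : ℕ} (g : Fin n → V) (f : V) :
    contractEnds b n (PiTensorProduct.tprod ℂ (Fin.cons (α := fun _ => V) e
      (Fin.snoc (α := fun _ => V) g f : Fin (n + 1) → V))) =
      b e f • PiTensorProduct.tprod ℂ g := by
  have h : Fin.last (n + 1) = (Fin.last n).succ := rfl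
  rw [contractEnds, pairEnds_tprod, h]
  simp

theorem mergeEnds_cons_snoc (m : V →ₗ[ℂ] V →ₗ[ℂ] V) (e : V) {n : ℕ} (g : Fin n → V) (f : V) :
    mergeEnds m n (PiTensorProduct.tprod ℂ (Fin.cons (α := fun _ => V) e
      (Fin.snoc (α := fun _ => V) g f : Fin (n + 1) → V))) =
      PiTensorProduct.tprod ℂ (Fin.cons (α := fun _ => V) (m f e) g) := by
  have h : Fin.last (n + 1) = (Fin.last n).succ := rfl
  rw [mergeEnds, pairEnds_tprod, h]
  simp

end Ends

/-! ### The compound Poisson case -/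

section Poisson

variable {D : Type*} [Ring D] [StarRing D] [Algebra ℂ D] [StarModule ℂ D] (ψ : TracialState D)

omit [StarModule ℂ D] in
theorem poissonC_word {n : ℕ} (f : Fin n → D) :
    poissonC ψ (word f) = poissonCAux ψ n (PiTensorProduct.tprod ℂ f) := by
  simp [poissonC, word]

omit [StarModule ℂ D] in
theorem poissonC_ends (e : D) (m : List D) (f : D) :
    poissonC ψ (wordL (e :: (m ++ [f]))) =
      circL (e :: (m ++ [f])) + circL (f * e :: m) + ψ.toFun (e * f) • poissonC ψ (wordL m) := by
  obtain ⟨n, hn⟩ : ∃ n, m.length = n := ⟨_, rfl⟩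
  obtain ⟨g, rfl⟩ := exists_ofFn hn
  have h : f * e :: List.ofFn g = List.ofFn (Fin.cons (α := fun _ => D) (f * e) g) := by simp
  rw [ends_eq_ofFn, h, wordL_ofFn, circL_ofFn, circL_ofFn, wordL_ofFn, poissonC_word, poissonC_word,
    poissonCAux]
  simp only [LinearMap.add_apply, LinearMap.comp_apply, contractEnds_cons_snoc,
    mergeEnds_cons_snoc, map_smul]
  rfl

omit [StarModule ℂ D] in
theorem poissonC_wordL (ξ : List D) :
    poissonC ψ (wordL (ξ.map id)) = toCyc id (cycList ψ.toFun ξ) := by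
  rw [List.map_id]
  induction ξ using List.bidirectionalRec with
  | nil => rw [wordL, poissonC_word, cycList, map_zero]; rfl
  | singleton e =>
    rw [wordL, poissonC_word, cycList, toCyc, linExt_lst, List.map_id]
    rfl
  | cons_append e m f ih =>
    rw [poissonC_ends, cycList_ends, ih]
    simp only [map_add, map_smul, toCyc, linExt_lst, List.map_id]

theorem poissonOp_op (d : D) (ξ : List D) :
    (poissonOp ψ d).op (toFock id (lst ξ)) = toFock id (opF ψ.toFun d (lst ξ)) := by
  simp only [poissonOp, LinearMap.add_apply, LinearMap.smul_apply, Module.End.one_apply]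
  rcases ξ with _ | ⟨e, ξ⟩
  · have h : lst ([] : List D) = 1 := lst_nil
    conv_rhs => rw [h, opF_one]
    simp [toFock, ← h, annihilation_wordL_nil, preservation_wordL_nil, creation_wordL]
  · simp only [opF_cons, map_add, map_smul, toFock, linExt_lst, List.map_id, creation_wordL,
      annihilation_wordL, preservation_wordL, stateForm_apply, star_star,
      LinearMap.mulLeft_apply]
    abel

/-- The surjection of the free algebra on the letters onto the algebra generated by the `p(d)`. -/
def poissonHom : FreeAlgebra ℂ D →ₐ[ℂ] PoissonAlg ψ := FreeAlgebra.lift ℂ (poisson ψ)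

theorem poissonHom_val (t : FreeAlgebra ℂ D) :
    (poissonHom ψ t).1 = FreeAlgebra.lift ℂ (poissonOp ψ) t := by
  have : (PoissonAlg ψ).val.comp (poissonHom ψ) = FreeAlgebra.lift ℂ (poissonOp ψ) := by
    refine FreeAlgebra.hom_ext (funext fun d => ?_)
    simp [poissonHom, poisson]
  exact DFunLike.congr_fun this t

theorem poissonHom_surjective : Function.Surjective (poissonHom ψ) := by
  refine adjoin_surjective _ fun x hx => ?_
  obtain ⟨d, rfl⟩ := hx
  exact ⟨FreeAlgebra.ι ℂ d, by simp [poissonHom, poisson]⟩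

theorem poissonPhi_hom (t : FreeAlgebra ℂ D) :
    poissonPhi ψ (poissonHom ψ t) = phiFree ψ.toFun t := by
  have h := lift_phi (poissonOp_op ψ) t
  rw [← poissonHom_val] at h
  exact h

theorem poissonRho_hom (s t : FreeAlgebra ℂ D) :
    poissonRho ψ (poissonHom ψ s) (poissonHom ψ t) = rhoFree ψ.toFun s t := by
  have h := lift_rho (ψ := ψ.toFun) (v := id) (C := poissonC ψ) (P := poissonOp ψ) ψ.trace
    ψ.map_star (fun _ _ => rfl) (poissonOp_op ψ) (fun d => rfl) (poissonC_wordL ψ) s t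
  rw [← poissonHom_val, ← poissonHom_val] at h
  exact h

theorem isSecondOrderSpace_poisson : IsSecondOrderSpace (poissonPhi ψ) (poissonRho ψ) :=
  (isSecondOrderSpace_free ψ.toFun ψ.trace).of_surjective (poissonHom ψ) (poissonHom_surjective ψ)
    (poissonPhi_hom ψ) (poissonRho_hom ψ)

theorem isSecondOrderFree_poisson {p : ℕ} (d : Fin p → D) (hd : ∀ i j, i ≠ j → d i * d j = 0) :
    IsSecondOrderFree (poissonPhi ψ) (poissonRho ψ)
      (fun i => Algebra.adjoin ℂ {poisson ψ (d i)}) := by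
  -- The positive powers of `d i` are the smallest set of letters containing `d i` and closed under
  -- multiplication; for different indices their products still vanish.
  let S : Fin p → Set D := fun i => {x | ∃ k : ℕ, x = d i ^ (k + 1)}
  have h := isSecondOrderFree_free (ψ := ψ.toFun) (S := S) ψ.trace (map_zero _) ?_ ?_
  · refine h.of_map (poissonHom ψ) (fun i => ?_) (poissonPhi_hom ψ) (poissonRho_hom ψ)
    rw [Algebra.adjoin_le_iff, Set.singleton_subset_iff]
    refine ⟨FreeAlgebra.ι ℂ (d i), Algebra.subset_adjoin ⟨d i, ⟨0, by simp⟩, rfl⟩, ?_⟩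
    simp [poissonHom]
  · rintro i _ ⟨k, rfl⟩ _ ⟨l, rfl⟩
    exact ⟨k + 1 + l, by rw [← pow_add]; rfl⟩
  · rintro i j hij _ ⟨k, rfl⟩ _ ⟨l, rfl⟩
    rw [pow_succ, pow_succ', mul_assoc, ← mul_assoc (d i), hd i j hij, zero_mul, mul_zero]

end Poisson

/-! ### The semi-circular case -/

section Semi

variable (E : Type*) [NormedAddCommGroup E] [InnerProductSpace ℝ E]

variable {E} in
theorem cpxConj_cpxConj (x : Cpx E) : cpxConj E (cpxConj E x) = x := by
  induction x using TensorProduct.induction_on with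
  | zero => simp
  | tmul z f => simp [cpxConj_tmul]
  | add x y hx hy => rw [map_add, map_add, hx, hy]

variable {E} in
theorem cpxBilin_symm (x y : Cpx E) : cpxBilin E x y = cpxBilin E y x := by
  induction x using TensorProduct.induction_on with
  | zero => simp
  | add x x' hx hx' => rw [map_add, LinearMap.add_apply, hx, hx', map_add]
  | tmul z f =>
    induction y using TensorProduct.induction_on with
    | zero => simp
    | add x x' hx hx' => rw [map_add, hx, hx', map_add, LinearMap.add_apply]
    | tmul w g => rw [cpxBilin_tmul, cpxBilin_tmul, real_inner_comm, mul_comm z w]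

variable {E} in
theorem cpxInner_apply (x y : Cpx E) : cpxInner E x y = cpxBilin E x (cpxConj E y) := rfl

variable {E} in
theorem conj_cpxBilin (x y : Cpx E) :
    (starRingEnd ℂ) (cpxBilin E x y) = cpxBilin E (cpxConj E y) (cpxConj E x) := by
  rw [← cpxInner_apply, cpxInner_symm, cpxInner_apply, cpxConj_cpxConj]

/-- Letters for words in the `ω(f)`: the letter `⟨f, c⟩` stands for `ω(f) + c`. -/
@[ext]
structure SemiLetter where
  vec : Cpx E
  scalar : ℂ

/-- Products have vector part zero, so all triple products vanish and associativity is automatic. -/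
instance : SemigroupWithZero (SemiLetter E) where
  mul x y := ⟨0, cpxBilin E x.vec y.vec⟩
  zero := ⟨0, 0⟩
  mul_assoc x y z := by
    change SemiLetter.mk (0 : Cpx E) (cpxBilin E 0 z.vec) = ⟨0, cpxBilin E x.vec 0⟩
    simp
  zero_mul x := by
    change SemiLetter.mk (0 : Cpx E) (cpxBilin E 0 x.vec) = ⟨0, 0⟩
    simp
  mul_zero x := by
    change SemiLetter.mk (0 : Cpx E) (cpxBilin E x.vec 0) = ⟨0, 0⟩
    simp

instance : StarMul (SemiLetter E) where
  star x := ⟨cpxConj E x.vec, (starRingEnd ℂ) x.scalar⟩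
  star_involutive x := by
    change SemiLetter.mk (cpxConj E (cpxConj E x.vec)) ((starRingEnd ℂ) ((starRingEnd ℂ) x.scalar)) =
      x
    rw [cpxConj_cpxConj, Complex.conj_conj]
  star_mul x y := by
    change SemiLetter.mk (cpxConj E 0) ((starRingEnd ℂ) (cpxBilin E x.vec y.vec)) =
      ⟨0, cpxBilin E (cpxConj E y.vec) (cpxConj E x.vec)⟩
    rw [map_zero, conj_cpxBilin]

/-- The operator of a letter. -/
def semiOp (x : SemiLetter E) : AdjOp (fockForm (cpxInner E)) := omegaOp x.vec + x.scalar • 1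

theorem semiScalar_mul_comm (x y : SemiLetter E) : (x * y).scalar = (y * x).scalar :=
  cpxBilin_symm _ _

theorem semiC_word {n : ℕ} (f : Fin n → Cpx E) :
    semiC E (word f) = semiCAux E n (PiTensorProduct.tprod ℂ f) := by
  simp [semiC, word]

theorem semiC_ends (e : Cpx E) (m : List (Cpx E)) (f : Cpx E) :
    semiC E (wordL (e :: (m ++ [f]))) =
      circL (e :: (m ++ [f])) + cpxBilin E e f • semiC E (wordL m) := by
  obtain ⟨n, hn⟩ : ∃ n, m.length = n := ⟨_, rfl⟩
  obtain ⟨g, rfl⟩ := exists_ofFn hn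
  rw [ends_eq_ofFn, wordL_ofFn, circL_ofFn, wordL_ofFn, semiC_word, semiC_word, semiCAux]
  simp only [LinearMap.add_apply, LinearMap.comp_apply, contractEnds_cons_snoc, map_smul]

theorem semiC_wordL (ξ : List (SemiLetter E)) :
    semiC E (wordL (ξ.map SemiLetter.vec)) = toCyc SemiLetter.vec (cycList (SemiLetter.scalar) ξ) := by
  induction ξ using List.bidirectionalRec with
  | nil => rw [wordL, semiC_word, cycList, map_zero]; rfl
  | singleton e =>
    rw [wordL, semiC_word, cycList, toCyc, linExt_lst]
    rfl
  | cons_append e m f ih =>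
    -- The merged letter is a pure scalar, so the middle term of `cycList` disappears and the
    -- recursion for `semiC` remains.
    have h : circL ((f * e).vec :: m.map SemiLetter.vec) = 0 := circL_cons_zero _
    rw [List.map_cons, List.map_append, List.map_singleton, semiC_ends, cycList_ends, ih]
    simp only [map_add, map_smul, toCyc, linExt_lst, List.map_cons, List.map_append, h,
      List.map_nil, add_zero]
    rfl

theorem semiOp_op (d : SemiLetter E) (ξ : List (SemiLetter E)) :
    (semiOp E d).op (toFock SemiLetter.vec (lst ξ)) =
      toFock SemiLetter.vec (opF (SemiLetter.scalar) d (lst ξ)) := by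
  simp only [semiOp, AdjOp.add_op, omegaOp, AdjOp.smul_op, AdjOp.one_op, LinearMap.add_apply,
    LinearMap.smul_apply, Module.End.one_apply]
  rcases ξ with _ | ⟨e, ξ⟩
  · have h : lst ([] : List (SemiLetter E)) = 1 := lst_nil
    conv_rhs => rw [h, opF_one]
    simp [toFock, ← h, annihilation_wordL_nil, creation_wordL]
  · have h : wordL ((d * e).vec :: ξ.map SemiLetter.vec) = 0 := wordL_cons_zero _
    have h2 : cpxInner E e.vec (cpxConj E d.vec) = (d * e).scalar := by
      rw [cpxInner_apply, cpxConj_cpxConj, cpxBilin_symm]; rfl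
    simp only [opF_cons, map_add, map_smul, toFock, linExt_lst, List.map_cons, creation_wordL,
      annihilation_wordL, h, h2, add_zero]

/-- The surjection of the free algebra on the letters onto the algebra generated by the `ω(f)`. -/
def semiHom : FreeAlgebra ℂ (SemiLetter E) →ₐ[ℂ] SemiAlg E :=
  FreeAlgebra.lift ℂ fun x => omega x.vec + x.scalar • 1

theorem semiHom_val (t : FreeAlgebra ℂ (SemiLetter E)) :
    (semiHom E t).1 = FreeAlgebra.lift ℂ (semiOp E) t := by
  have : (SemiAlg E).val.comp (semiHom E) = FreeAlgebra.lift ℂ (semiOp E) := by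
    refine FreeAlgebra.hom_ext (funext fun d => ?_)
    simp [semiHom, omega, semiOp]
  exact DFunLike.congr_fun this t

theorem semiHom_ι (f : Cpx E) :
    semiHom E (FreeAlgebra.ι ℂ (⟨f, 0⟩ : SemiLetter E)) = omega f := by
  rw [semiHom, FreeAlgebra.lift_ι_apply]
  simp

theorem semiHom_surjective : Function.Surjective (semiHom E) := by
  refine adjoin_surjective _ fun x hx => ?_
  obtain ⟨f, rfl⟩ := hx
  exact ⟨_, by rw [semiHom_ι]; rfl⟩

theorem semiPhi_hom (t : FreeAlgebra ℂ (SemiLetter E)) :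
    semiPhi E (semiHom E t) = phiFree (SemiLetter.scalar) t := by
  have h := lift_phi (semiOp_op E) t
  rw [← semiHom_val] at h
  exact h

theorem semiRho_hom (s t : FreeAlgebra ℂ (SemiLetter E)) :
    semiRho E (semiHom E s) (semiHom E t) = rhoFree (SemiLetter.scalar) s t := by
  have h := lift_rho (ψ := SemiLetter.scalar) (v := SemiLetter.vec) (C := semiC E) (P := semiOp E)
    (semiScalar_mul_comm E) (fun _ => rfl) (fun x y => ?_) (semiOp_op E) (fun d => ?_)
    (semiC_wordL E) s t
  · rw [← semiHom_val, ← semiHom_val] at h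
    exact h
  · exact (cpxInner_apply _ _).trans (cpxBilin_symm _ _)
  · change creation (cpxConj E d.vec) + annihilation (cpxInner E) d.vec + _ =
      creation (cpxConj E d.vec) + annihilation (cpxInner E) (cpxConj E (cpxConj E d.vec)) + _
    rw [cpxConj_cpxConj]
    rfl

theorem isSecondOrderSpace_semi : IsSecondOrderSpace (semiPhi E) (semiRho E) :=
  (isSecondOrderSpace_free (SemiLetter.scalar) (semiScalar_mul_comm E)).of_surjective (semiHom E)
    (semiHom_surjective E) (semiPhi_hom E) (semiRho_hom E)

/-- A colour class contains every letter whose vector lies in `T i`, with arbitrary scalar part. It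
is closed under products because these have vector part `0`, and orthogonality makes products across
classes equal to the zero letter. -/
theorem isSecondOrderFree_semi {ι : Type*} (T : ι → Set (Cpx E)) (h0 : ∀ i, 0 ∈ T i)
    (hT : ∀ i j, i ≠ j → ∀ f ∈ T i, ∀ g ∈ T j, cpxBilin E f g = 0) :
    IsSecondOrderFree (semiPhi E) (semiRho E) (fun i => Algebra.adjoin ℂ (omega '' T i)) := by
  let S : ι → Set (SemiLetter E) := fun i => {x | x.vec ∈ T i}
  have h := isSecondOrderFree_free (ψ := SemiLetter.scalar) (S := S) (semiScalar_mul_comm E) rfl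
    (fun i _ _ _ _ => h0 i) (fun i j hij x hx y hy => SemiLetter.ext rfl (hT i j hij _ hx _ hy))
  refine h.of_map (semiHom E) (fun i => ?_) (semiPhi_hom E) (semiRho_hom E)
  rw [Algebra.adjoin_le_iff]
  rintro _ ⟨f, hf, rfl⟩
  exact ⟨_, Algebra.subset_adjoin ⟨_, hf, rfl⟩, semiHom_ι E f⟩

theorem isSecondOrderFree_semi_real {ι : Type*} (K : ι → Submodule ℝ E)
    (hK : ∀ i j, i ≠ j → ∀ f ∈ K i, ∀ g ∈ K j, inner ℝ f g = 0) :
    IsSecondOrderFree (semiPhi E) (semiRho E)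
      (fun i => Algebra.adjoin ℂ (Set.range fun f : K i => omega (toCpx (f : E)))) := by
  convert isSecondOrderFree_semi E (fun i => toCpx '' (K i : Set E)) (fun i => ?_) ?_ using 3
  · rw [Set.image_image]
    ext x
    simp
  · exact ⟨0, zero_mem _, by simp [toCpx]⟩
  · rintro i j hij _ ⟨f, hf, rfl⟩ _ ⟨g, hg, rfl⟩
    rw [toCpx, toCpx, cpxBilin_tmul, hK i j hij f hf g hg]
    simp

theorem isSecondOrderFree_semi_complex {ι : Type*} (K : ι → Submodule ℂ (Cpx E))
    (hc : ∀ i, ∀ f ∈ K i, cpxConj E f ∈ K i)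
    (hK : ∀ i j, i ≠ j → ∀ f ∈ K i, ∀ g ∈ K j, cpxInner E f g = 0) :
    IsSecondOrderFree (semiPhi E) (semiRho E)
      (fun i => Algebra.adjoin ℂ (Set.range fun f : K i => omega (f : Cpx E))) := by
  convert isSecondOrderFree_semi E (fun i => (K i : Set (Cpx E))) (fun i => zero_mem _) ?_ using 3
  · ext x
    simp
  · intro i j hij f hf g hg
    -- Orthogonality is sesquilinear while letters multiply bilinearly; invariance under conjugation
    -- bridges the two.
    have := hK i j hij f hf _ (hc j g hg)
    rwa [cpxInner_apply, cpxConj_cpxConj] at this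

end Semi

/-! ### Formal cumulants -/

section Cumulants

variable {α : Type*} [DecidableEq α]

/-- The Möbius weight of a partition into `n` blocks. -/
def mobiusWeight (n : ℕ) : ℂ := (-1 : ℂ) ^ (n - 1) * (Nat.factorial (n - 1) : ℂ)

/-- The cumulants of a function on finite sets, thought of as a family of moments. -/
def formalCumulant (m : Finset α → ℂ) (S : Finset α) : ℂ :=
  ∑ π : Finpartition S, mobiusWeight π.parts.card * ∏ b ∈ π.parts, m b

/-- The set of all partitions, as sets of blocks. -/
def partitions (S : Finset α) : Finset (Finset (Finset α)) :=
  Finset.univ.image fun π : Finpartition S => π.parts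

theorem mem_partitions {S : Finset α} {Q : Finset (Finset α)} :
    Q ∈ partitions S ↔ ∅ ∉ Q ∧ (Q : Set (Finset α)).PairwiseDisjoint id ∧ Q.sup id = S := by
  simp only [partitions, Finset.mem_image, Finset.mem_univ, true_and]
  constructor
  · rintro ⟨π, rfl⟩
    exact ⟨π.bot_notMem, π.disjoint, π.sup_parts⟩
  · rintro ⟨h1, h2, h3⟩
    exact ⟨⟨Q, Finset.supIndep_iff_pairwiseDisjoint.mpr h2, h3, h1⟩, rfl⟩

theorem formalCumulant_eq (m : Finset α → ℂ) (S : Finset α) :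
    formalCumulant m S = ∑ Q ∈ partitions S, mobiusWeight Q.card * ∏ b ∈ Q, m b := by
  rw [partitions, Finset.sum_image fun π _ π' _ h => Finpartition.ext h]
  rfl

theorem mobiusWeight_succ (n : ℕ) (hn : 1 ≤ n) :
    mobiusWeight (n + 1) + n * mobiusWeight n = 0 := by
  obtain ⟨n, rfl⟩ : ∃ k, n = k + 1 := ⟨n - 1, by omega⟩
  simp only [mobiusWeight, Nat.add_sub_cancel, Nat.factorial_succ, pow_succ]
  push_cast
  ring

/-- Exactly one block of a partition contains `s`. -/
theorem card_filter_notMem {S : Finset α} {s : α} (hs : s ∈ S) {Q : Finset (Finset α)}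
    (hQ : Q ∈ partitions S) : (Q.filter (s ∉ ·)).card + 1 = Q.card := by
  obtain ⟨π, -, rfl⟩ := Finset.mem_image.mp hQ
  have h1 : π.parts.filter (s ∈ ·) = {π.part s} := by
    ext b
    simp only [Finset.mem_filter, Finset.mem_singleton]
    constructor
    · rintro ⟨hb, hsb⟩
      exact (π.part_eq_of_mem hb hsb).symm
    · rintro rfl
      exact ⟨π.part_mem.mpr hs, π.mem_part hs⟩
  have h2 := Finset.card_filter_add_card_filter_not (s := π.parts) (s ∈ ·)
  rw [h1, Finset.card_singleton] at h2
  omega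

/-- The moment-cumulant relation. -/
theorem sum_formalCumulant (m : Finset α → ℂ) (hm : m ∅ = 1) {S : Finset α} {s : α} (hs : s ∈ S) :
    ∑ T ∈ S.powerset.filter (s ∈ ·), formalCumulant m T * m (S \ T) = m S := by
  have key : ∑ T ∈ (S.powerset.filter (s ∈ ·)).erase S, formalCumulant m T * m (S \ T) =
      ∑ Q ∈ partitions S, (Q.card - 1 : ℕ) * mobiusWeight (Q.card - 1) * ∏ b ∈ Q, m b := by
    have h1 : ∀ Q ∈ partitions S,
        (Q.card - 1 : ℕ) * mobiusWeight (Q.card - 1) * ∏ b ∈ Q, m b =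
          ∑ _B ∈ Q.filter (s ∉ ·), mobiusWeight (Q.card - 1) * ∏ b ∈ Q, m b := by
      intro Q hQ
      rw [Finset.sum_const, ← card_filter_notMem hs hQ, Nat.add_sub_cancel, nsmul_eq_mul, mul_assoc]
    rw [Finset.sum_congr rfl h1]
    simp only [formalCumulant_eq, Finset.sum_mul]
    rw [Finset.sum_sigma', Finset.sum_sigma']
    -- A proper subset `T` containing `s` together with a partition of `T` is the same as a
    -- partition of `S` with a distinguished block avoiding `s`, namely `S \ T`.
    refine Finset.sum_bij' (fun x _ => ⟨insert (S \ x.1) x.2, S \ x.1⟩)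
      (fun y _ => ⟨S \ y.2, y.1.erase y.2⟩) ?_ ?_ ?_ ?_ ?_
    · rintro ⟨T, Q⟩ h
      simp only [Finset.mem_sigma, Finset.mem_erase, Finset.mem_filter, Finset.mem_powerset,
        mem_partitions] at h ⊢
      obtain ⟨⟨hTS, hT, hsT⟩, h1, h2, h3⟩ := h
      have hne : S \ T ≠ ∅ := by
        rw [Ne, Finset.sdiff_eq_empty_iff_subset]
        exact fun h => hTS (hT.antisymm h)
      refine ⟨⟨by simp [h1, hne.symm], ?_, ?_⟩, Finset.mem_insert_self _ _, by simp [hsT]⟩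
      · rw [Finset.coe_insert, Set.pairwiseDisjoint_insert]
        refine ⟨h2, fun b hb _ => ?_⟩
        have : b ≤ T := h3 ▸ Finset.le_sup (f := id) hb
        exact Finset.disjoint_of_subset_right this Finset.sdiff_disjoint
      · rw [Finset.sup_insert, h3]
        exact Finset.sdiff_union_of_subset hT
    · rintro ⟨Q, B⟩ h
      simp only [Finset.mem_sigma, Finset.mem_erase, Finset.mem_filter, Finset.mem_powerset,
        mem_partitions] at h ⊢
      obtain ⟨⟨h1, h2, h3⟩, hB, hsB⟩ := h
      have hBS : B ≤ S := h3 ▸ Finset.le_sup (f := id) hB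
      have hBe : B ≠ ∅ := fun h => h1 (h ▸ hB)
      refine ⟨⟨?_, Finset.sdiff_subset, by simp [hs, hsB]⟩, fun h => h1 h.2, ?_, ?_⟩
      · intro h
        rw [Finset.sdiff_eq_self_iff_disjoint] at h
        exact hBe (Finset.disjoint_self_iff_empty B |>.mp (Finset.disjoint_of_subset_left hBS h))
      · exact h2.subset (by simp)
      · have h4 : S = B ∪ (Q.erase B).sup id := by
          rw [← h3]
          conv_lhs => rw [← Finset.insert_erase hB, Finset.sup_insert]
          rfl
        have h5 : Disjoint B ((Q.erase B).sup id) := by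
          rw [Finset.disjoint_sup_right]
          intro b hb
          exact h2 hB (Finset.mem_of_mem_erase hb) (Finset.ne_of_mem_erase hb).symm
        rw [h4, Finset.union_sdiff_cancel_left h5]
    · rintro ⟨T, Q⟩ h
      simp only [Finset.mem_sigma, Finset.mem_erase, Finset.mem_filter, Finset.mem_powerset,
        mem_partitions] at h
      obtain ⟨⟨hTS, hT, hsT⟩, h1, h2, h3⟩ := h
      have hn : S \ T ∉ Q := by
        intro h
        have h6 : S \ T ≤ Q.sup id := Finset.le_sup (f := id) h
        rw [h3] at h6
        have h7 : S \ T = ∅ := by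
          rw [← Finset.disjoint_self_iff_empty]
          exact Finset.disjoint_of_subset_right h6 Finset.sdiff_disjoint
        exact h1 (h7 ▸ h)
      simp only [Finset.sdiff_sdiff_eq_self hT, Finset.erase_insert hn]
    · rintro ⟨Q, B⟩ h
      simp only [Finset.mem_sigma, Finset.mem_filter, mem_partitions] at h
      obtain ⟨⟨h1, h2, h3⟩, hB, hsB⟩ := h
      have hBS : B ≤ S := h3 ▸ Finset.le_sup (f := id) hB
      simp only [Finset.sdiff_sdiff_eq_self hBS, Finset.insert_erase hB]
    · rintro ⟨T, Q⟩ h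
      simp only [Finset.mem_sigma, Finset.mem_erase, Finset.mem_filter, Finset.mem_powerset,
        mem_partitions] at h
      obtain ⟨⟨hTS, hT, hsT⟩, h1, h2, h3⟩ := h
      have hn : S \ T ∉ Q := by
        intro h
        have h6 : S \ T ≤ Q.sup id := Finset.le_sup (f := id) h
        rw [h3] at h6
        have h7 : S \ T = ∅ := by
          rw [← Finset.disjoint_self_iff_empty]
          exact Finset.disjoint_of_subset_right h6 Finset.sdiff_disjoint
        exact h1 (h7 ▸ h)
      rw [Finset.card_insert_of_notMem hn, Nat.add_sub_cancel, Finset.prod_insert hn]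
      ring
  have hS : S ∈ S.powerset.filter (s ∈ ·) := by simp [hs]
  rw [← Finset.add_sum_erase _ _ hS, key, Finset.sdiff_self, hm, mul_one, formalCumulant_eq,
    ← Finset.sum_add_distrib]
  have hmem : {S} ∈ partitions S := by
    rw [mem_partitions]
    refine ⟨?_, by simp, by simp⟩
    rw [Finset.mem_singleton]
    exact (Finset.ne_empty_of_mem hs).symm
  -- For a partition into `n + 1` blocks the coefficient is `mobiusWeight (n + 1) + n * mobiusWeight
  -- n`, which vanishes for `n ≥ 1`; only the partition with one block is left.
  rw [Finset.sum_eq_single_of_mem _ hmem]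
  · simp [mobiusWeight]
  · intro Q hQ hne
    have hc := card_filter_notMem hs hQ
    have hc2 : Q.card ≠ 1 := by
      intro h
      obtain ⟨B, rfl⟩ := Finset.card_eq_one.mp h
      rw [mem_partitions] at hQ
      exact hne (by simpa using hQ.2.2)
    obtain ⟨n, hn⟩ : ∃ n, Q.card = n + 1 := ⟨_, hc.symm⟩
    rw [← add_mul, hn, Nat.add_sub_cancel, mobiusWeight_succ n (by omega), zero_mul]

theorem formalCumulant_recursion (m : Finset α → ℂ) (hm : m ∅ = 1) {S : Finset α} {s : α}
    (hs : s ∈ S) : formalCumulant m S =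
      m S - ∑ T ∈ (S.powerset.filter (s ∈ ·)).erase S, formalCumulant m T * m (S \ T) := by
  have hS : S ∈ S.powerset.filter (s ∈ ·) := by simp [hs]
  have h := sum_formalCumulant m hm hs
  rw [← Finset.add_sum_erase _ _ hS, Finset.sdiff_self, hm, mul_one] at h
  exact eq_sub_of_add_eq h

/-- Cumulants are determined by the moment-cumulant relation. -/
theorem formalCumulant_unique (m κ : Finset α → ℂ) (hm : m ∅ = 1)
    (h : ∀ S, S.Nonempty → ∃ s ∈ S, ∑ T ∈ S.powerset.filter (s ∈ ·), κ T * m (S \ T) = m S)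
    (S : Finset α) (hS : S.Nonempty) : formalCumulant m S = κ S := by
  induction S using Finset.strongInduction with
  | H S ih =>
    obtain ⟨s, hs, h⟩ := h S hS
    have hS' : S ∈ S.powerset.filter (s ∈ ·) := by simp [hs]
    rw [← Finset.add_sum_erase _ _ hS', Finset.sdiff_self, hm, mul_one] at h
    rw [formalCumulant_recursion m hm hs, ← h, sub_eq_iff_eq_add, add_right_inj]
    refine Finset.sum_congr rfl fun T hT => ?_
    simp only [Finset.mem_erase, Finset.mem_filter, Finset.mem_powerset] at hT
    rw [ih T (hT.2.1.ssubset_of_ne hT.1) ⟨s, hT.2.2⟩]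

theorem tendsto_formalCumulant {l : Filter ℕ} {m : ℕ → Finset α → ℂ} {m' : Finset α → ℂ}
    (h : ∀ S, Tendsto (fun N => m N S) l (𝓝 (m' S))) (S : Finset α) :
    Tendsto (fun N => formalCumulant (m N) S) l (𝓝 (formalCumulant m' S)) :=
  tendsto_finsetSum _ fun _ _ => tendsto_const_nhds.mul (tendsto_finsetProd _ fun b _ => h b)

/-! ### Cumulants of a linear functional on an algebra -/

variable {R : Type*} [CommRing R] [Algebra ℂ R] (e : R →ₗ[ℂ] ℂ)

/-- The joint moments of a family of elements. -/
def momentFun (y : α → R) (S : Finset α) : ℂ := e (∏ i ∈ S, y i)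

/-- The joint cumulant of a family of elements. -/
def functionalCumulant (y : α → R) (S : Finset α) : ℂ := formalCumulant (momentFun e y) S

variable {e}

omit [DecidableEq α] in
theorem momentFun_empty (he : e 1 = 1) (y : α → R) : momentFun e y ∅ = 1 := by
  simp [momentFun, he]

theorem momentFun_update_notMem {y : α → R} {i : α} {x : R} {S : Finset α} (hi : i ∉ S) :
    momentFun e (Function.update y i x) S = momentFun e y S := by
  rw [momentFun, Finset.prod_update_of_notMem hi, momentFun]

/-- The recursion is distinguished at `i` itself, so the varied entry always sits in the cumulant
factor and never in the moment of the complement. -/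
theorem functionalCumulant_update_add (he : e 1 = 1) (y : α → R) (i : α) (a b : R) {S : Finset α}
    (hi : i ∈ S) : functionalCumulant e (Function.update y i (a + b)) S =
      functionalCumulant e (Function.update y i a) S +
        functionalCumulant e (Function.update y i b) S := by
  induction S using Finset.strongInduction with
  | H S ih =>
    simp only [functionalCumulant] at ih ⊢
    simp only [formalCumulant_recursion _ (momentFun_empty he _) hi]
    have h : momentFun e (Function.update y i (a + b)) S =
        momentFun e (Function.update y i a) S + momentFun e (Function.update y i b) S := by
      simp only [momentFun, Finset.prod_update_of_mem hi, add_mul, map_add]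
    rw [h, sub_add_sub_comm, ← Finset.sum_add_distrib]
    congr 1
    refine Finset.sum_congr rfl fun T hT => ?_
    simp only [Finset.mem_erase, Finset.mem_filter, Finset.mem_powerset] at hT
    have hn : i ∉ S \ T := by simp [hT.2.2]
    rw [ih T (hT.2.1.ssubset_of_ne hT.1) hT.2.2, momentFun_update_notMem hn,
      momentFun_update_notMem hn, momentFun_update_notMem hn, add_mul]

theorem functionalCumulant_update_smul (he : e 1 = 1) (y : α → R) (i : α) (c : ℂ) (a : R)
    {S : Finset α} (hi : i ∈ S) : functionalCumulant e (Function.update y i (c • a)) S =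
      c * functionalCumulant e (Function.update y i a) S := by
  induction S using Finset.strongInduction with
  | H S ih =>
    simp only [functionalCumulant] at ih ⊢
    simp only [formalCumulant_recursion _ (momentFun_empty he _) hi]
    have h : momentFun e (Function.update y i (c • a)) S =
        c * momentFun e (Function.update y i a) S := by
      simp only [momentFun, Finset.prod_update_of_mem hi, smul_mul_assoc, map_smul, smul_eq_mul]
    rw [h, mul_sub, Finset.mul_sum]
    congr 1
    refine Finset.sum_congr rfl fun T hT => ?_
    simp only [Finset.mem_erase, Finset.mem_filter, Finset.mem_powerset] at hT
    have hn : i ∉ S \ T := by simp [hT.2.2]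
    rw [ih T (hT.2.1.ssubset_of_ne hT.1) hT.2.2, momentFun_update_notMem hn,
      momentFun_update_notMem hn, mul_assoc]

/-- In the recursion at `i` only `T = {i}` contributes, and it cancels the full moment. -/
theorem functionalCumulant_update_one (he : e 1 = 1) (y : α → R) (i : α) {S : Finset α}
    (hi : i ∈ S) (h2 : S ≠ {i}) : functionalCumulant e (Function.update y i 1) S = 0 := by
  induction S using Finset.strongInduction with
  | H S ih =>
    simp only [functionalCumulant] at ih ⊢
    have hmem : {i} ∈ (S.powerset.filter (i ∈ ·)).erase S := by simp [hi, h2.symm]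
    rw [formalCumulant_recursion _ (momentFun_empty he _) hi, Finset.sum_eq_single_of_mem _ hmem]
    · have h1 : formalCumulant (momentFun e (Function.update y i 1)) {i} = 1 := by
        rw [formalCumulant_recursion _ (momentFun_empty he _) (Finset.mem_singleton_self i),
          Finset.sum_eq_zero]
        · simp [momentFun, he]
        · intro T hT
          simp only [Finset.mem_erase, Finset.mem_filter, Finset.mem_powerset] at hT
          exact absurd (Finset.Subset.antisymm hT.2.1 (by simpa using hT.2.2)) hT.1
      rw [h1, one_mul, sub_eq_zero, momentFun, momentFun, Finset.prod_update_of_mem hi, one_mul,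
        Finset.prod_update_of_notMem (by simp)]
    · intro T hT hne
      simp only [Finset.mem_erase, Finset.mem_filter, Finset.mem_powerset] at hT
      rw [ih T (hT.2.1.ssubset_of_ne hT.1) hT.2.2 hne, zero_mul]

/-- Cumulants of at least two variables do not change under shifts by constants. -/
theorem functionalCumulant_shift [Fintype α] (he : e 1 = 1) (y : α → R) (c : α → ℂ)
    (h2 : ∀ i : α, Finset.univ ≠ {i}) :
    functionalCumulant e (fun i => y i - c i • 1) Finset.univ =
      functionalCumulant e y Finset.univ := by
  -- The variables are shifted one at a time; each constant is removed by
  -- `functionalCumulant_update_one`.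
  have key (U : Finset α) :
      functionalCumulant e (fun i => if i ∈ U then y i - c i • 1 else y i) Finset.univ =
        functionalCumulant e y Finset.univ := by
    induction U using Finset.induction_on with
    | empty => simp
    | insert j U hj ih =>
      set z : α → R := fun i => if i ∈ U then y i - c i • 1 else y i
      have h3 : (fun i => if i ∈ insert j U then y i - c i • 1 else y i) =
          Function.update z j (y j + (-c j) • 1) := by
        funext i
        rcases eq_or_ne i j with rfl | hij
        · simp [sub_eq_add_neg]
        · simp [hij, z]
      have h4 : Function.update z j (y j) = z := by
        rw [Function.update_eq_self_iff]; simp [z, hj]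
      rw [h3, functionalCumulant_update_add he z j _ _ (Finset.mem_univ j),
        functionalCumulant_update_smul he z j _ _ (Finset.mem_univ j),
        functionalCumulant_update_one he z j (Finset.mem_univ j) (h2 j), mul_zero, add_zero, h4, ih]
  simpa using key Finset.univ

theorem functionalCumulant_singleton (he : e 1 = 1) (y : α → R) (i : α) :
    functionalCumulant e y {i} = e (y i) := by
  rw [functionalCumulant, formalCumulant_recursion _ (momentFun_empty he _)
    (Finset.mem_singleton_self i), Finset.sum_eq_zero]
  · simp [momentFun]
  · intro T hT
    simp only [Finset.mem_erase, Finset.mem_filter, Finset.mem_powerset] at hT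
    exact absurd (Finset.Subset.antisymm hT.2.1 (by simpa using hT.2.2)) hT.1

end Cumulants

/-! ### Asymptotics of solutions of the Schwinger-Dyson equations -/

theorem splitSum_comm {A B M : Type*} [AddCommMonoid M]
    (F : List A → A → List A → List B → B → List B → M) (W : List A) (Z : List B) :
    splitSum (fun U g V => splitSum (fun U' g' V' => F U g V U' g' V') Z) W =
      splitSum (fun U' g' V' => splitSum (fun U g V => F U g V U' g' V') W) Z := by
  induction W generalizing F with
  | nil => exact (splitSum_eq_zero fun _ _ _ _ => rfl).symm
  | cons g V ih => simp only [splitSum_cons, ih, splitSum_add]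

section SchwingerDyson

open MvPolynomial

variable {L : Type*} [Mul L]

/-- The derivation which joins the word `W` at the letter `d` to another word. -/
def joinDeriv (d : L) (W : List L) :
    Derivation ℂ (MvPolynomial (List L) ℂ) (MvPolynomial (List L) ℂ) :=
  mkDerivation ℂ fun Z => splitSum (fun U g V => X (W ++ (V ++ (U ++ [g * d])))) Z

/-- The Schwinger-Dyson equations for the joint moments of traces of words in `N × N` random
matrices; the variable `X W` stands for the trace of the word `W`. -/
structure IsSchwingerDyson (N : ℕ) (ψ : L → ℂ) (e : MvPolynomial (List L) ℂ →ₗ[ℂ] ℂ) : Prop where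
  one : e 1 = 1
  nil : ∀ p, e (X [] * p) = N * e p
  cons : ∀ d W p, e (X (d :: W) * p) = ψ d * e (X W * p) +
    (N : ℂ)⁻¹ * splitSum (fun U g V => e (X (U ++ [g * d]) * X V * p)) W +
    (N : ℂ)⁻¹ * e (joinDeriv d W p)

/-- Product of the centred traces of a list of words. -/
def centeredProd (e : MvPolynomial (List L) ℂ →ₗ[ℂ] ℂ) (Zs : List (List L)) :
    MvPolynomial (List L) ℂ :=
  (Zs.map fun Z => X Z - e (X Z) • 1).prod

omit [Mul L] in
@[simp] theorem centeredProd_nil (e : MvPolynomial (List L) ℂ →ₗ[ℂ] ℂ) : centeredProd e [] = 1 :=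
  rfl

omit [Mul L] in
theorem centeredProd_cons (e : MvPolynomial (List L) ℂ →ₗ[ℂ] ℂ) (Z : List L)
    (Zs : List (List L)) :
    centeredProd e (Z :: Zs) = X Z * centeredProd e Zs - e (X Z) • centeredProd e Zs := by
  simp [centeredProd, sub_mul]

omit [Mul L] in
theorem e_X_mul_centeredProd (e : MvPolynomial (List L) ℂ →ₗ[ℂ] ℂ) (Z : List L)
    (Zs : List (List L)) : e (X Z * centeredProd e Zs) =
      e (centeredProd e (Z :: Zs)) + e (X Z) * e (centeredProd e Zs) := by
  rw [centeredProd_cons, map_sub, map_smul, smul_eq_mul, sub_add_cancel]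

omit [Mul L] in
theorem e_X_mul_X_mul_centeredProd (e : MvPolynomial (List L) ℂ →ₗ[ℂ] ℂ) (Z Z' : List L)
    (Zs : List (List L)) : e (X Z * X Z' * centeredProd e Zs) =
      e (centeredProd e (Z :: Z' :: Zs)) + e (X Z) * e (centeredProd e (Z' :: Zs)) +
        e (X Z') * e (centeredProd e (Z :: Zs)) + e (X Z) * e (X Z') * e (centeredProd e Zs) := by
  simp only [centeredProd_cons, mul_sub, map_sub, map_smul, smul_eq_mul, mul_smul_comm, smul_sub,
    mul_assoc]
  ring

theorem derivation_list_prod {A B : Type*} [CommRing A] [Algebra ℂ A] (D : Derivation ℂ A A)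
    (f : B → A) (l : List B) : D (l.map f).prod =
      splitSum (fun U b V => D (f b) * ((U ++ V).map f).prod) l := by
  induction l with
  | nil => simp
  | cons b l ih =>
    rw [List.map_cons, List.prod_cons, D.leibniz, ih, splitSum_cons, add_comm, smul_eq_mul,
      smul_eq_mul, mul_comm, mul_splitSum]
    simp [mul_left_comm]

theorem joinDeriv_centeredProd (e : MvPolynomial (List L) ℂ →ₗ[ℂ] ℂ) (d : L) (W : List L)
    (Zs : List (List L)) : joinDeriv d W (centeredProd e Zs) =
      splitSum (fun As Z Bs => splitSum (fun U g V =>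
        X (W ++ (V ++ (U ++ [g * d]))) * centeredProd e (As ++ Bs)) Z) Zs := by
  rw [centeredProd, derivation_list_prod]
  refine splitSum_congr fun As Z Bs _ => ?_
  rw [map_sub, Derivation.map_smul, Derivation.map_one_eq_zero, smul_zero, sub_zero, joinDeriv,
    mkDerivation_X, splitSum_mul]
  rfl

variable {N : ℕ} {ψ : L → ℂ} {e : MvPolynomial (List L) ℂ →ₗ[ℂ] ℂ}

theorem IsSchwingerDyson.centeredProd_nil_cons (h : IsSchwingerDyson N ψ e) (Zs : List (List L)) :
    e (centeredProd e ([] :: Zs)) = 0 := by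
  have h1 := h.nil 1
  rw [mul_one, h.one, mul_one] at h1
  rw [centeredProd_cons, map_sub, map_smul, h.nil, h1, smul_eq_mul, sub_self]

theorem IsSchwingerDyson.e_centeredProd_single (h : IsSchwingerDyson N ψ e) (Z : List L) :
    e (centeredProd e [Z]) = 0 := by
  rw [centeredProd_cons, centeredProd_nil, mul_one, map_sub, map_smul, h.one, smul_eq_mul, mul_one,
    sub_self]

theorem IsSchwingerDyson.e_X_cons (h : IsSchwingerDyson N ψ e) (d : L) (W : List L) :
    e (X (d :: W)) = ψ d * e (X W) + (N : ℂ)⁻¹ * splitSum (fun U g V =>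
      e (centeredProd e [U ++ [g * d], V]) + e (X (U ++ [g * d])) * e (X V)) W := by
  have h1 := h.cons d W 1
  rw [mul_one, mul_one, Derivation.map_one_eq_zero, map_zero, mul_zero, add_zero] at h1
  rw [h1]
  congr 2
  refine splitSum_congr fun U g V _ => ?_
  have h2 := e_X_mul_X_mul_centeredProd e (U ++ [g * d]) V []
  rw [h.e_centeredProd_single, h.e_centeredProd_single, centeredProd_nil, h.one] at h2
  rw [h2]
  ring

/-- The equation in centred variables, with terms sorted by size. A factor 1/N next to a trace mean
is a normalized trace and survives in the limit; a factor 1/N next to centred moments alone is an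
error term. -/
theorem IsSchwingerDyson.centeredProd_cons_cons (h : IsSchwingerDyson N ψ e) (d : L) (W : List L)
    (Zs : List (List L)) : e (centeredProd e ((d :: W) :: Zs)) =
      ψ d * e (centeredProd e (W :: Zs)) +
      splitSum (fun U g V => ((N : ℂ)⁻¹ * e (centeredProd e ((U ++ [g * d]) :: V :: Zs)) -
        (N : ℂ)⁻¹ * (e (centeredProd e [U ++ [g * d], V]) * e (centeredProd e Zs))) +
        ((N : ℂ)⁻¹ * e (X (U ++ [g * d])) * e (centeredProd e (V :: Zs)) +
        (N : ℂ)⁻¹ * e (X V) * e (centeredProd e ((U ++ [g * d]) :: Zs)))) W +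
      splitSum (fun As Z Bs => splitSum (fun U g V =>
        (N : ℂ)⁻¹ * e (centeredProd e ((W ++ (V ++ (U ++ [g * d]))) :: (As ++ Bs))) +
        (N : ℂ)⁻¹ * e (X (W ++ (V ++ (U ++ [g * d])))) * e (centeredProd e (As ++ Bs))) Z) Zs := by
  have h1 := h.cons d W (centeredProd e Zs)
  have h2 : (N : ℂ)⁻¹ * e (joinDeriv d W (centeredProd e Zs)) =
      splitSum (fun As Z Bs => splitSum (fun U g V =>
        (N : ℂ)⁻¹ * e (centeredProd e ((W ++ (V ++ (U ++ [g * d]))) :: (As ++ Bs))) +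
        (N : ℂ)⁻¹ * e (X (W ++ (V ++ (U ++ [g * d])))) * e (centeredProd e (As ++ Bs))) Z) Zs := by
    rw [joinDeriv_centeredProd, map_splitSum, mul_splitSum]
    refine splitSum_congr fun As Z Bs _ => ?_
    rw [map_splitSum, mul_splitSum]
    refine splitSum_congr fun U g V _ => ?_
    rw [e_X_mul_centeredProd]
    ring
  rw [h2] at h1
  rw [centeredProd_cons, map_sub, map_smul, h1, smul_eq_mul, h.e_X_cons, e_X_mul_centeredProd,
    add_sub_right_comm, add_left_inj]
  have h3 : splitSum (fun U g V => ((N : ℂ)⁻¹ * e (centeredProd e ((U ++ [g * d]) :: V :: Zs)) -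
        (N : ℂ)⁻¹ * (e (centeredProd e [U ++ [g * d], V]) * e (centeredProd e Zs))) +
        ((N : ℂ)⁻¹ * e (X (U ++ [g * d])) * e (centeredProd e (V :: Zs)) +
        (N : ℂ)⁻¹ * e (X V) * e (centeredProd e ((U ++ [g * d]) :: Zs)))) W =
      (N : ℂ)⁻¹ * splitSum (fun U g V => e (X (U ++ [g * d]) * X V * centeredProd e Zs)) W -
      (N : ℂ)⁻¹ * splitSum (fun U g V =>
        e (centeredProd e [U ++ [g * d], V]) + e (X (U ++ [g * d])) * e (X V)) W *
          e (centeredProd e Zs) := by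
    rw [eq_sub_iff_add_eq, mul_splitSum, mul_splitSum, splitSum_mul, ← splitSum_add]
    refine splitSum_congr fun U g V _ => ?_
    rw [e_X_mul_X_mul_centeredProd]
    ring
  rw [h3]
  ring

/-! ### The limit -/

/-- The joint moments of a centred Gaussian family with covariance `ρ`, with a parameter bounding
the number of factors. -/
def wickAux {B : Type*} (ρ : B → B → ℂ) : ℕ → List B → ℂ
  | 0, _ => 1
  | 1, _ => 0
  -- This value is not reached from `wick`, where the parameter is the length of the list.
  | _ + 2, [] => 1
  | n + 2, Z :: Zs => splitSum (fun As Z' Bs => ρ Z Z' * wickAux ρ n (As ++ Bs)) Zs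

/-- The joint moments of a centred Gaussian family with covariance `ρ`. -/
def wick {B : Type*} (ρ : B → B → ℂ) (Zs : List B) : ℂ := wickAux ρ Zs.length Zs

theorem wick_nil {B : Type*} (ρ : B → B → ℂ) : wick ρ [] = 1 := rfl

theorem wick_cons {B : Type*} (ρ : B → B → ℂ) (Z : B) (Zs : List B) :
    wick ρ (Z :: Zs) = splitSum (fun As Z' Bs => ρ Z Z' * wick ρ (As ++ Bs)) Zs := by
  rcases Zs with _ | ⟨Z', Zs⟩
  · rfl
  · rw [wick, List.length_cons, List.length_cons, wickAux]
    refine splitSum_congr fun As Z'' Bs h => ?_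
    have : (As ++ Bs).length = Zs.length := by
      have := congrArg List.length h
      simp at this ⊢
      omega
    rw [wick, this]

/-- The limit functionals of the Schwinger-Dyson equations. -/
structure IsLimitSchwingerDyson (ψ : L → ℂ) (φ : List L → ℂ) (ρ : List L → List L → ℂ) : Prop where
  phi_nil : φ [] = 1
  phi_cons : ∀ d W, φ (d :: W) = ψ d * φ W + splitSum (fun U g V => φ (U ++ [g * d]) * φ V) W
  rho_nil : ∀ Z, ρ [] Z = 0
  rho_cons : ∀ d W Z, ρ (d :: W) Z = ψ d * ρ W Z +
    splitSum (fun U g V => φ (U ++ [g * d]) * ρ V Z + φ V * ρ (U ++ [g * d]) Z) W +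
    splitSum (fun U g V => φ (W ++ (V ++ (U ++ [g * d])))) Z

/-- In a Wick sum the first word occurs in exactly one covariance, so the linear equation for ρ in
its first argument carries over. This is the equation for centred moments with the error terms
dropped. -/
theorem IsLimitSchwingerDyson.wick_cons_cons {φ : List L → ℂ} {ρ : List L → List L → ℂ}
    (h : IsLimitSchwingerDyson ψ φ ρ) (d : L) (W : List L) (Zs : List (List L)) :
    wick ρ ((d :: W) :: Zs) = ψ d * wick ρ (W :: Zs) +
      splitSum (fun U g V => φ (U ++ [g * d]) * wick ρ (V :: Zs) +
        φ V * wick ρ ((U ++ [g * d]) :: Zs)) W +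
      splitSum (fun As Z Bs => splitSum (fun U g V =>
        φ (W ++ (V ++ (U ++ [g * d]))) * wick ρ (As ++ Bs)) Z) Zs := by
  simp only [wick_cons]
  have h1 : splitSum (fun As Z Bs => ρ (d :: W) Z * wick ρ (As ++ Bs)) Zs =
      ψ d * splitSum (fun As Z Bs => ρ W Z * wick ρ (As ++ Bs)) Zs +
      splitSum (fun As Z Bs => splitSum (fun U g V => φ (U ++ [g * d]) * ρ V Z +
        φ V * ρ (U ++ [g * d]) Z) W * wick ρ (As ++ Bs)) Zs +
      splitSum (fun As Z Bs => splitSum (fun U g V =>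
        φ (W ++ (V ++ (U ++ [g * d]))) * wick ρ (As ++ Bs)) Z) Zs := by
    rw [mul_splitSum, ← splitSum_add, ← splitSum_add]
    refine splitSum_congr fun As Z Bs _ => ?_
    rw [h.rho_cons, add_mul, add_mul, mul_assoc, splitSum_mul _ (fun U g V =>
      φ (W ++ (V ++ (U ++ [g * d]))))]
  rw [h1]
  congr 2
  simp only [mul_splitSum, splitSum_mul, ← splitSum_add]
  rw [splitSum_comm]
  refine splitSum_congr fun U g V _ => splitSum_congr fun As Z Bs _ => ?_
  ring

variable {ψs : ℕ → L → ℂ} {es : ℕ → MvPolynomial (List L) ℂ →ₗ[ℂ] ℂ}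
  {φ : List L → ℂ} {ρ : List L → List L → ℂ}

/-- The total number of letters. -/
def totalLength (Zs : List (List L)) : ℕ := (Zs.map List.length).sum

/-- Induction on the total number of letters, simultaneously for mean traces and centred moments,
since each equation involves both quantities. Every term on the right has lost at least one letter:
`d` is removed or merged with `g`. -/
theorem tendsto_schwingerDyson (he : ∀ N, IsSchwingerDyson N (ψs N) (es N))
    (hψ : ∀ d, Tendsto (fun N => ψs N d) atTop (𝓝 (ψ d))) (h : IsLimitSchwingerDyson ψ φ ρ)
    (n : ℕ) :
    (∀ W : List L, W.length ≤ n →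
      Tendsto (fun N : ℕ => (N : ℂ)⁻¹ * es N (X W)) atTop (𝓝 (φ W))) ∧
    (∀ Zs : List (List L), totalLength Zs ≤ n →
      Tendsto (fun N : ℕ => es N (centeredProd (es N) Zs)) atTop (𝓝 (wick ρ Zs))) := by
  have hN : Tendsto (fun N : ℕ => (N : ℂ)⁻¹) atTop (𝓝 0) := tendsto_inv_atTop_nhds_zero_nat
  have A0 : Tendsto (fun N : ℕ => (N : ℂ)⁻¹ * es N (X [])) atTop (𝓝 (φ [])) := by
    rw [h.phi_nil]
    -- The normalized trace of the unit matrix is 1 only for `N ≥ 1`.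
    refine tendsto_const_nhds.congr' ?_
    filter_upwards [eventually_ge_atTop 1] with N hN
    have h1 := (he N).nil 1
    rw [mul_one, (he N).one, mul_one] at h1
    rw [h1, inv_mul_cancel₀ (by exact_mod_cast (by omega : N ≠ 0))]
  have B0 : Tendsto (fun N : ℕ => es N (centeredProd (es N) [])) atTop (𝓝 (wick ρ [])) := by
    simp only [centeredProd_nil, (he _).one, wick_nil]
    exact tendsto_const_nhds
  have B1 (Zs : List (List L)) :
      Tendsto (fun N : ℕ => es N (centeredProd (es N) ([] :: Zs))) atTop (𝓝 (wick ρ ([] :: Zs))) := by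
    have h0 : wick ρ ([] :: Zs) = 0 := by
      rw [wick_cons]
      exact splitSum_eq_zero fun As Z Bs _ => by rw [h.rho_nil, zero_mul]
    simp only [(he _).centeredProd_nil_cons, h0]
    exact tendsto_const_nhds
  induction n with
  | zero =>
    refine ⟨fun W hW => ?_, fun Zs hZ => ?_⟩
    · obtain rfl : W = [] := List.length_eq_zero_iff.mp (by omega)
      exact A0
    · rcases Zs with _ | ⟨_ | ⟨d, W⟩, Zs⟩
      · exact B0
      · exact B1 Zs
      · simp [totalLength] at hZ
  | succ n ih =>
    obtain ⟨A, B⟩ := ih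
    refine ⟨fun W hW => ?_, fun Zs hZ => ?_⟩
    · rcases W with _ | ⟨d, W⟩
      · exact A0
      have hW : W.length ≤ n := by simpa using hW
      rw [h.phi_cons]
      -- The expectation of the product of two traces is the product of the means plus a covariance;
      -- the latter stays bounded and is divided by N twice.
      have key : Tendsto (fun N : ℕ => ψs N d * ((N : ℂ)⁻¹ * es N (X W)) +
          splitSum (fun U g V => (N : ℂ)⁻¹ * ((N : ℂ)⁻¹ *
            es N (centeredProd (es N) [U ++ [g * d], V])) +
            ((N : ℂ)⁻¹ * es N (X (U ++ [g * d]))) * ((N : ℂ)⁻¹ * es N (X V))) W) atTop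
          (𝓝 (ψ d * φ W + splitSum (fun U g V => 0 * (0 * wick ρ [U ++ [g * d], V]) +
            φ (U ++ [g * d]) * φ V) W)) := by
        refine ((hψ d).mul (A W hW)).add (tendsto_splitSum fun U g V hUV => ?_)
        rw [hUV] at hW
        simp at hW
        refine (hN.mul (hN.mul (B _ ?_))).add ((A _ ?_).mul (A _ ?_))
        · simp [totalLength]; omega
        · simp; omega
        · omega
      simp only [zero_mul, zero_add] at key
      refine key.congr fun N => ?_
      rw [(he N).e_X_cons, mul_add, mul_left_comm, mul_splitSum, mul_splitSum]
      congr 1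
      refine splitSum_congr fun U g V _ => ?_
      ring
    · rcases Zs with _ | ⟨_ | ⟨d, W⟩, Zs⟩
      · exact B0
      · exact B1 Zs
      have hZ : W.length + totalLength Zs ≤ n := by
        simp [totalLength] at hZ ⊢; omega
      simp only [(he _).centeredProd_cons_cons, h.wick_cons_cons]
      refine ((((hψ d).mul (B _ ?_)).add (tendsto_splitSum fun U g V hUV => ?_)).add
        (tendsto_splitSum fun As Z Bs hAB => tendsto_splitSum fun U g V hUV => ?_))
      · simpa [totalLength] using hZ
      · rw [hUV] at hZ
        simp at hZ
        have h1 := B ((U ++ [g * d]) :: V :: Zs) (by simp [totalLength] at hZ ⊢; omega)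
        have h2 := B [U ++ [g * d], V] (by simp [totalLength]; omega)
        have h3 := B Zs (by omega)
        have h4 := B (V :: Zs) (by simp [totalLength] at hZ ⊢; omega)
        have h5 := B ((U ++ [g * d]) :: Zs) (by simp [totalLength] at hZ ⊢; omega)
        have h6 := A (U ++ [g * d]) (by simp; omega)
        have h7 := A V (by omega)
        simpa using ((hN.mul h1).sub (hN.mul (h2.mul h3))).add ((h6.mul h4).add (h7.mul h5))
      · rw [hAB, hUV] at hZ
        simp [totalLength] at hZ
        -- Joining `W` with `Z` costs one word and one letter; the centred joined trace is of order
        -- 1/N and its mean contributes `φ`.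
        have h1 := B ((W ++ (V ++ (U ++ [g * d]))) :: (As ++ Bs))
          (by simp [totalLength]; omega)
        have h2 := A (W ++ (V ++ (U ++ [g * d]))) (by simp; omega)
        have h3 := B (As ++ Bs) (by simp [totalLength]; omega)
        simpa using (hN.mul h1).add (h2.mul h3)

end SchwingerDyson

/-! ### Limits of cumulants -/

theorem splitSum_eq_sum {A M : Type*} [DecidableEq A] [AddCommMonoid M] (F : A → M) {l : List A}
    (hl : l.Nodup) : splitSum (fun _ a _ => F a) l = ∑ a ∈ l.toFinset, F a := by
  induction l with
  | nil => simp
  | cons a l ih =>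
    rw [List.nodup_cons] at hl
    rw [splitSum_cons, ih hl.2, List.toFinset_cons, Finset.sum_insert (by simpa using hl.1)]

/-- The Wick recursion pairs the element `s` with each other `t`. This is the moment-cumulant
relation for cumulants supported on pairs, so uniqueness applies. Invariance under permutations is
needed because `Finset.toList` fixes an arbitrary order. -/
theorem formalCumulant_wick {A B : Type*} [DecidableEq A] (ρ : B → B → ℂ)
    (hρ : ∀ l l' : List B, l.Perm l' → wick ρ l = wick ρ l') (Z : A → B) {S : Finset A}
    (hS : S.Nonempty) : formalCumulant (fun S => wick ρ (S.toList.map Z)) S =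
      if S.card = 2 then wick ρ (S.toList.map Z) else 0 := by
  refine formalCumulant_unique (fun S => wick ρ (S.toList.map Z))
    (fun S => if S.card = 2 then wick ρ (S.toList.map Z) else 0)
    (by simp [wick_nil]) (fun S hS => ?_) S hS
  obtain ⟨s, hs⟩ := hS
  refine ⟨s, hs, ?_⟩
  have h1 : wick ρ (S.toList.map Z) = ∑ t ∈ S.erase s,
      ρ (Z s) (Z t) * wick ρ ((S \ {s, t}).toList.map Z) := by
    have hp : S.toList.Perm (s :: (S.erase s).toList) := by
      conv_lhs => rw [← Finset.insert_erase hs]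
      exact Finset.toList_insert (Finset.notMem_erase s S)
    rw [hρ _ _ (hp.map Z), List.map_cons, wick_cons, splitSum_map,
      ← Finset.toList_toFinset (S.erase s), ← splitSum_eq_sum _ (Finset.nodup_toList _),
      Finset.toList_toFinset]
    refine splitSum_congr fun As t Bs h => ?_
    rw [← List.map_append]
    congr 1
    refine hρ _ _ (List.Perm.map Z ?_)
    have hnd : (As ++ t :: Bs).Nodup := h ▸ Finset.nodup_toList _
    have hmem (x : A) : x ∈ As ++ t :: Bs ↔ x ≠ s ∧ x ∈ S := by
      rw [← h, Finset.mem_toList, Finset.mem_erase]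
    have hnd' := List.nodup_middle.mp hnd
    rw [List.nodup_cons] at hnd'
    refine (List.perm_ext_iff_of_nodup hnd'.2 (Finset.nodup_toList _)).mpr fun x => ?_
    have := hmem x
    have ht := hnd'.1
    simp only [List.mem_append, List.mem_cons, Finset.mem_toList, Finset.mem_sdiff,
      Finset.mem_insert, Finset.mem_singleton, not_or] at this ht ⊢
    by_cases hxt : x = t
    · subst hxt; tauto
    · tauto
  -- The pairs containing `s` are the only subsets with a nonzero candidate cumulant.
  have hsub : (S.erase s).image (fun t => {s, t}) ⊆ S.powerset.filter (s ∈ ·) := by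
    intro T hT
    obtain ⟨t, ht, rfl⟩ := Finset.mem_image.mp hT
    simp [Finset.insert_subset_iff, hs, Finset.mem_of_mem_erase ht]
  rw [h1, ← Finset.sum_subset hsub, Finset.sum_image]
  · refine Finset.sum_congr rfl fun t ht => ?_
    have hst : s ≠ t := (Finset.ne_of_mem_erase ht).symm
    have hp : ({s, t} : Finset A).toList.Perm [s, t] := by
      refine (Finset.toList_insert (by simpa using hst)).trans ?_
      rw [Finset.toList_singleton]
    rw [if_pos (Finset.card_pair hst), hρ _ _ (hp.map Z)]
    simp [wick_cons, wick_nil]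
  · intro t ht t' ht' h
    have : t ∈ ({s, t'} : Finset A) := by
      rw [← show ({s, t} : Finset A) = {s, t'} from h]
      simp
    have hne := Finset.ne_of_mem_erase ht
    simpa [hne] using this
  · intro T hT hT'
    rw [if_neg, zero_mul]
    intro hc
    simp only [Finset.mem_filter, Finset.mem_powerset] at hT
    obtain ⟨t, ht⟩ := Finset.card_eq_one.mp
      (show (T.erase s).card = 1 by rw [Finset.card_erase_of_mem hT.2, hc])
    refine hT' (Finset.mem_image.mpr ⟨t, ?_, ?_⟩)
    · have : t ∈ T.erase s := by simp [ht]
      exact Finset.mem_erase.mpr ⟨Finset.ne_of_mem_erase this, hT.1 (Finset.mem_of_mem_erase this)⟩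
    · rw [← ht, Finset.insert_erase hT.2]

/-! ### Convergence of the cumulants of traces of words -/

section Limit

open MvPolynomial

variable {L : Type*} [Mul L] {ψ : L → ℂ} {ψs : ℕ → L → ℂ}
  {es : ℕ → MvPolynomial (List L) ℂ →ₗ[ℂ] ℂ} {φ : List L → ℂ} {ρ : List L → List L → ℂ}

/-- The symmetry is inherited from finite `N`: centred traces commute, and both sides are limits of
the same moments. -/
theorem wick_perm (he : ∀ N, IsSchwingerDyson N (ψs N) (es N))
    (hψ : ∀ d, Tendsto (fun N => ψs N d) atTop (𝓝 (ψ d))) (h : IsLimitSchwingerDyson ψ φ ρ)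
    {l l' : List (List L)} (hl : l.Perm l') : wick ρ l = wick ρ l' := by
  refine tendsto_nhds_unique ((tendsto_schwingerDyson he hψ h _).2 l le_rfl) ?_
  refine ((tendsto_schwingerDyson he hψ h _).2 l' le_rfl).congr fun N => ?_
  rw [centeredProd, centeredProd, (hl.map _).prod_eq]

/-- Cumulants of order at least two may be computed from centred variables, whose moments converge
to those of a Gaussian family. -/
theorem tendsto_functionalCumulant (he : ∀ N, IsSchwingerDyson N (ψs N) (es N))
    (hψ : ∀ d, Tendsto (fun N => ψs N d) atTop (𝓝 (ψ d))) (h : IsLimitSchwingerDyson ψ φ ρ)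
    {r : ℕ} (hr : 2 ≤ r) (Z : Fin r → List L) :
    Tendsto (fun N => functionalCumulant (es N) (fun j => X (Z j)) Finset.univ) atTop
      (𝓝 (if r = 2 then wick ρ ((Finset.univ : Finset (Fin r)).toList.map Z) else 0)) := by
  have h2 (i : Fin r) : (Finset.univ : Finset (Fin r)) ≠ {i} := fun h => by
    have := congrArg Finset.card h
    simp at this
    omega
  have hne : (Finset.univ : Finset (Fin r)).Nonempty := ⟨⟨0, by omega⟩, Finset.mem_univ _⟩
  have h3 := formalCumulant_wick ρ (fun _ _ => wick_perm he hψ h) Z hne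
  rw [Finset.card_univ, Fintype.card_fin] at h3
  rw [← h3]
  refine Tendsto.congr (fun N => functionalCumulant_shift (he N).one (fun j => X (Z j))
    (fun j => es N (X (Z j))) h2) ?_
  refine tendsto_formalCumulant (fun S => ?_) _
  refine ((tendsto_schwingerDyson he hψ h _).2 (S.toList.map Z) le_rfl).congr fun N => ?_
  rw [momentFun, centeredProd, List.map_map, ← Finset.prod_map_toList]
  rfl

theorem tendsto_functionalCumulant_two (he : ∀ N, IsSchwingerDyson N (ψs N) (es N))
    (hψ : ∀ d, Tendsto (fun N => ψs N d) atTop (𝓝 (ψ d))) (h : IsLimitSchwingerDyson ψ φ ρ)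
    (Z : Fin 2 → List L) :
    Tendsto (fun N => functionalCumulant (es N) (fun j => X (Z j)) Finset.univ) atTop
      (𝓝 (ρ (Z 0) (Z 1))) := by
  convert tendsto_functionalCumulant he hψ h le_rfl Z using 2
  have hp : (Finset.univ : Finset (Fin 2)).toList.Perm [0, 1] :=
    (List.perm_ext_iff_of_nodup (Finset.nodup_toList _) (by simp)).mpr fun x => by
      fin_cases x <;> simp
  rw [if_pos rfl, wick_perm he hψ h (hp.map Z)]
  simp [wick_cons, wick_nil]

theorem tendsto_functionalCumulant_zero (he : ∀ N, IsSchwingerDyson N (ψs N) (es N))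
    (hψ : ∀ d, Tendsto (fun N => ψs N d) atTop (𝓝 (ψ d))) (h : IsLimitSchwingerDyson ψ φ ρ)
    {r : ℕ} (hr : 3 ≤ r) (Z : Fin r → List L) :
    Tendsto (fun N => functionalCumulant (es N) (fun j => X (Z j)) Finset.univ) atTop (𝓝 0) := by
  simpa [show r ≠ 2 by omega] using tendsto_functionalCumulant he hψ h (by omega) Z

theorem tendsto_functionalCumulant_one (he : ∀ N, IsSchwingerDyson N (ψs N) (es N))
    (hψ : ∀ d, Tendsto (fun N => ψs N d) atTop (𝓝 (ψ d))) (h : IsLimitSchwingerDyson ψ φ ρ)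
    (Z : List L) : Tendsto (fun N : ℕ => (N : ℂ)⁻¹ * es N (X Z)) atTop (𝓝 (φ Z)) :=
  (tendsto_schwingerDyson he hψ h _).1 Z le_rfl

end Limit

/-! ### Schwinger-Dyson equations from integration by parts -/

theorem sum_splitSum {A B M : Type*} [AddCommMonoid M] (S : Finset B)
    (F : B → List A → A → List A → M) (W : List A) :
    ∑ b ∈ S, splitSum (F b) W = splitSum (fun U g V => ∑ b ∈ S, F b U g V) W := by
  induction W generalizing F with
  | nil => simp
  | cons g V ih => simp only [splitSum_cons, Finset.sum_add_distrib, ih]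

section MatrixSchwingerDyson

open MvPolynomial

variable {L : Type*} {R : Type*} [CommRing R] [Algebra ℂ R] {N : ℕ}

/-- The traces of words, as an algebra homomorphism. -/
def traceHom (P : L → Matrix (Fin N) (Fin N) R) : MvPolynomial (List L) ℂ →ₐ[ℂ] R :=
  aeval fun W => (W.map P).prod.trace

theorem traceHom_X (P : L → Matrix (Fin N) (Fin N) R) (W : List L) :
    traceHom P (X W) = (W.map P).prod.trace := aeval_X _ _

/-- Integration by parts for a family of random matrices. -/
structure IsMatrixSchwingerDyson [Mul L] (ψ : L → ℂ) (E : R →ₗ[ℂ] ℂ)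
    (P : L → Matrix (Fin N) (Fin N) R) (δ : L → Fin N → Fin N → Derivation ℂ R R) : Prop where
  one : E 1 = 1
  parts : ∀ d B, E ((P d * B).trace) = ψ d * E B.trace + E (∑ a, ∑ b, δ d a b (B b a))
  deriv : ∀ d a b g k l, δ d a b (P g k l) = if a = l then (N : ℂ)⁻¹ • P (g * d) k b else 0

theorem map_derivation_mul {n : Type*} [Fintype n] (D : Derivation ℂ R R) (A B : Matrix n n R) :
    (A * B).map D = A * B.map D + A.map D * B := by
  ext i j
  simp only [Matrix.map_apply, Matrix.mul_apply, Matrix.add_apply, map_sum, Derivation.leibniz,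
    smul_eq_mul, Finset.sum_add_distrib, add_right_inj]
  exact Finset.sum_congr rfl fun k _ => mul_comm _ _

theorem map_derivation_prod {n : Type*} [Fintype n] [DecidableEq n] (D : Derivation ℂ R R)
    (P : L → Matrix n n R) (W : List L) : (W.map P).prod.map D =
      splitSum (fun U g V => (U.map P).prod * (P g).map D * (V.map P).prod) W := by
  induction W with
  | nil =>
    ext i j
    simp [Matrix.one_apply, apply_ite D]
  | cons g V ih =>
    rw [List.map_cons, List.prod_cons, map_derivation_mul, ih, splitSum_cons, mul_splitSum,
      add_comm]
    simp [mul_assoc]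

variable [Mul L] {ψ : L → ℂ} {E : R →ₗ[ℂ] ℂ} {P : L → Matrix (Fin N) (Fin N) R}
  {δ : L → Fin N → Fin N → Derivation ℂ R R}

/-- Differentiating a letter of another trace opens that trace and inserts it into the first one,
giving a single trace. -/
theorem IsMatrixSchwingerDyson.sum_mul_deriv (h : IsMatrixSchwingerDyson ψ E P δ)
    (d g : L) (A U V : Matrix (Fin N) (Fin N) R) :
    ∑ a, ∑ b, A b a * (U * (P g).map (δ d a b) * V).trace =
      (N : ℂ)⁻¹ • (A * V * U * P (g * d)).trace := by
  have h1 (a b : Fin N) : (U * (P g).map (δ d a b) * V).trace =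
      (N : ℂ)⁻¹ • ((V * U * P (g * d)) a b) := by
    rw [Matrix.trace_mul_comm, ← mul_assoc, Matrix.mul_apply, Finset.smul_sum]
    generalize V * U = Q
    simp [Matrix.trace, Matrix.mul_apply, h.deriv]
  simp only [h1, mul_smul_comm, ← Finset.smul_sum]
  rw [show A * V * U * P (g * d) = A * (V * U * P (g * d)) by simp only [mul_assoc]]
  generalize V * U * P (g * d) = Q
  rw [Finset.sum_comm]
  simp [Matrix.trace, Matrix.mul_apply]

/-- Differentiating a letter of the same word cuts the trace into two. -/
theorem IsMatrixSchwingerDyson.sum_deriv_mat (h : IsMatrixSchwingerDyson ψ E P δ)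
    (d : L) (W : List L) : ∑ a, ∑ b, δ d a b ((W.map P).prod b a) =
      (N : ℂ)⁻¹ • splitSum (fun U g V => traceHom P (X (U ++ [g * d]) * X V)) W := by
  have h1 (a b : Fin N) : δ d a b ((W.map P).prod b a) = splitSum (fun U g V =>
      ((U.map P).prod * (P g).map (δ d a b) * (V.map P).prod) b a) W := by
    have := congrFun (congrFun (map_derivation_prod (δ d a b) P W) b) a
    rw [Matrix.map_apply] at this
    rw [this]
    exact map_splitSum (Matrix.entryAddMonoidHom R b a) _ W
  simp only [h1, sum_splitSum]
  rw [splitSum_smul]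
  refine splitSum_congr fun U g V _ => ?_
  have h4 (a b : Fin N) : ((U.map P).prod * (P g).map (δ d a b) * (V.map P).prod) b a =
      (N : ℂ)⁻¹ • (((U.map P).prod * P (g * d)) b b * (V.map P).prod a a) := by
    rw [mul_assoc, Matrix.mul_apply, Matrix.mul_apply, Finset.sum_mul, Finset.smul_sum]
    refine Finset.sum_congr rfl fun k _ => ?_
    simp [Matrix.mul_apply, h.deriv, mul_assoc]
  simp only [h4, ← Finset.smul_sum]
  rw [map_mul, traceHom_X, traceHom_X, List.map_append, List.prod_append, Matrix.trace,
    Matrix.trace, Finset.sum_mul_sum, Finset.sum_comm]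
  simp

theorem IsMatrixSchwingerDyson.chain (h : IsMatrixSchwingerDyson ψ E P δ)
    (d : L) (W : List L) (p : MvPolynomial (List L) ℂ) :
    ∑ a, ∑ b, (W.map P).prod b a * δ d a b (traceHom P p) =
      (N : ℂ)⁻¹ • traceHom P (joinDeriv d W p) := by
  induction p using MvPolynomial.induction_on with
  | C c =>
    rw [← algebraMap_eq, AlgHom.commutes, Derivation.map_algebraMap]
    simp
  | add p q hp hq =>
    simp only [map_add, mul_add, Finset.sum_add_distrib, hp, hq, smul_add]
  | mul_X p Z hp =>
    simp only [map_mul, Derivation.leibniz, smul_eq_mul, mul_add, map_add, smul_add,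
      Finset.sum_add_distrib]
    congr 1
    · have h1 (a b : Fin N) : δ d a b (traceHom P (X Z)) =
          splitSum (fun U g V =>
            ((U.map P).prod * (P g).map (δ d a b) * (V.map P).prod).trace) Z := by
        rw [traceHom_X, Matrix.trace, map_sum]
        have := congrArg Matrix.trace (map_derivation_prod (δ d a b) P Z)
        rw [Matrix.trace] at this
        simp only [Matrix.diag_apply, Matrix.map_apply] at this ⊢
        rw [this]
        exact map_splitSum (Matrix.traceAddMonoidHom (Fin N) R) _ Z
      have h2 (a b : Fin N) : (W.map P).prod b a * (traceHom P p * δ d a b (traceHom P (X Z))) =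
          splitSum (fun U g V => traceHom P p * ((W.map P).prod b a *
            ((U.map P).prod * (P g).map (δ d a b) * (V.map P).prod).trace)) Z := by
        rw [h1, mul_left_comm, mul_splitSum, mul_splitSum]
      simp only [h2, sum_splitSum]
      rw [joinDeriv, mkDerivation_X, map_splitSum, mul_splitSum, splitSum_smul]
      refine splitSum_congr fun U g V _ => ?_
      simp only [← Finset.mul_sum, h.sum_mul_deriv, traceHom_X]
      simp [mul_assoc]
    · rw [mul_comm (traceHom P (X Z)), ← smul_mul_assoc, ← hp, Finset.sum_mul]
      refine Finset.sum_congr rfl fun a _ => ?_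
      rw [Finset.sum_mul]
      refine Finset.sum_congr rfl fun b _ => ?_
      ring

/-- Integration by parts is applied to the word `W` times the traces in `p`; by the Leibniz rule the
derivative hits either the word, splitting a trace, or the other traces, joining them. -/
theorem IsMatrixSchwingerDyson.isSchwingerDyson (h : IsMatrixSchwingerDyson ψ E P δ) :
    IsSchwingerDyson N ψ (E ∘ₗ (traceHom P).toLinearMap) where
  one := by simp [h.one]
  nil p := by
    have : traceHom P (X [] * p) = (N : ℂ) • traceHom P p := by
      rw [map_mul, traceHom_X, Algebra.smul_def, map_natCast]
      simp [Matrix.trace_one]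
    simp [this]
  cons d W p := by
    have h1 := h.parts d (traceHom P p • (W.map P).prod)
    have h2 : ∑ a, ∑ b, δ d a b ((traceHom P p • (W.map P).prod) b a) =
        traceHom P p * ∑ a, ∑ b, δ d a b ((W.map P).prod b a) +
          ∑ a, ∑ b, (W.map P).prod b a * δ d a b (traceHom P p) := by
      simp only [Matrix.smul_apply, smul_eq_mul, Derivation.leibniz, Finset.mul_sum,
        Finset.sum_add_distrib]
    rw [h2, h.chain, h.sum_deriv_mat, Matrix.mul_smul, Matrix.trace_smul, Matrix.trace_smul,
      map_add] at h1
    simp only [LinearMap.comp_apply, AlgHom.toLinearMap_apply, map_mul, traceHom_X, List.map_cons,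
      List.prod_cons] at h1 ⊢
    rw [mul_comm _ (traceHom P p), mul_comm _ (traceHom P p)]
    simp only [smul_eq_mul, mul_smul_comm, map_smul, ← add_assoc] at h1
    rw [h1]
    congr 3
    rw [mul_splitSum, map_splitSum]
    refine splitSum_congr fun U g V _ => ?_
    rw [mul_comm]

end MatrixSchwingerDyson

/-! ### From words to polynomials -/

/-- Coordinates are released from `S` to its span one at a time, as in `multilinear_ext_span`. -/
theorem tendsto_multilinear_span {M : Type*} [AddCommGroup M] [Module ℂ M] {n : ℕ}
    {f : ℕ → MultilinearMap ℂ (fun _ : Fin n => M) ℂ} {g : MultilinearMap ℂ (fun _ : Fin n => M) ℂ}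
    {S : Set M} (hS : Submodule.span ℂ S = ⊤)
    (h : ∀ a, (∀ k, a k ∈ S) → Tendsto (fun N => f N a) atTop (𝓝 (g a))) (a : Fin n → M) :
    Tendsto (fun N => f N a) atTop (𝓝 (g a)) := by
  suffices H : ∀ (s : Finset (Fin n)) (a : Fin n → M), (∀ k, k ∉ s → a k ∈ S) →
      Tendsto (fun N => f N a) atTop (𝓝 (g a)) from
    H Finset.univ a fun k hk => absurd (Finset.mem_univ k) hk
  intro s
  induction s using Finset.induction_on with
  | empty => exact fun a ha' => h a fun k => ha' k (Finset.notMem_empty k)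
  | insert k s _ ih =>
    intro a ha'
    have key : ∀ x ∈ Submodule.span ℂ S, Tendsto (fun N => f N (Function.update a k x)) atTop
        (𝓝 (g (Function.update a k x))) := by
      intro x hx
      induction hx using Submodule.span_induction with
      | mem x hx =>
        refine ih _ (fun l hl => ?_)
        rcases eq_or_ne l k with rfl | hlk
        · rw [Function.update_self]; exact hx
        · rw [Function.update_of_ne hlk]
          exact ha' l (by simp [hlk, hl])
      | zero => simp
      | add x y _ _ hx hy => simpa only [MultilinearMap.map_update_add] using hx.add hy
      | smul c x _ hx => simpa only [MultilinearMap.map_update_smul] using hx.const_smul c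
    have := key (a k) (hS ▸ Submodule.mem_top)
    rwa [Function.update_eq_self] at this

/-- The matrix models have their own letters, such as words in the deterministic matrices. Only a
multiplicative map `θ` to the limiting letters is needed, as the equations use nothing but products.
-/
theorem isLimitSchwingerDyson {L L' : Type*} [Semigroup L] [Mul L'] {ψ : L → ℂ}
    (hψ : ∀ a b, ψ (a * b) = ψ (b * a)) {θ : L' → L} (hθ : ∀ a b, θ (a * b) = θ a * θ b) :
    IsLimitSchwingerDyson (fun l => ψ (θ l)) (fun W => phiWord ψ (W.map θ))
      (fun W Z => rhoWord ψ (W.map θ) (Z.map θ)) where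
  phi_nil := by simp [phiWord]
  phi_cons d W := by
    rw [List.map_cons, phiWord_cons ψ hψ, splitSum_map]
    simp [hθ]
  rho_nil Z := rhoWord_nil_left ψ _
  rho_cons d W Z := by
    rw [List.map_cons, rhoWord_cons ψ hψ, splitSum_map, splitSum_map]
    simp [hθ]

/-! ### Random variables generated by a commutative algebra -/

section Model

variable {Ω : Type*} [MeasurableSpace Ω] {P : Measure Ω} {R : Type*} [CommRing R] [Algebra ℂ R]
  {ev : R →ₐ[ℂ] (Ω → ℂ)}

/-- The expectation of algebraically generated random variables. -/
def expectation (P : Measure Ω) (ev : R →ₐ[ℂ] (Ω → ℂ)) (h : ∀ q, Integrable (ev q) P) :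
    R →ₗ[ℂ] ℂ where
  toFun q := ∫ ω, ev q ω ∂P
  map_add' p q := by
    simp only [map_add, Pi.add_apply]
    exact integral_add (h p) (h q)
  map_smul' c q := by
    simp only [map_smul, Pi.smul_apply]
    exact integral_smul c _

theorem expectation_apply (h : ∀ q, Integrable (ev q) P) (q : R) :
    expectation P ev h q = ∫ ω, ev q ω ∂P := rfl

theorem cumulant_eq_functionalCumulant (h : ∀ q, Integrable (ev q) P) {r : ℕ} (y : Fin r → R) :
    cumulant P (fun j ω => ev (y j) ω) = functionalCumulant (expectation P ev h) y Finset.univ := by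
  have h1 (b : Finset (Fin r)) : momentFun (expectation P ev h) y b =
      ∫ ω, ∏ i ∈ b, ev (y i) ω ∂P := by
    simp [momentFun, expectation_apply, map_prod]
  simp only [cumulant, functionalCumulant, formalCumulant, h1, mobiusWeight]

variable {N : ℕ} {I : Type*}

/-- The trace of a polynomial in matrices. -/
def freeTrace (B : I → Matrix (Fin N) (Fin N) R) : FreeAlgebra ℂ I →ₗ[ℂ] R :=
  Matrix.traceLinearMap (Fin N) ℂ R ∘ₗ (FreeAlgebra.lift ℂ B).toLinearMap

theorem freeTrace_freeWord {L : Type*} (B : L → Matrix (Fin N) (Fin N) R) (ℓ : I → L)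
    (W : List I) :
    freeTrace (fun i => B (ℓ i)) (freeWord W) = traceHom B (MvPolynomial.X (W.map ℓ)) := by
  simp [freeTrace, freeWord, traceHom_X, map_list_prod, Function.comp_def]

omit [MeasurableSpace Ω] in
theorem polyTr_eq (B : I → Matrix (Fin N) (Fin N) R) (p : FreeAlgebra ℂ I) (ω : Ω) :
    polyTr p (fun i => (B i).map fun q => ev q ω) = ev (freeTrace B p) ω := by
  let f : R →ₐ[ℂ] ℂ := (Pi.evalAlgHom ℂ (fun _ : Ω => ℂ) ω).comp ev
  have h1 : FreeAlgebra.lift ℂ (fun i => (B i).map fun q => ev q ω) =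
      (f.mapMatrix (m := Fin N)).comp (FreeAlgebra.lift ℂ B) := by
    ext1
    funext i
    ext k l
    simp [f]
  rw [polyTr, h1]
  simp [freeTrace, Matrix.trace, f]

/-- The cumulants of the traces as a multilinear map. -/
def traceCumulant (E : R →ₗ[ℂ] ℂ) (hE : E 1 = 1) (B : I → Matrix (Fin N) (Fin N) R) (r : ℕ) :
    MultilinearMap ℂ (fun _ : Fin r => FreeAlgebra ℂ I) ℂ :=
  MultilinearMap.mk' (fun p => functionalCumulant E (fun j => freeTrace B (p j)) Finset.univ)
    (fun p i x y => by
      have h (z : FreeAlgebra ℂ I) : (fun j => freeTrace B (Function.update p i z j)) =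
          Function.update (fun j => freeTrace B (p j)) i (freeTrace B z) :=
        funext fun j => Function.apply_update (fun _ => freeTrace B) p i z j
      simp only [h, map_add, functionalCumulant_update_add hE _ i _ _ (Finset.mem_univ i)])
    (fun p i c x => by
      have h (z : FreeAlgebra ℂ I) : (fun j => freeTrace B (Function.update p i z j)) =
          Function.update (fun j => freeTrace B (p j)) i (freeTrace B z) :=
        funext fun j => Function.apply_update (fun _ => freeTrace B) p i z j
      simp only [h, map_smul, functionalCumulant_update_smul hE _ i _ _ (Finset.mem_univ i),
        smul_eq_mul])

theorem traceCumulant_apply (E : R →ₗ[ℂ] ℂ) (hE : E 1 = 1) (B : I → Matrix (Fin N) (Fin N) R)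
    {r : ℕ} (p : Fin r → FreeAlgebra ℂ I) : traceCumulant E hE B r p =
      functionalCumulant E (fun j => freeTrace B (p j)) Finset.univ := rfl

theorem traceCumulant_freeWord {L : Type*} (E : R →ₗ[ℂ] ℂ) (hE : E 1 = 1)
    (B : L → Matrix (Fin N) (Fin N) R) (ℓ : I → L) {r : ℕ} (W : Fin r → List I) :
    traceCumulant E hE (fun i => B (ℓ i)) r (fun j => freeWord (W j)) =
      functionalCumulant (E ∘ₗ (traceHom B).toLinearMap)
        (fun j => MvPolynomial.X ((W j).map ℓ)) Finset.univ := by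
  have h1 : momentFun E (fun j => freeTrace (fun i => B (ℓ i)) (freeWord (W j))) =
      momentFun (E ∘ₗ (traceHom B).toLinearMap) (fun j => MvPolynomial.X ((W j).map ℓ)) := by
    funext S
    simp [momentFun, freeTrace_freeWord, map_prod]
  rw [traceCumulant_apply, functionalCumulant, functionalCumulant, h1]

end Model

/-- A bilinear map as a multilinear map. -/
def bilinToMultilinear {M : Type*} [AddCommGroup M] [Module ℂ M] (b : M →ₗ[ℂ] M →ₗ[ℂ] ℂ) :
    MultilinearMap ℂ (fun _ : Fin 2 => M) ℂ :=
  MultilinearMap.mk' (fun p => b (p 0) (p 1))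
    (fun p i x y => by fin_cases i <;> simp) (fun p i c x => by fin_cases i <;> simp)

/-- Random matrices which satisfy an integration by parts formula have a second order limit
distribution. -/
theorem hasSecondOrderLimit_of_parts {I L L' : Type*} [Semigroup L] [Mul L'] {ψ : L → ℂ}
    (hψ : ∀ a b, ψ (a * b) = ψ (b * a)) {θ : L' → L} (hθ : ∀ a b, θ (a * b) = θ a * θ b)
    (ℓ : I → L') {Ω : ℕ → Type*} [∀ N, MeasurableSpace (Ω N)] {P : ∀ N, Measure (Ω N)}
    {A : ∀ N, I → Ω N → Matrix (Fin N) (Fin N) ℂ}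
    {𝒜 : Type*} [Ring 𝒜] [Algebra ℂ 𝒜] {φ : 𝒜 →ₗ[ℂ] ℂ} {ρ : 𝒜 →ₗ[ℂ] 𝒜 →ₗ[ℂ] ℂ} {a : I → 𝒜}
    (space : IsSecondOrderSpace φ ρ)
    (hφ : ∀ W : List I, φ (W.map a).prod = phiWord ψ (W.map fun i => θ (ℓ i)))
    (hρ : ∀ W Z : List I, ρ (W.map a).prod (Z.map a).prod =
      rhoWord ψ (W.map fun i => θ (ℓ i)) (Z.map fun i => θ (ℓ i)))
    {R : ℕ → Type*} [∀ N, CommRing (R N)] [∀ N, Algebra ℂ (R N)]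
    (ev : ∀ N, R N →ₐ[ℂ] (Ω N → ℂ)) (hev : ∀ N q, Integrable (ev N q) (P N))
    (B : ∀ N, L' → Matrix (Fin N) (Fin N) (R N))
    (hB : ∀ N i ω, A N i ω = (B N (ℓ i)).map fun q => ev N q ω)
    {δ : ∀ N, L' → Fin N → Fin N → Derivation ℂ (R N) (R N)} {ψs : ℕ → L' → ℂ}
    (hδ : ∀ N, IsMatrixSchwingerDyson (ψs N) (expectation (P N) (ev N) (hev N)) (B N) (δ N))
    (hlim : ∀ l, Tendsto (fun N => ψs N l) atTop (𝓝 (ψ (θ l)))) :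
    HasSecondOrderLimit P A φ ρ a := by
  have hA (N : ℕ) (p : FreeAlgebra ℂ I) (ω : Ω N) :
      polyTr p (fun i => A N i ω) = ev N (freeTrace (fun i => B N (ℓ i)) p) ω := by
    simp only [hB, polyTr_eq]
  have hsd (N : ℕ) := (hδ N).isSchwingerDyson
  have hl := isLimitSchwingerDyson hψ hθ
  have hlift (W : List I) : FreeAlgebra.lift ℂ a (freeWord W) = (W.map a).prod := by
    simp [freeWord, map_list_prod, Function.comp_def]
  have hc (N r : ℕ) (p : Fin r → FreeAlgebra ℂ I) :
      cumulant (P N) (fun j ω => polyTr (p j) (fun i => A N i ω)) =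
        traceCumulant _ (hδ N).one (fun i => B N (ℓ i)) r p := by
    simp only [hA]
    rw [cumulant_eq_functionalCumulant (hev N), traceCumulant_apply]
  refine ⟨space, fun N r p => ?_, fun p => ?_, fun p => ?_, fun r hr p => ?_⟩
  · simp only [hA]
    have := hev N (∏ j, freeTrace (fun i => B N (ℓ i)) (p j))
    rw [map_prod] at this
    convert this using 1
    funext ω
    simp
  · have h1 (N : ℕ) : cumulant (P N) (fun (_ : Fin 1) ω => (N : ℂ)⁻¹ *
        polyTr p (fun i => A N i ω)) = (N : ℂ)⁻¹ * expectation (P N) (ev N) (hev N)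
          (freeTrace (fun i => B N (ℓ i)) p) := by
      have h2 : (fun (_ : Fin 1) ω => (N : ℂ)⁻¹ * polyTr p (fun i => A N i ω)) =
          fun _ ω => ev N ((N : ℂ)⁻¹ • freeTrace (fun i => B N (ℓ i)) p) ω := by
        funext _ ω
        rw [hA, map_smul, Pi.smul_apply, smul_eq_mul]
      rw [h2, cumulant_eq_functionalCumulant (hev N)]
      rw [show (Finset.univ : Finset (Fin 1)) = {0} from rfl,
        functionalCumulant_singleton (hδ N).one, map_smul, smul_eq_mul]
    simp only [h1]
    clear h1
    -- Both sides are linear in `p`, so it suffices to treat words.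
    have hp : p ∈ Submodule.span ℂ (Set.range (freeWord (L := I))) :=
      span_freeWord (L := I) ▸ Submodule.mem_top
    induction hp using Submodule.span_induction with
    | mem x hx =>
      obtain ⟨W, rfl⟩ := hx
      rw [hlift, hφ]
      have := tendsto_functionalCumulant_one hsd hlim hl (W.map ℓ)
      simp only [List.map_map] at this
      refine this.congr fun N => ?_
      rw [freeTrace_freeWord]
      rfl
    | zero => simp
    | add x y _ _ hx hy => simpa only [map_add, mul_add] using hx.add hy
    | smul c x _ hx => simpa only [map_smul, mul_smul_comm] using hx.const_smul c
  · simp only [hc]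
    let b := (ρ.compl₁₂ (FreeAlgebra.lift ℂ a).toLinearMap (FreeAlgebra.lift ℂ a).toLinearMap)
    refine tendsto_multilinear_span (g := bilinToMultilinear b) span_freeWord (fun p hp => ?_) p
    choose W hW using hp
    obtain rfl := funext hW
    have := tendsto_functionalCumulant_two hsd hlim hl (fun j => (W j).map ℓ)
    simp only [traceCumulant_freeWord]
    convert this using 2
    simp [bilinToMultilinear, b, hlift, hρ, Function.comp_def]
  · simp only [hc]
    refine tendsto_multilinear_span (g := 0) span_freeWord (fun p hp => ?_) p
    choose W hW using hp
    obtain rfl := funext hW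
    simp only [traceCumulant_freeWord]
    exact tendsto_functionalCumulant_zero hsd hlim hl hr (fun j => (W j).map ℓ)

/-! ### Gaussian integration by parts -/

theorem hasDerivAt_gaussianPDFReal (v : ℝ≥0) (x : ℝ) :
    HasDerivAt (gaussianPDFReal 0 v) (-(x / v) * gaussianPDFReal 0 v x) x := by
  have h1 : HasDerivAt (fun x : ℝ => -(x - 0) ^ 2 / (2 * (v : ℝ))) (-(x / v)) x := by
    refine ((((hasDerivAt_id' x).sub_const (0 : ℝ)).fun_pow 2).fun_neg.div_const
      (2 * (v : ℝ))).congr_deriv ?_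
    rcases eq_or_ne (v : ℝ) 0 with hv | hv
    · simp [hv]
    · simp; field_simp
  rw [gaussianPDFReal_def]
  exact ((h1.exp).const_mul (√(2 * Real.pi * v))⁻¹).congr_deriv (by ring)

theorem integrable_pow_gaussianReal (v : ℝ≥0) (k : ℕ) :
    Integrable (fun x : ℝ => x ^ k) (gaussianReal 0 v) := by
  have := (memLp_id_gaussianReal (μ := 0) (v := v) (k : ℝ≥0)).integrable_norm_pow'
  refine this.mono (by fun_prop) (Eventually.of_forall fun x => ?_)
  simp

theorem integrable_pow_mul_gaussianPDFReal {v : ℝ≥0} (hv : v ≠ 0) (k : ℕ) :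
    Integrable (fun x : ℝ => x ^ k * gaussianPDFReal 0 v x) := by
  have h := integrable_pow_gaussianReal v k
  rw [gaussianReal_of_var_ne_zero _ hv, integrable_withDensity_iff_integrable_smul'
    (measurable_gaussianPDF _ _) (ae_of_all _ fun _ => gaussianPDF_lt_top)] at h
  refine h.congr (Eventually.of_forall fun x => ?_)
  simp only [toReal_gaussianPDF, smul_eq_mul, mul_comm]

/-- Integration by parts against the density, whose derivative is `-(x / v)` times itself. The
truncated exponent `k - 1` at `k = 0` is harmless because of the factor `k`. -/
theorem integral_pow_gaussianReal (v : ℝ≥0) (k : ℕ) :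
    ∫ x, x ^ (k + 1) ∂gaussianReal 0 v = v * (k * ∫ x, x ^ (k - 1) ∂gaussianReal 0 v) := by
  rcases eq_or_ne v 0 with rfl | hv
  · simp
  have hv' : (v : ℝ) ≠ 0 := by exact_mod_cast hv
  have h := integral_mul_deriv_eq_deriv_mul_of_integrable (u := fun x : ℝ => x ^ k)
    (u' := fun x => k * x ^ (k - 1)) (v := gaussianPDFReal 0 v)
    (v' := fun x => -(x / v) * gaussianPDFReal 0 v x)
    (fun x _ => hasDerivAt_pow k x) (fun x _ => hasDerivAt_gaussianPDFReal v x)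
    (by
      refine ((integrable_pow_mul_gaussianPDFReal hv (k + 1)).const_mul (-(v : ℝ)⁻¹)).congr
        (Eventually.of_forall fun x => ?_)
      simp only [Pi.mul_apply]
      ring)
    (by
      refine ((integrable_pow_mul_gaussianPDFReal hv (k - 1)).const_mul (k : ℝ)).congr
        (Eventually.of_forall fun x => ?_)
      simp only [Pi.mul_apply]
      ring)
    (integrable_pow_mul_gaussianPDFReal hv k)
  rw [integral_gaussianReal_eq_integral_smul hv, integral_gaussianReal_eq_integral_smul hv]
  have h1 : ∫ x, x ^ k * (-(x / v) * gaussianPDFReal 0 v x) =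
      -(v : ℝ)⁻¹ * ∫ x, gaussianPDFReal 0 v x • x ^ (k + 1) := by
    rw [← integral_const_mul]
    congr 1
    funext x
    simp only [smul_eq_mul]
    ring
  have h2 : ∫ x, k * x ^ (k - 1) * gaussianPDFReal 0 v x =
      k * ∫ x, gaussianPDFReal 0 v x • x ^ (k - 1) := by
    rw [← integral_const_mul]
    congr 1
    funext x
    simp only [smul_eq_mul]
    ring
  rw [h1, h2] at h
  rw [neg_mul, neg_inj] at h
  rw [← h, mul_inv_cancel_left₀ hv']

/-! ### Random variables with all moments -/

section Moments

variable {Ω : Type*} [MeasurableSpace Ω] {P : Measure Ω} [IsProbabilityMeasure P]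

/-- All moments of the random variable exist. -/
def HasMoments (P : Measure Ω) (f : Ω → ℂ) : Prop := ∀ p : ENNReal, p ≠ ⊤ → MemLp f p P

omit [IsProbabilityMeasure P] in
theorem HasMoments.integrable {f : Ω → ℂ} (hf : HasMoments P f) : Integrable f P :=
  memLp_one_iff_integrable.mp (hf 1 (by simp))

theorem hasMoments_const (c : ℂ) : HasMoments P fun _ => c := fun _ _ => memLp_const c

omit [IsProbabilityMeasure P] in
theorem HasMoments.add {f g : Ω → ℂ} (hf : HasMoments P f) (hg : HasMoments P g) :
    HasMoments P (f + g) := fun p hp => (hf p hp).add (hg p hp)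

omit [IsProbabilityMeasure P] in
-- Hölder's inequality with exponents `2 * p`; asking for every finite exponent makes the condition
-- stable under products.
theorem HasMoments.mul {f g : Ω → ℂ} (hf : HasMoments P f) (hg : HasMoments P g) :
    HasMoments P (f * g) := fun p hp => by
  have : ENNReal.HolderTriple (2 * p) (2 * p) p := ⟨by
    rw [ENNReal.mul_inv (by simp) (by simp), ← add_mul, ENNReal.inv_two_add_inv_two, one_mul]⟩
  have h2 : 2 * p ≠ ⊤ := ENNReal.mul_ne_top (by simp) hp
  exact (hg _ h2).mul (hf _ h2)

theorem HasMoments.aeval {V : Type*} {Y : V → Ω → ℂ} (hY : ∀ a, HasMoments P (Y a))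
    (q : MvPolynomial V ℂ) : HasMoments P (MvPolynomial.aeval Y q) := by
  induction q using MvPolynomial.induction_on with
  | C c =>
    rw [← MvPolynomial.algebraMap_eq, AlgHom.commutes]
    exact hasMoments_const c
  | add p q hp hq => rw [map_add]; exact hp.add hq
  | mul_X p a hp => rw [map_mul, MvPolynomial.aeval_X]; exact hp.mul (hY a)

omit [IsProbabilityMeasure P] in
theorem hasMoments_gaussian {f : Ω → ℝ} (hf : HasGaussianLaw f P) :
    HasMoments P fun ω => (f ω : ℂ) := fun _ hp => (hf.memLp hp).ofReal

end Moments

/-! ### Integration by parts for Gaussian processes -/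

section GaussianProcess

variable {Ω : Type*} [MeasurableSpace Ω] {P : Measure Ω} {S : Type*} {g : S → Ω → ℝ}

/-- A process, as complex valued random variables. -/
def cproc (g : S → Ω → ℝ) (s : S) (ω : Ω) : ℂ := g s ω

theorem IsGaussianProcess.hasMoments_aeval (hg : IsGaussianProcess g P)
    (q : MvPolynomial S ℂ) : HasMoments P (MvPolynomial.aeval (cproc g) q) := by
  have := hg.isProbabilityMeasure
  exact HasMoments.aeval (fun s => hasMoments_gaussian (hg.hasGaussianLaw_eval s)) q

theorem measurable_aeval (q : MvPolynomial S ℂ) :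
    Measurable fun x : S → ℝ => MvPolynomial.aeval (fun s => (x s : ℂ)) q := by
  induction q using MvPolynomial.induction_on with
  | C c => simp
  | add p q hp hq => simpa using! hp.add hq
  | mul_X p a hp => simpa using! hp.mul (by fun_prop)

omit [MeasurableSpace Ω] in
theorem aeval_cproc_apply {V : Type*} (Y : V → Ω → ℂ) (q : MvPolynomial V ℂ) (ω : Ω) :
    MvPolynomial.aeval Y q ω = MvPolynomial.aeval (fun s => Y s ω) q := by
  have : (Pi.evalAlgHom ℂ (fun _ : Ω => ℂ) ω).comp (MvPolynomial.aeval Y) =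
      MvPolynomial.aeval (fun s => Y s ω) := by
    ext i
    simp
  exact DFunLike.congr_fun this q

/-- The part of the process which is independent of its value at `s`. -/
def residual (P : Measure Ω) (g : S → Ω → ℝ) (s u : S) (ω : Ω) : ℝ :=
  g u ω - (∫ ω, g s ω * g u ω ∂P) / (∫ ω, g s ω * g s ω ∂P) * g s ω

theorem isGaussianProcess_residual (hg : IsGaussianProcess g P) (s : S) :
    IsGaussianProcess (Sum.elim (fun _ : Unit => g s) (residual P g s)) P := by
  classical
  refine hg.of_isGaussianProcess fun t => ?_
  rcases t with _ | u
  · exact ⟨{s}, ContinuousLinearMap.proj ⟨s, by simp⟩, fun ω => by simp⟩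
  · refine ⟨{u, s}, ContinuousLinearMap.proj ⟨u, by simp⟩ -
      ((∫ ω, g s ω * g u ω ∂P) / (∫ ω, g s ω * g s ω ∂P)) •
        ContinuousLinearMap.proj ⟨s, by simp⟩, fun ω => by simp [residual]⟩

/-- The residual is the part of the process orthogonal to `g s`, and uncorrelated jointly Gaussian
variables are independent. -/
theorem indepFun_residual (hg : IsGaussianProcess g P) (hc : ∀ s, ∫ ω, g s ω ∂P = 0) (s : S)
    (hs : ∫ ω, g s ω * g s ω ∂P ≠ 0) :
    IndepFun (fun ω (_ : Unit) => g s ω) (fun ω u => residual P g s u ω) P := by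
  have := hg.isProbabilityMeasure
  have hr := isGaussianProcess_residual hg s
  have hL (u : S) : MemLp (g u) 2 P := (hg.hasGaussianLaw_eval u).memLp_two
  have hi (u v : S) : Integrable (fun ω => g u ω * g v ω) P := (hL u).integrable_mul (hL v)
  have hi1 (u : S) : Integrable (g u) P := (hg.hasGaussianLaw_eval u).integrable
  refine IsGaussianProcess.indepFun_of_covariance_eq_zero hr (fun _ => hg.aemeasurable s)
    (fun u => hr.aemeasurable (Sum.inr u)) fun _ u => ?_
  have hLu : MemLp (residual P g s u) 2 P := (hr.hasGaussianLaw_eval (Sum.inr u)).memLp_two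
  rw [covariance_eq_sub (hL s) hLu, hc s, zero_mul, sub_zero]
  have h1 : (g s * residual P g s u) = fun ω => g s ω * g u ω -
      (∫ ω, g s ω * g u ω ∂P) / (∫ ω, g s ω * g s ω ∂P) * (g s ω * g s ω) := by
    funext ω
    simp only [Pi.mul_apply, residual]
    ring
  rw [h1, integral_sub (hi s u) ((hi s s).const_mul _), integral_const_mul, div_mul_cancel₀ _ hs,
    sub_self]

theorem integral_pow_gaussian (hg : IsGaussianProcess g P) (hc : ∀ s, ∫ ω, g s ω ∂P = 0) (s : S)
    (k : ℕ) : ∫ ω, (g s ω : ℂ) ^ (k + 1) ∂P =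
      ((∫ ω, g s ω * g s ω ∂P : ℝ) : ℂ) * (k * ∫ ω, (g s ω : ℂ) ^ (k - 1) ∂P) := by
  have := hg.isProbabilityMeasure
  have hl := hg.hasGaussianLaw_eval s
  have hm := hl.map_eq_gaussianReal
  have hv : (Var[g s; P].toNNReal : ℝ) = ∫ ω, g s ω * g s ω ∂P := by
    rw [Real.coe_toNNReal _ (variance_nonneg _ _), variance_of_integral_eq_zero hl.aemeasurable (hc s)]
    congr 1
    funext ω
    exact pow_two _
  have key (n : ℕ) : ∫ ω, (g s ω : ℂ) ^ n ∂P =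
      ((∫ x, x ^ n ∂gaussianReal 0 (Var[g s; P].toNNReal) : ℝ) : ℂ) := by
    rw [hc s] at hm
    rw [← hm, integral_map hl.aemeasurable (by fun_prop), ← integral_complex_ofReal]
    simp
  rw [key, key, integral_pow_gaussianReal, ← hv]
  push_cast
  rfl

open MvPolynomial in
/-- Evaluation of the polynomials in the value at `s` with coefficients which are polynomials in
the residuals. -/
def residualEval (P : Measure Ω) (g : S → Ω → ℝ) (s : S) :
    Polynomial (MvPolynomial S ℂ) →+* (Ω → ℂ) :=
  Polynomial.eval₂RingHom (aeval (cproc (residual P g s))).toRingHom (cproc g s)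

open MvPolynomial in
theorem residualEval_monomial (P : Measure Ω) (g : S → Ω → ℝ) (s : S) (n : ℕ)
    (a : MvPolynomial S ℂ) : residualEval P g s (Polynomial.monomial n a) =
      aeval (cproc (residual P g s)) a * cproc g s ^ n := by
  simp [residualEval]

theorem integral_residualEval_monomial (hg : IsGaussianProcess g P)
    (hc : ∀ s, ∫ ω, g s ω ∂P = 0) (s : S) (hs : ∫ ω, g s ω * g s ω ∂P ≠ 0) (n : ℕ)
    (a : MvPolynomial S ℂ) : ∫ ω, residualEval P g s (Polynomial.monomial n a) ω ∂P =
      (∫ ω, MvPolynomial.aeval (cproc (residual P g s)) a ω ∂P) * ∫ ω, (g s ω : ℂ) ^ n ∂P := by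
  have hr := (isGaussianProcess_residual hg s).comp_right Sum.inr
  have h1 := (indepFun_residual hg hc s hs).symm.comp (measurable_aeval a)
    (show Measurable fun x : Unit → ℝ => (x () : ℂ) ^ n by fun_prop)
  have h2 := h1.integral_mul_eq_mul_integral (𝕜 := ℂ)
    (by
      convert (IsGaussianProcess.hasMoments_aeval hr a).integrable.aestronglyMeasurable using 1
      funext ω
      rw [aeval_cproc_apply]
      rfl)
    (by
      convert (IsGaussianProcess.hasMoments_aeval hg
        (MvPolynomial.X s ^ n)).integrable.aestronglyMeasurable using 1
      funext ω
      simp [cproc])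
  rw [residualEval_monomial, show MvPolynomial.aeval (cproc (residual P g s)) a =
    (fun x : S → ℝ => MvPolynomial.aeval (fun s => (x s : ℂ)) a) ∘ fun ω u => residual P g s u ω
    from funext (aeval_cproc_apply _ a)]
  exact h2

theorem hasMoments_residualEval (hg : IsGaussianProcess g P) (s : S)
    (p : Polynomial (MvPolynomial S ℂ)) : HasMoments P (residualEval P g s p) := by
  have hr := (isGaussianProcess_residual hg s).comp_right Sum.inr
  induction p using Polynomial.induction_on' with
  | add p q hp hq => rw [map_add]; exact hp.add hq
  | monomial n a =>
    rw [residualEval_monomial]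
    refine (IsGaussianProcess.hasMoments_aeval hr a).mul ?_
    have := IsGaussianProcess.hasMoments_aeval hg (MvPolynomial.X s ^ n)
    rwa [map_pow, MvPolynomial.aeval_X] at this

/-- By independence the coefficients factor out of the expectation, and the one-variable recursion
for Gaussian moments remains. -/
theorem integral_residualEval (hg : IsGaussianProcess g P)
    (hc : ∀ s, ∫ ω, g s ω ∂P = 0) (s : S) (hs : ∫ ω, g s ω * g s ω ∂P ≠ 0)
    (p : Polynomial (MvPolynomial S ℂ)) : ∫ ω, residualEval P g s (Polynomial.X * p) ω ∂P =
      ((∫ ω, g s ω * g s ω ∂P : ℝ) : ℂ) * ∫ ω, residualEval P g s p.derivative ω ∂P := by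
  induction p using Polynomial.induction_on' with
  | add p q hp hq =>
    have h (p : Polynomial (MvPolynomial S ℂ)) := (hasMoments_residualEval hg s p).integrable
    simp only [mul_add, map_add, Pi.add_apply]
    rw [integral_add (h _) (h _), integral_add (h _) (h _), hp, hq, mul_add]
  | monomial n a =>
    rw [Polynomial.X_mul_monomial, Polynomial.derivative_monomial,
      integral_residualEval_monomial hg hc s hs, integral_residualEval_monomial hg hc s hs,
      integral_pow_gaussian hg hc]
    have : ∫ ω, MvPolynomial.aeval (cproc (residual P g s)) (a * (n : MvPolynomial S ℂ)) ω ∂P =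
        (∫ ω, MvPolynomial.aeval (cproc (residual P g s)) a ω ∂P) * n := by
      rw [← integral_mul_const]
      simp
    rw [this]
    ring

-- Each `g u` is split into its independent residual and a multiple of `g s`. A polynomial in the
-- process becomes a polynomial in `g s` with independent coefficients, and one-variable integration
-- by parts applies.
open MvPolynomial in
theorem gaussian_integration_by_parts (hg : IsGaussianProcess g P) (hc : ∀ s, ∫ ω, g s ω ∂P = 0)
    (s : S) (q : MvPolynomial S ℂ) :
    ∫ ω, aeval (cproc g) (X s * q) ω ∂P = ∫ ω, aeval (cproc g)
      (mkDerivation ℂ (fun u => C ((∫ ω, g s ω * g u ω ∂P : ℝ) : ℂ)) q) ω ∂P := by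
  have := hg.isProbabilityMeasure
  have hL (u : S) : MemLp (g u) 2 P := (hg.hasGaussianLaw_eval u).memLp_two
  set σ := ∫ ω, g s ω * g s ω ∂P with hσ
  -- If `g s` has variance zero it vanishes almost surely, and so do all its covariances; both sides
  -- are zero.
  by_cases hs : σ = 0
  · have h0 : g s =ᵐ[P] 0 := by
      have h1 := (integral_eq_zero_iff_of_nonneg (fun ω => mul_self_nonneg (g s ω))
        ((hL s).integrable_mul (hL s))).mp hs
      filter_upwards [h1] with ω hω
      exact mul_self_eq_zero.mp hω
    have h1 (u : S) : ∫ ω, g s ω * g u ω ∂P = 0 := by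
      rw [integral_eq_zero_of_ae]
      filter_upwards [h0] with ω hω
      simp [hω]
    have h2 : mkDerivation ℂ (fun u => C (σ := S) ((∫ ω, g s ω * g u ω ∂P : ℝ) : ℂ)) = 0 := by
      ext u
      simp [h1]
    rw [h2, integral_eq_zero_of_ae]
    · simp
    · filter_upwards [h0] with ω hω
      simp [cproc, hω]
  let Φ : MvPolynomial S ℂ →ₐ[ℂ] Polynomial (MvPolynomial S ℂ) := aeval fun u =>
    Polynomial.C (X u) + Polynomial.C (C (((∫ ω, g s ω * g u ω ∂P) / σ : ℝ) : ℂ)) * Polynomial.X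
  have hΦ (q : MvPolynomial S ℂ) : residualEval P g s (Φ q) = aeval (cproc g) q := by
    induction q using MvPolynomial.induction_on with
    | C c => simp [Φ, residualEval, ← algebraMap_eq, Polynomial.algebraMap_apply]
    | add p q hp hq => rw [map_add, map_add, hp, hq, map_add]
    | mul_X p u hp =>
      rw [map_mul, map_mul, hp, map_mul, aeval_X]
      congr 1
      funext ω
      simp [residualEval, cproc, residual, aeval_cproc_apply, ← hσ]
  -- Differentiating in `g s` and multiplying by its variance restores the covariances, by the chain
  -- rule for `g u = residual + (cov / σ) g s`.
  have hder (q : MvPolynomial S ℂ) : (Φ q).derivative * Polynomial.C (C (σ : ℂ)) =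
      Φ (mkDerivation ℂ (fun u => C ((∫ ω, g s ω * g u ω ∂P : ℝ) : ℂ)) q) := by
    induction q using MvPolynomial.induction_on with
    | C c =>
      rw [← algebraMap_eq, AlgHom.commutes, Derivation.map_algebraMap, map_zero,
        Polynomial.algebraMap_apply, Polynomial.derivative_C, zero_mul]
    | add p q hp hq => rw [map_add, map_add, map_add, map_add, add_mul, hp, hq]
    | mul_X p u hp =>
      rw [map_mul, Polynomial.derivative_mul, add_mul, mul_right_comm, hp, Derivation.leibniz,
        mkDerivation_X, map_add, add_comm]
      have h1 : (Φ (X u)).derivative * Polynomial.C (C (σ : ℂ)) =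
          Φ (C ((∫ ω, g s ω * g u ω ∂P : ℝ) : ℂ)) := by
        have h2 : Φ (C ((∫ ω, g s ω * g u ω ∂P : ℝ) : ℂ)) =
            Polynomial.C (C ((∫ ω, g s ω * g u ω ∂P : ℝ) : ℂ)) := by
          rw [← algebraMap_eq, AlgHom.commutes, Polynomial.algebraMap_apply]
        rw [h2]
        simp only [Φ, aeval_X, Polynomial.derivative_add, Polynomial.derivative_C, zero_add,
          Polynomial.derivative_C_mul, Polynomial.derivative_X, mul_one, ← map_mul,
          ← Complex.ofReal_mul, div_mul_cancel₀ _ hs]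
      rw [smul_eq_mul, smul_eq_mul, map_mul, map_mul, mul_assoc, h1, mul_comm (Φ (X u))]
  have h1 : aeval (cproc g) (X s * q) = residualEval P g s (Polynomial.X * Φ q) := by
    rw [map_mul, map_mul, hΦ, aeval_X]
    simp [residualEval]
  rw [h1, integral_residualEval hg hc s hs, ← hΦ, ← hder, map_mul, ← integral_const_mul]
  congr 1
  funext ω
  simp only [Polynomial.coe_eval₂RingHom, residualEval, Polynomial.eval₂_C, Pi.mul_apply]
  rw [mul_comm]
  simp [← hσ]

/-! ### Complex linear combinations of a real Gaussian process -/

section Complex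

open MvPolynomial

variable {V : Type*} {Y : V → Ω → ℂ} {r r' : V → S} {z : V → ℂ}

/-- Complex Gaussian variables expressed by the underlying real ones. -/
def realForm (r r' : V → S) (z : V → ℂ) : MvPolynomial V ℂ →ₐ[ℂ] MvPolynomial S ℂ :=
  aeval fun a => X (r a) + C (z a) * X (r' a)

omit [MeasurableSpace Ω] in
theorem aeval_realForm (hY : ∀ a ω, Y a ω = g (r a) ω + z a * g (r' a) ω) (q : MvPolynomial V ℂ) :
    aeval (cproc g) (realForm r r' z q) = aeval Y q := by
  have : (aeval (cproc g)).comp (realForm r r' z) = aeval Y := by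
    ext a
    simp [realForm, hY, cproc, aeval_cproc_apply]
  exact DFunLike.congr_fun this q

theorem hasMoments_aeval_complex (hg : IsGaussianProcess g P)
    (hY : ∀ a ω, Y a ω = g (r a) ω + z a * g (r' a) ω) (q : MvPolynomial V ℂ) :
    HasMoments P (aeval Y q) := by
  rw [← aeval_realForm hY]
  exact IsGaussianProcess.hasMoments_aeval hg _

theorem integral_complex_gaussian (hg : IsGaussianProcess g P)
    (hY : ∀ a ω, Y a ω = g (r a) ω + z a * g (r' a) ω) (a b : V) :
    ∫ ω, Y a ω * Y b ω ∂P =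
      (((∫ ω, g (r a) ω * g (r b) ω ∂P : ℝ) : ℂ) + z b * (∫ ω, g (r a) ω * g (r' b) ω ∂P : ℝ)) +
      z a * (((∫ ω, g (r' a) ω * g (r b) ω ∂P : ℝ) : ℂ) +
        z b * (∫ ω, g (r' a) ω * g (r' b) ω ∂P : ℝ)) := by
  have hi (q : MvPolynomial S ℂ) : Integrable (fun ω => aeval (cproc g) q ω) P :=
    (IsGaussianProcess.hasMoments_aeval hg q).integrable
  have hi2 (s u : S) : Integrable (fun ω => ((g s ω * g u ω : ℝ) : ℂ)) P := by
    refine (hi (X s * X u)).congr (Eventually.of_forall fun ω => ?_)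
    simp [cproc]
  have lin (f f' : Ω → ℂ) (hf : Integrable f P) (hf' : Integrable f' P) (c : ℂ) :
      ∫ ω, (f ω + c * f' ω) ∂P = (∫ ω, f ω ∂P) + c * ∫ ω, f' ω ∂P := by
    rw [← integral_const_mul, ← integral_add hf (hf'.const_mul c)]
  simp only [← integral_complex_ofReal]
  rw [← lin _ _ (hi2 _ _) (hi2 _ _), ← lin _ _ (hi2 _ _) (hi2 _ _)]
  refine Eq.trans ?_ (lin _ _ ?_ ?_ _)
  rotate_left
  · exact (hi2 _ _).add ((hi2 _ _).const_mul _)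
  · exact (hi2 _ _).add ((hi2 _ _).const_mul _)
  congr 1
  funext ω
  rw [hY, hY]
  push_cast
  ring

/-- Real integration by parts is complex linear in the distinguished variable. The relevant
covariance is the bilinear one, without conjugation. -/
theorem complex_gaussian_integration_by_parts (hg : IsGaussianProcess g P)
    (hc : ∀ s, ∫ ω, g s ω ∂P = 0) (hY : ∀ a ω, Y a ω = g (r a) ω + z a * g (r' a) ω)
    (a : V) (q : MvPolynomial V ℂ) : ∫ ω, aeval Y (X a * q) ω ∂P =
      ∫ ω, aeval Y (mkDerivation ℂ (fun b => C (∫ ω, Y a ω * Y b ω ∂P)) q) ω ∂P := by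
  let D (s : S) : Derivation ℂ (MvPolynomial S ℂ) (MvPolynomial S ℂ) :=
    mkDerivation ℂ fun u => C ((∫ ω, g s ω * g u ω ∂P : ℝ) : ℂ)
  have hi (q : MvPolynomial S ℂ) : Integrable (fun ω => aeval (cproc g) q ω) P :=
    (IsGaussianProcess.hasMoments_aeval hg q).integrable
  have hD (q : MvPolynomial V ℂ) :
      realForm r r' z (mkDerivation ℂ (fun b => C (∫ ω, Y a ω * Y b ω ∂P)) q) =
        D (r a) (realForm r r' z q) + C (z a) * D (r' a) (realForm r r' z q) := by
    induction q using MvPolynomial.induction_on with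
    | C c => simp [← algebraMap_eq]
    | add p q hp hq =>
      simp only [map_add, hp, hq]
      ring
    | mul_X p b hp =>
      have hb : realForm r r' z (X b) = X (r b) + C (z b) * X (r' b) := aeval_X _ _
      have hCz (c : ℂ) : realForm r r' z (C c) = C c := by
        rw [← algebraMap_eq, AlgHom.commutes, algebraMap_eq]
      have hDX (s : S) : D s (X (r b) + C (z b) * X (r' b)) =
          C ((∫ ω, g s ω * g (r b) ω ∂P : ℝ) : ℂ) +
            C (z b) * C ((∫ ω, g s ω * g (r' b) ω ∂P : ℝ) : ℂ) := by
        rw [map_add, C_mul', Derivation.map_smul, mkDerivation_X, mkDerivation_X, ← C_mul']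
      simp only [Derivation.leibniz, map_mul, map_add, smul_eq_mul, mkDerivation_X, hp, hb, hDX]
      rw [integral_complex_gaussian hg hY a b]
      simp only [map_add, map_mul, hCz]
      ring
  rw [← aeval_realForm hY, ← aeval_realForm hY, hD, map_mul]
  have h1 : realForm r r' z (X a) * realForm r r' z q =
      X (r a) * realForm r r' z q + C (z a) * (X (r' a) * realForm r r' z q) := by
    rw [realForm, aeval_X]
    ring
  have h2 (p p' : MvPolynomial S ℂ) : ∫ ω, aeval (cproc g) (p + C (z a) * p') ω ∂P =
      (∫ ω, aeval (cproc g) p ω ∂P) + z a * ∫ ω, aeval (cproc g) p' ω ∂P := by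
    rw [← integral_const_mul, ← integral_add (hi _) ((hi _).const_mul _)]
    simp [aeval_cproc_apply]
  rw [h1, h2, h2, gaussian_integration_by_parts hg hc, gaussian_integration_by_parts hg hc]

end Complex

end GaussianProcess

/-! ### Hermitian Gaussian random matrices -/

section Hermitian

variable {E : Type u} [NormedAddCommGroup E] [InnerProductSpace ℝ E]
  {Ω : Type*} [MeasurableSpace Ω] {P : Measure Ω} {N : ℕ} {X : E → Ω → Matrix (Fin N) (Fin N) ℂ}

theorem IsHermitianGaussianFamily.integrable (h : IsHermitianGaussianFamily P X) (f : E)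
    (i j : Fin N) : Integrable (fun ω => X f ω i j) P := by
  have h1 := (h.gaussian.hasGaussianLaw_eval (f, i, j, true)).integrable
  have h2 := (h.gaussian.hasGaussianLaw_eval (f, i, j, false)).integrable
  simp only [if_true, Bool.false_eq_true, if_false] at h1 h2
  refine (h1.ofReal.add (h2.ofReal.const_mul Complex.I)).congr (Eventually.of_forall fun ω => ?_)
  simp only [Pi.add_apply, Complex.coe_algebraMap]
  rw [mul_comm, Complex.re_add_im]

theorem IsHermitianGaussianFamily.integral_process (h : IsHermitianGaussianFamily P X)
    (t : E × Fin N × Fin N × Bool) : ∫ ω, (if t.2.2.2 then (X t.1 ω t.2.1 t.2.2.1).re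
      else (X t.1 ω t.2.1 t.2.2.1).im) ∂P = 0 := by
  obtain ⟨f, i, j, b⟩ := t
  have h1 := h.centered f i j
  cases b
  · have := integral_im (h.integrable f i j)
    rw [h1] at this
    simpa using this
  · have := integral_re (h.integrable f i j)
    rw [h1] at this
    simpa using this

theorem IsHermitianGaussianFamily.conj_entry (h : IsHermitianGaussianFamily P X) (f : E)
    (i j : Fin N) : ∀ᵐ ω ∂P, (starRingEnd ℂ) (X f ω i j) = X f ω j i := by
  filter_upwards [h.hermitian f] with ω hω
  exact hω.apply j i

theorem IsHermitianGaussianFamily.conj_covariance (h : IsHermitianGaussianFamily P X) (f g : E)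
    (i j k l : Fin N) : (starRingEnd ℂ) (∫ ω, X f ω i j * X g ω k l ∂P) =
      ∫ ω, X f ω j i * X g ω l k ∂P := by
  rw [← integral_conj]
  refine integral_congr_ae ?_
  filter_upwards [h.conj_entry f i j, h.conj_entry g k l] with ω h1 h2
  rw [map_mul, h1, h2]

/-- The hypotheses only concern entries on and above the diagonal; Hermitian symmetry and complex
conjugation provide the others. -/
theorem IsHermitianGaussianFamily.covariance (h : IsHermitianGaussianFamily P X) (f g : E)
    (i j k l : Fin N) : ∫ ω, X f ω i j * X g ω k l ∂P =
      if j = k ∧ i = l then (N : ℂ)⁻¹ * ((inner ℝ f g : ℝ) : ℂ) else 0 := by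
  have key {i j : Fin N} (hij : i ≤ j) (k l : Fin N) : ∫ ω, X f ω i j * X g ω k l ∂P =
      if j = k ∧ i = l then (N : ℂ)⁻¹ * ((inner ℝ f g : ℝ) : ℂ) else 0 := by
    have hconj {l k : Fin N} (hlk : l ≤ k) : ∫ ω, X f ω i j * X g ω k l ∂P =
        if j = k ∧ i = l then (N : ℂ)⁻¹ * ((inner ℝ f g : ℝ) : ℂ) else 0 := by
      rw [if_congr and_comm rfl rfl, ← h.cov_conj f g i j l k hij hlk]
      refine integral_congr_ae ?_
      filter_upwards [h.conj_entry g l k] with ω h1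
      rw [h1]
    rcases le_or_gt l k with hlk | hkl
    · exact hconj hlk
    · rw [if_neg (by rintro ⟨rfl, rfl⟩; exact absurd hij (not_le.mpr hkl))]
      rcases hij.lt_or_eq with hij | rfl
      · exact h.cov f g i j k l hij hkl
      -- For a diagonal entry `cov` does not apply; conjugation moves the second entry below the
      -- diagonal, where the value is already known to be zero.
      · have h1 := h.conj_covariance f g i i k l
        rw [hconj hkl.le, if_neg (by rintro ⟨rfl, rfl⟩; exact lt_irrefl _ hkl)] at h1
        exact (map_eq_zero _).mp h1
  rcases le_total i j with hij | hji
  · exact key hij k l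
  · have h1 := h.conj_covariance f g j i l k
    rw [key hji] at h1
    rw [← h1, apply_ite (starRingEnd ℂ)]
    simp [and_comm]

/-- The entries of the random matrices. -/
def gaussEntry (X : E → Ω → Matrix (Fin N) (Fin N) ℂ) (v : E × Fin N × Fin N) (ω : Ω) : ℂ :=
  X v.1 ω v.2.1 v.2.2

theorem IsHermitianGaussianFamily.covariance_entry (h : IsHermitianGaussianFamily P X)
    (v w : E × Fin N × Fin N) : ∫ ω, gaussEntry X v ω * gaussEntry X w ω ∂P =
      if v.2.2 = w.2.1 ∧ v.2.1 = w.2.2 then (N : ℂ)⁻¹ * ((inner ℝ v.1 w.1 : ℝ) : ℂ) else 0 :=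
  h.covariance _ _ _ _ _ _

/-- Evaluation of polynomials in the entries. -/
def gaussEval (X : E → Ω → Matrix (Fin N) (Fin N) ℂ) :
    MvPolynomial (E × Fin N × Fin N) ℂ →ₐ[ℂ] (Ω → ℂ) := MvPolynomial.aeval (gaussEntry X)

omit [NormedAddCommGroup E] [InnerProductSpace ℝ E] [MeasurableSpace Ω] in
theorem gaussEntry_eq (X : E → Ω → Matrix (Fin N) (Fin N) ℂ) (v : E × Fin N × Fin N) (ω : Ω) :
    gaussEntry X v ω = ((X v.1 ω v.2.1 v.2.2).re : ℂ) +
      Complex.I * ((X v.1 ω v.2.1 v.2.2).im : ℂ) := by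
  rw [mul_comm, Complex.re_add_im, gaussEntry]

variable (E) in
/-- The letters for polynomials in Hermitian Gaussian random matrices: the matrices and scalar
multiples of the unit matrix. -/
inductive GaussLetter where
  | matrix (f : E)
  | scalar (c : ℂ)

/-- The product of two letters is the covariance. -/
instance : Mul (GaussLetter E) where
  mul
    | .matrix f, .matrix g => .scalar ((inner ℝ f g : ℝ) : ℂ)
    -- A scalar letter stands for a constant matrix, which has no covariance with anything.
    | _, _ => .scalar 0

/-- The corresponding letter in the semi-circular algebra. -/
def GaussLetter.toSemi : GaussLetter E → SemiLetter E
  | .matrix f => ⟨toCpx f, 0⟩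
  | .scalar c => ⟨0, c⟩

theorem GaussLetter.toSemi_mul (x y : GaussLetter E) :
    (x * y).toSemi = x.toSemi * y.toSemi := by
  rcases x with f | c <;> rcases y with g | c'
  · change SemiLetter.mk _ _ = SemiLetter.mk _ _
    simp [GaussLetter.toSemi, toCpx, cpxBilin_tmul]
  all_goals
    change SemiLetter.mk _ _ = SemiLetter.mk _ _
    simp [GaussLetter.toSemi]

/-- The normalized trace of the scalar part of a letter. -/
def GaussLetter.mean : GaussLetter E → ℂ
  | .matrix _ => 0
  | .scalar c => c

open MvPolynomial in
/-- The random matrix of a letter, with indeterminates as entries. -/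
def GaussLetter.mat (N : ℕ) :
    GaussLetter E → Matrix (Fin N) (Fin N) (MvPolynomial (E × Fin N × Fin N) ℂ)
  | .matrix f => Matrix.of fun i j => MvPolynomial.X (f, i, j)
  | .scalar c => c • 1

open MvPolynomial in
/-- The derivation of integration by parts with respect to an entry. -/
def GaussLetter.deriv (P : Measure Ω) (X : E → Ω → Matrix (Fin N) (Fin N) ℂ) (i j : Fin N) :
    GaussLetter E →
    Derivation ℂ (MvPolynomial (E × Fin N × Fin N) ℂ) (MvPolynomial (E × Fin N × Fin N) ℂ)
  | .matrix f => mkDerivation ℂ fun v => C (∫ ω, gaussEntry X (f, i, j) ω * gaussEntry X v ω ∂P)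
  | .scalar _ => 0

theorem IsHermitianGaussianFamily.hasMoments (h : IsHermitianGaussianFamily P X)
    (q : MvPolynomial (E × Fin N × Fin N) ℂ) : HasMoments P (gaussEval X q) :=
  hasMoments_aeval_complex h.gaussian (r := fun v => (v.1, v.2.1, v.2.2, true))
    (r' := fun v => (v.1, v.2.1, v.2.2, false)) (z := fun _ => Complex.I)
    (gaussEntry_eq X) q

-- By Gaussian integration by parts the covariance of the entries `(a, b)` and `(k, l)` forces `a =
-- l` and `b = k`; the second condition is the entry `(k, b)` of the scalar matrix attached to the
-- product of the letters.
open MvPolynomial in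
theorem IsHermitianGaussianFamily.isMatrixSchwingerDyson (h : IsHermitianGaussianFamily P X) :
    IsMatrixSchwingerDyson GaussLetter.mean (expectation P
      (gaussEval X) fun q => (h.hasMoments q).integrable)
      (GaussLetter.mat N) (fun d a b => d.deriv P X a b) where
  one := by
    have := h.gaussian.isProbabilityMeasure
    simp [expectation_apply]
  parts d B := by
    rcases d with f | c
    · have h1 (a b : Fin N) := complex_gaussian_integration_by_parts h.gaussian h.integral_process
        (Y := gaussEntry X) (r := fun v => (v.1, v.2.1, v.2.2, true))
        (r' := fun v => (v.1, v.2.1, v.2.2, false)) (z := fun _ => Complex.I)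
        (gaussEntry_eq X) (f, a, b) (B b a)
      simp only [GaussLetter.mean, zero_mul, zero_add, Matrix.trace, Matrix.diag_apply,
        Matrix.mul_apply, map_sum, GaussLetter.mat, Matrix.of_apply, expectation_apply,
        gaussEval, h1]
      rfl
    · simp [GaussLetter.mean, GaussLetter.mat, GaussLetter.deriv]
  deriv d a b g k l := by
    rcases d with f | c <;> rcases g with g | c'
    · change mkDerivation ℂ _ (MvPolynomial.X (g, k, l)) = if a = l then
        (N : ℂ)⁻¹ • (((inner ℝ g f : ℝ) : ℂ) • (1 : Matrix (Fin N) (Fin N) _)) k b else 0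
      rw [mkDerivation_X, h.covariance_entry, real_inner_comm]
      rcases eq_or_ne a l with rfl | hal <;> rcases eq_or_ne b k with rfl | hbk
      · rw [if_pos ⟨rfl, rfl⟩, if_pos rfl, Matrix.smul_apply, Matrix.one_apply_eq, smul_smul,
          ← algebraMap_eq, Algebra.algebraMap_eq_smul_one]
      · simp [hbk, hbk.symm]
      · simp [hal]
      · simp [hal]
    · change mkDerivation ℂ _ ((c' • (1 : Matrix (Fin N) (Fin N) _)) k l) = if a = l then
        (N : ℂ)⁻¹ • ((0 : ℂ) • (1 : Matrix (Fin N) (Fin N) _)) k b else 0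
      by_cases hkl : k = l <;> simp [hkl, Matrix.one_apply]
    all_goals
      change 0 = if a = l then
        (N : ℂ)⁻¹ • ((0 : ℂ) • (1 : Matrix (Fin N) (Fin N) _)) k b else 0
      simp

theorem hasSecondOrderLimit_semi {I : Type*} (ℓ : I → E) {Ω : ℕ → Type*}
    [∀ N, MeasurableSpace (Ω N)] {P : ∀ N, Measure (Ω N)}
    {X : ∀ N, E → Ω N → Matrix (Fin N) (Fin N) ℂ} (h : ∀ N, IsHermitianGaussianFamily (P N) (X N)) :
    HasSecondOrderLimit P (fun N i => X N (ℓ i)) (semiPhi E) (semiRho E)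
      (fun i => omega (toCpx (ℓ i))) := by
  have hW (W : List I) : (W.map fun i => omega (toCpx (ℓ i))).prod =
      semiHom E (freeWord (W.map fun i => (GaussLetter.matrix (ℓ i)).toSemi)) := by
    simp only [freeWord, map_list_prod, List.map_map, Function.comp_def, GaussLetter.toSemi,
      semiHom_ι]
  refine hasSecondOrderLimit_of_parts (ψ := SemiLetter.scalar) (semiScalar_mul_comm E)
    (θ := GaussLetter.toSemi) GaussLetter.toSemi_mul (fun i => GaussLetter.matrix (ℓ i))
    (isSecondOrderSpace_semi E) (fun W => ?_) (fun W Z => ?_)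
    (fun N => gaussEval (X N))
    (fun N q => ((h N).hasMoments q).integrable) (fun N => GaussLetter.mat N) (fun N i ω => ?_)
    (fun N => (h N).isMatrixSchwingerDyson) (fun d => ?_)
  · rw [hW, semiPhi_hom, phiFree_freeWord]
  · rw [hW, hW, semiRho_hom, rhoFree_freeWord]
  · ext k l
    simp [GaussLetter.mat, gaussEval, gaussEntry]
  · refine tendsto_const_nhds.congr fun N => ?_
    rcases d with f | c <;> rfl

end Hermitian

/-! ### Compound Wishart matrices -/

section Wishart

open MvPolynomial

variable {Ω : Type*} [MeasurableSpace Ω] {P : Measure Ω} {N : ℕ} {X : Ω → Matrix (Fin N) (Fin N) ℂ}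

/-- The real and imaginary parts of the entries. -/
def ginibreReal (X : Ω → Matrix (Fin N) (Fin N) ℂ) (t : Fin N × Fin N × Bool) (ω : Ω) : ℝ :=
  if t.2.2 then (X ω t.1 t.2.1).re else (X ω t.1 t.2.1).im

/-- The entries and their conjugates. -/
def ginibreEntry (X : Ω → Matrix (Fin N) (Fin N) ℂ) (v : Fin N × Fin N × Bool) (ω : Ω) : ℂ :=
  if v.2.2 then X ω v.1 v.2.1 else (starRingEnd ℂ) (X ω v.1 v.2.1)

theorem IsComplexGaussianMatrix.hasLaw (h : IsComplexGaussianMatrix P X)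
    (t : Fin N × Fin N × Bool) :
    HasLaw (ginibreReal X t) (gaussianReal 0 (2 * (N : ℝ≥0))⁻¹) P := by
  obtain ⟨i, j, b⟩ := t
  cases b
  · exact (h.law i j).2
  · exact (h.law i j).1

theorem IsComplexGaussianMatrix.gaussian_real (h : IsComplexGaussianMatrix P X) :
    IsGaussianProcess (ginibreReal X) P where
  hasGaussianLaw I := by
    have h1 : HasGaussianLaw (fun ω => (ginibreReal X · ω)) P :=
      iIndepFun.hasGaussianLaw (fun t => (h.hasLaw t).hasGaussianLaw) h.indep
    exact h1.map_fun (ContinuousLinearMap.pi fun i : I => ContinuousLinearMap.proj (i : Fin N × Fin N × Bool))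

theorem IsComplexGaussianMatrix.centered_real (h : IsComplexGaussianMatrix P X)
    (t : Fin N × Fin N × Bool) : ∫ ω, ginibreReal X t ω ∂P = 0 := by
  rw [(h.hasLaw t).integral_eq, integral_id_gaussianReal]

theorem IsComplexGaussianMatrix.covariance_real (h : IsComplexGaussianMatrix P X)
    (s t : Fin N × Fin N × Bool) : ∫ ω, ginibreReal X s ω * ginibreReal X t ω ∂P =
      if s = t then (2 * (N : ℝ))⁻¹ else 0 := by
  have hm (t) := (h.gaussian_real.hasGaussianLaw_eval t).aemeasurable
  split_ifs with hst
  · subst hst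
    have := (h.hasLaw s).variance_eq
    rw [variance_of_integral_eq_zero (hm s) (h.centered_real s), variance_id_gaussianReal] at this
    simp only [pow_two] at this
    rw [this]
    simp
  · have h1 : IndepFun (ginibreReal X s) (ginibreReal X t) P := h.indep.indepFun hst
    have := h1.integral_mul_eq_mul_integral (𝕜 := ℝ) (hm s).aestronglyMeasurable
      (hm t).aestronglyMeasurable
    rw [h.centered_real, zero_mul] at this
    exact this

/-- The imaginary unit or its conjugate. -/
def ginibreSign (v : Fin N × Fin N × Bool) : ℂ := if v.2.2 then Complex.I else -Complex.I

omit [MeasurableSpace Ω] in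
theorem ginibreEntry_eq (X : Ω → Matrix (Fin N) (Fin N) ℂ) (v : Fin N × Fin N × Bool) (ω : Ω) :
    ginibreEntry X v ω = (ginibreReal X (v.1, v.2.1, true) ω : ℂ) +
      ginibreSign v * (ginibreReal X (v.1, v.2.1, false) ω : ℂ) := by
  obtain ⟨i, j, b⟩ := v
  apply Complex.ext <;> cases b <;> simp [ginibreEntry, ginibreReal, ginibreSign]

/-- Real and imaginary parts have equal variances, so they cancel between two conjugate entries and
add up between an entry and its own conjugate. -/
theorem IsComplexGaussianMatrix.covariance (h : IsComplexGaussianMatrix P X)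
    (i j k l : Fin N) (b : Bool) :
    ∫ ω, ginibreEntry X (i, j, false) ω * ginibreEntry X (k, l, b) ω ∂P =
      if i = k ∧ j = l ∧ b = true then (N : ℂ)⁻¹ else 0 := by
  rw [integral_complex_gaussian h.gaussian_real (ginibreEntry_eq X)]
  simp only [h.covariance_real]
  by_cases hik : i = k <;> by_cases hjl : j = l <;> cases b <;>
    simp [hik, hjl, ginibreSign, ← mul_assoc, ← two_mul]
  ring

/-- Evaluation of polynomials in the entries and their conjugates. -/
def ginibreEval (X : Ω → Matrix (Fin N) (Fin N) ℂ) :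
    MvPolynomial (Fin N × Fin N × Bool) ℂ →ₐ[ℂ] (Ω → ℂ) := aeval (ginibreEntry X)

theorem IsComplexGaussianMatrix.hasMoments (h : IsComplexGaussianMatrix P X)
    (q : MvPolynomial (Fin N × Fin N × Bool) ℂ) : HasMoments P (ginibreEval X q) :=
  hasMoments_aeval_complex h.gaussian_real (ginibreEntry_eq X) q

/-- The matrix of the entries. -/
def ginibreMat (N : ℕ) : Matrix (Fin N) (Fin N) (MvPolynomial (Fin N × Fin N × Bool) ℂ) :=
  Matrix.of fun i j => MvPolynomial.X (i, j, true)

/-- A deterministic matrix, with constant polynomials as entries. -/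
def constMat (M : Matrix (Fin N) (Fin N) ℂ) :
    Matrix (Fin N) (Fin N) (MvPolynomial (Fin N × Fin N × Bool) ℂ) := M.map C

/-- The adjoint of the matrix of the entries. -/
def ginibreMatStar (N : ℕ) : Matrix (Fin N) (Fin N) (MvPolynomial (Fin N × Fin N × Bool) ℂ) :=
  Matrix.of fun i j => MvPolynomial.X (j, i, false)

/-- The derivation of integration by parts with respect to a conjugate entry. -/
def ginibreDeriv (N : ℕ) (i j : Fin N) : Derivation ℂ (MvPolynomial (Fin N × Fin N × Bool) ℂ)
    (MvPolynomial (Fin N × Fin N × Bool) ℂ) :=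
  mkDerivation ℂ fun v => C (if i = v.1 ∧ j = v.2.1 ∧ v.2.2 = true then (N : ℂ)⁻¹ else 0)

theorem ginibreDeriv_star (i j k l : Fin N) : ginibreDeriv N i j (ginibreMatStar N k l) = 0 := by
  simp [ginibreDeriv, ginibreMatStar, mkDerivation_X]

theorem ginibreDeriv_mul (M : Matrix (Fin N) (Fin N) ℂ) (i j k l : Fin N) :
    ginibreDeriv N i j ((constMat M * ginibreMat N) k l) =
      if j = l then (N : ℂ)⁻¹ • C (M k i) else 0 := by
  rw [Matrix.mul_apply, map_sum, Finset.sum_eq_single i]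
  · rw [constMat, Matrix.map_apply, C_mul', Derivation.map_smul, ginibreDeriv, ginibreMat, Matrix.of_apply,
      mkDerivation_X]
    by_cases hjl : j = l
    · simp [hjl, smul_eq_C_mul, mul_comm]
    · simp [hjl]
  · intro m _ hm
    rw [constMat, Matrix.map_apply, C_mul', Derivation.map_smul, ginibreDeriv, ginibreMat, Matrix.of_apply,
      mkDerivation_X]
    simp [hm.symm]
  · simp

theorem IsComplexGaussianMatrix.integration_by_parts (h : IsComplexGaussianMatrix P X)
    (i j : Fin N) (q : MvPolynomial (Fin N × Fin N × Bool) ℂ) :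
    ∫ ω, ginibreEval X (ginibreMatStar N j i * q) ω ∂P =
      ∫ ω, ginibreEval X (ginibreDeriv N i j q) ω ∂P := by
  have h1 := complex_gaussian_integration_by_parts h.gaussian_real h.centered_real
    (ginibreEntry_eq X) (i, j, false) q
  simp only [h.covariance] at h1
  exact h1

variable {p : ℕ}

/-- The compound Wishart matrix of a word. -/
def wishartMat (M : Fin p → Matrix (Fin N) (Fin N) ℂ) (w : FreeMonoid (Fin p)) :
    Matrix (Fin N) (Fin N) (MvPolynomial (Fin N × Fin N × Bool) ℂ) :=
  ginibreMatStar N * (constMat (FreeMonoid.lift M w) * ginibreMat N)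

/-- The derivation of integration by parts for a compound Wishart matrix. -/
def wishartDeriv (M : Fin p → Matrix (Fin N) (Fin N) ℂ) (w : FreeMonoid (Fin p)) (a b : Fin N) :
    Derivation ℂ (MvPolynomial (Fin N × Fin N × Bool) ℂ)
      (MvPolynomial (Fin N × Fin N × Bool) ℂ) :=
  ∑ i, (constMat (FreeMonoid.lift M w) * ginibreMat N) i b • ginibreDeriv N i a

theorem wishartDeriv_apply (M : Fin p → Matrix (Fin N) (Fin N) ℂ) (w : FreeMonoid (Fin p))
    (a b : Fin N) (q : MvPolynomial (Fin N × Fin N × Bool) ℂ) : wishartDeriv M w a b q =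
      ∑ i, (constMat (FreeMonoid.lift M w) * ginibreMat N) i b * ginibreDeriv N i a q := by
  rw [wishartDeriv]
  generalize (Finset.univ : Finset (Fin N)) = S
  induction S using Finset.induction_on with
  | empty => simp
  | insert i S hi ih => simp [Finset.sum_insert hi, ih]

/-- Integration by parts is performed in the entries of the factor X*. Letters are words in the
deterministic matrices because contracting X* of one Wishart factor with X of another multiplies
their inner matrices. -/
theorem IsComplexGaussianMatrix.isMatrixSchwingerDyson (h : IsComplexGaussianMatrix P X)
    [IsProbabilityMeasure P] (M : Fin p → Matrix (Fin N) (Fin N) ℂ) :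
    IsMatrixSchwingerDyson (fun w => (N : ℂ)⁻¹ * (FreeMonoid.lift M w).trace)
      (expectation P (ginibreEval X) fun q => (h.hasMoments q).integrable)
      (wishartMat M) (wishartDeriv M) where
  one := by simp [expectation_apply]
  parts w B := by
    set E := expectation P (ginibreEval X) fun q => (h.hasMoments q).integrable with hE
    set A := constMat (FreeMonoid.lift M w) * ginibreMat N with hA
    have h1 (i a : Fin N) (q) : E (ginibreMatStar N a i * q) = E (ginibreDeriv N i a q) :=
      h.integration_by_parts i a q
    have h2 : (wishartMat M w * B).trace =
        ∑ a, ∑ b, ∑ i, ginibreMatStar N a i * (A i b * B b a) := by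
      rw [wishartMat, ← hA, Matrix.trace]
      simp only [Matrix.diag_apply, Matrix.mul_apply]
      simp only [Finset.sum_mul, mul_assoc]
    rw [h2]
    simp only [map_sum, h1, Derivation.leibniz, smul_eq_mul, map_add, Finset.sum_add_distrib]
    rw [add_comm]
    congr 1
    -- The contraction of X* with the X of the same Wishart factor closes the inner matrix to its
    -- normalized trace; this is the mean of the letter.
    · have h3 (a b : Fin N) : ∑ i, E (B b a * ginibreDeriv N i a (A i b)) =
          if a = b then (N : ℂ)⁻¹ * (FreeMonoid.lift M w).trace * E (B b a) else 0 := by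
        simp only [hA, ginibreDeriv_mul]
        generalize FreeMonoid.lift M w = Q
        split_ifs with hab
        · simp only [mul_comm (B b a), smul_mul_assoc, C_mul', map_smul, smul_eq_mul]
          rw [← Finset.mul_sum, ← Finset.sum_mul, mul_assoc]
          rfl
        · simp
      simp only [h3, Finset.sum_ite_eq, Finset.mem_univ, if_true, Matrix.trace, Matrix.diag_apply,
        map_sum, Finset.mul_sum]
    · simp only [wishartDeriv_apply, map_sum, ← hA]
  deriv w a b g k l := by
    have h1 (i : Fin N) : ginibreDeriv N i a (wishartMat M g k l) =
        if a = l then (N : ℂ)⁻¹ • (ginibreMatStar N * constMat (FreeMonoid.lift M g)) k i else 0 := by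
      rw [wishartMat, Matrix.mul_apply, map_sum]
      simp only [Derivation.leibniz, ginibreDeriv_star, add_zero, ginibreDeriv_mul,
        smul_eq_mul, mul_ite, mul_zero]
      split_ifs with hal
      · simp only [Matrix.mul_apply, Finset.smul_sum, mul_smul_comm, constMat, Matrix.map_apply]
      · simp
    rw [wishartDeriv_apply]
    simp only [h1, mul_ite, mul_zero]
    split_ifs with hal
    -- The derivative removes the X of the letter `g`; the remaining X* M_g is followed by M_w X
    -- from the differentiating letter.
    · have h2 : wishartMat M (g * w) = ginibreMatStar N * constMat (FreeMonoid.lift M g) *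
          (constMat (FreeMonoid.lift M w) * ginibreMat N) := by
        rw [wishartMat, map_mul, constMat, Matrix.map_mul]
        simp only [Matrix.mul_assoc, constMat]
      rw [h2, Matrix.mul_apply, Finset.smul_sum]
      refine Finset.sum_congr rfl fun i _ => ?_
      rw [mul_smul_comm, mul_comm]
    · simp

omit [MeasurableSpace Ω] in
theorem ginibreEval_wishartMat (X : Ω → Matrix (Fin N) (Fin N) ℂ)
    (M : Fin p → Matrix (Fin N) (Fin N) ℂ) (i : Fin p) (ω : Ω) :
    (X ω).conjTranspose * M i * X ω =
      (wishartMat M (FreeMonoid.of i)).map fun q => ginibreEval X q ω := by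
  ext k l
  rw [Matrix.mul_assoc]
  simp [wishartMat, Matrix.mul_apply, ginibreEval, ginibreMat, ginibreMatStar, constMat, aeval_cproc_apply,
    ginibreEntry]

end Wishart

/-- Convergence in distribution of the deterministic matrices enters only as convergence of the
means of the letters, one for each word. -/
theorem hasSecondOrderLimit_poisson {D : Type*} [Ring D] [StarRing D] [Algebra ℂ D] [StarModule ℂ D]
    (ψ : TracialState D) {p : ℕ} (d : Fin p → D) {I : Type*} (ℓ : I → Fin p) {Ω : ℕ → Type*}
    [∀ N, MeasurableSpace (Ω N)] {P : ∀ N, Measure (Ω N)} [∀ N, IsProbabilityMeasure (P N)]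
    {X : ∀ N, Ω N → Matrix (Fin N) (Fin N) ℂ} {M : ∀ N : ℕ, Fin p → Matrix (Fin N) (Fin N) ℂ}
    (h : ∀ N, IsComplexGaussianMatrix (P N) (X N)) (hM : ConvergesInDistribution M ψ d) :
    HasSecondOrderLimit P (fun N i ω => (X N ω).conjTranspose * M N (ℓ i) * X N ω)
      (poissonPhi ψ) (poissonRho ψ) (fun i => poisson ψ (d (ℓ i))) := by
  have hW (W : List I) : (W.map fun i => poisson ψ (d (ℓ i))).prod =
      poissonHom ψ (freeWord (W.map fun i => FreeMonoid.lift d (FreeMonoid.of (ℓ i)))) := by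
    simp [freeWord, map_list_prod, Function.comp_def, poissonHom]
  refine hasSecondOrderLimit_of_parts (ψ := ψ.toFun) ψ.trace
    (θ := FreeMonoid.lift d) (map_mul _) (fun i => FreeMonoid.of (ℓ i))
    (isSecondOrderSpace_poisson ψ) (fun W => ?_) (fun W Z => ?_)
    (fun N => ginibreEval (X N)) (fun N q => ((h N).hasMoments q).integrable)
    (fun N => wishartMat (M N)) (fun N i ω => ginibreEval_wishartMat (X N) (M N) (ℓ i) ω)
    (fun N => (h N).isMatrixSchwingerDyson (M N)) (fun w => ?_)
  · rw [hW, poissonPhi_hom, phiFree_freeWord]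
  · rw [hW, hW, poissonRho_hom, rhoFree_freeWord]
  · simp only [FreeMonoid.lift_apply]
    exact hM w.toList

end

end SecondOrder

open SecondOrder in
theorem mainTheorem9 :
    -- orthogonal families of Hermitian Gaussian random matrices
    (∀ (E : Type u) [NormedAddCommGroup E] [InnerProductSpace ℝ E],
      IsSecondOrderSpace (semiPhi E) (semiRho E) ∧
      (∀ (n : ℕ) (K : Fin n → Submodule ℝ E),
        (∀ i j, i ≠ j → ∀ f ∈ K i, ∀ g ∈ K j, inner ℝ f g = 0) →
        IsSecondOrderFree (semiPhi E) (semiRho E)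
          (fun i => Algebra.adjoin ℂ (Set.range fun f : K i => omega (toCpx (f : E))))) ∧
      (∀ (n : ℕ) (K : Fin n → Submodule ℂ (Cpx E)),
        (∀ i, ∀ f ∈ K i, cpxConj E f ∈ K i) →
        (∀ i j, i ≠ j → ∀ f ∈ K i, ∀ g ∈ K j, cpxInner E f g = 0) →
        IsSecondOrderFree (semiPhi E) (semiRho E)
          (fun i => Algebra.adjoin ℂ (Set.range fun f : K i => omega (f : Cpx E)))) ∧
      (∀ (Ω : ℕ → Type w) [∀ N, MeasurableSpace (Ω N)] (P : ∀ N, Measure (Ω N))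
        [∀ N, IsProbabilityMeasure (P N)] (X : ∀ N, E → Ω N → Matrix (Fin N) (Fin N) ℂ),
        (∀ N, IsHermitianGaussianFamily (P N) (X N)) →
        HasSecondOrderLimit P X (semiPhi E) (semiRho E) (fun f => omega (toCpx f)) ∧
        ∀ (n : ℕ) (K : Fin n → Submodule ℝ E),
          (∀ i j, i ≠ j → ∀ f ∈ K i, ∀ g ∈ K j, inner ℝ f g = 0) →
          AsymptoticallyFreeSecondOrder.{u} P (fun N i (f : K i) => X N (f : E)))) ∧
    -- compound Wishart matrices
    (∀ (D : Type u) [Ring D] [StarRing D] [Algebra ℂ D] [StarModule ℂ D] (ψ : TracialState D)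
      (p : ℕ) (d : Fin p → D),
      IsSecondOrderSpace (poissonPhi ψ) (poissonRho ψ) ∧
      ((∀ i j, i ≠ j → d i * d j = 0) →
        IsSecondOrderFree (poissonPhi ψ) (poissonRho ψ)
          (fun i => Algebra.adjoin ℂ {poisson ψ (d i)})) ∧
      (∀ (Ω : ℕ → Type w) [∀ N, MeasurableSpace (Ω N)] (P : ∀ N, Measure (Ω N))
        [∀ N, IsProbabilityMeasure (P N)] (X : ∀ N, Ω N → Matrix (Fin N) (Fin N) ℂ)
        (M : ∀ N : ℕ, Fin p → Matrix (Fin N) (Fin N) ℂ),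
        (∀ N, IsComplexGaussianMatrix (P N) (X N)) → ConvergesInDistribution M ψ d →
        HasSecondOrderLimit P (fun N i ω => (X N ω).conjTranspose * M N i * X N ω)
          (poissonPhi ψ) (poissonRho ψ) (fun i => poisson ψ (d i)) ∧
        ((∀ i j, i ≠ j → d i * d j = 0) →
          AsymptoticallyFreeSecondOrder.{u} P
            (fun N i (_ : Unit) ω => (X N ω).conjTranspose * M N i * X N ω)))) := by
  refine ⟨fun E _ _ => ⟨isSecondOrderSpace_semi E, fun n K hK => isSecondOrderFree_semi_real E K hK,
    fun n K hc hK => isSecondOrderFree_semi_complex E K hc hK, fun Ω _ P _ X h =>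
      ⟨hasSecondOrderLimit_semi id h, fun n K hK =>
        ⟨SemiAlg E, inferInstance, inferInstance, semiPhi E, semiRho E,
          fun i f => omega (toCpx (f : E)),
          hasSecondOrderLimit_semi (fun s : Σ i, K i => (s.2 : E)) h,
          isSecondOrderFree_semi_real E K hK⟩⟩⟩,
    fun D _ _ _ _ ψ p d => ⟨isSecondOrderSpace_poisson ψ, isSecondOrderFree_poisson ψ d,
      fun Ω _ P _ X M h hM => ⟨hasSecondOrderLimit_poisson ψ d id h hM, fun hd =>
        ⟨PoissonAlg ψ, inferInstance, inferInstance, poissonPhi ψ, poissonRho ψ,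
          fun i _ => poisson ψ (d i),
          hasSecondOrderLimit_poisson ψ d (fun s : Σ _ : Fin p, Unit => s.1) h hM, ?_⟩⟩⟩⟩
  -- Each family has one member, indexed by `Unit`, so its range is a singleton.
  simpa only [Set.range_const] using isSecondOrderFree_poisson ψ d hd
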